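/- Let $\Omega\subset\mathbb R^2$ be open, $T>0$ and $Q=\Omega\times(0,T)$. Let $H$ (respectively $V$) be the closure in $L^2(\Omega)$ (respectively $H^1(\Omega)$) of the smooth divergence-free vector fields with compact support in $\Omega$. Let $(u_n)$ be a sequence in $C([0,T];H)$, $u_n(0)=u_n^0$, such that one of the following holds. (E) Each $u_n$ is a weak solution on $[0,T]$ of the Euler equations $\partial_tu_n+\nabla\cdot(u_n\otimes u_n)+\nabla p_n=0$, $\nabla\cdot u_n=0$, with the impermeability condition $\vec n\cdot u_n=0$ on $\partial\Omega$, with $u_n$ and its vorticity bounded on $Q$ and $\nabla u_n\in L^\infty(0,T;L^2(\Omega))$. (NS) Each $u_n$ is a weak solution on $[0,T]$, with $u_n\in L^2(0,T;V)$, of the Navier–Stokes equations $\partial_tu_n+\nabla\cdot(u_n\otimes u_n)+\nabla p_n-\nu_n\Delta u_n=0$, $\nabla\cdot u_n=0$, with $u_n=0$ on $\partial\Omega$, where $\nu_n>0$ and $\nu_n\to0$. Assume that $u_n^0\to u_0$ strongly in $L^2(\Omega)$, that $u_n\to u$ in the weak-$*$ topology of $L^\infty(0,T;L^2(\Omega))$,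 and that $R_{turb}=\lim_n(u_n-u)\otimes(u_n-u)$ exists in the sense of distributions on $Q$. Assume that $u$ is $C^1$ on $\overline\Omega\times(0,T]$, and that the trace-free part $S_{turb}=R_{turb}-\frac12(\operatorname{tr}R_{turb})I$ is a function which is $C^1$ on $\overline\Omega\times(0,T]$ (both being restrictions of $C^1$ maps on $\mathbb R^2\times(0,\infty)$); if $\Omega$ is unbounded assume also that, uniformly for $t$ in each $[s,T]$ with $0<s<T$, $u$ and $\nabla u$ are bounded on $\Omega$, and $u,\partial_tu,\nabla u,S_{turb},\nabla\cdot S_{turb}$ are bounded in $L^2(\Omega)$. Write, on $\overline\Omega\times(0,T]$, $$S_{turb}=-\nu_{turb}\,(\nabla u+{}^t\nabla u)+\delta\,\Phi(u),$$ $$\Phi(u)=\begin{pmatrix}\frac12(\partial_{x_2}u_1+\partial_{x_1}u_2)&\partial_{x_2}u_2\\ \partial_{x_2}u_2&-\frac12(\partial_{x_2}u_1+\partial_{x_1}u_2)\end{pmatrix},$$ with real functions $\nu_{turb}$ and $\delta$, where $\nu_{turb}=\delta=0$ by convention at the points where $\nabla u+{}^t\nabla u=0$. Assume finally that $u(x,t)=0$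 at every $(x,t)\in\partial\Omega\times(0,T]$ at which $\nu_{turb}\ne0$ or $\delta\ne0$. Then the following assertions are equivalent: (i) $u_n\to u$ strongly in $L^2(\Omega\times[0,T])$; (ii) $\nu_{turb}$ is identically zero on $\Omega\times(0,T]$; (iii) $\nu_{turb}\,\frac12|\nabla u+{}^t\nabla u|^2$ is integrable on $Q$ and $$\int_0^T\!\!\int_\Omega\nu_{turb}\,\tfrac12|\nabla u+{}^t\nabla u|^2\,dx\,dt\le0 .$$ If moreover $\nabla u$ is bounded on $\Omega\times(0,T]$ (as when $\Omega$ is bounded and $u$ is $C^1$ on $\overline\Omega\times[0,T]$), they are also equivalent to: $\nu_{turb}|\nabla u|^2$ is integrable on $Q$ and $\int_0^T\!\int_\Omega\nu_{turb}|\nabla u|^2\,dx\,dt\le0$. -/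

import Mathlib

open MeasureTheory Set Filter Topology
open scoped ContDiff ENNReal NNReal

namespace WeakTurbulence

/-- The Euclidean plane. -/
abbrev Plane := EuclideanSpace ℝ (Fin 2)

/-- The space-time cylinder `(0,T) × Ω`. -/
def cylinder (Ω : Set Plane) (T : ℝ) : Set (ℝ × Plane) := Ioo 0 T ×ˢ Ω

/-- `grad v x i j = ∂_j v_i (x)`. -/
noncomputable def grad (v : Plane → Plane) (x : Plane) (i j : Fin 2) : ℝ :=
  fderiv ℝ v x (EuclideanSpace.single j 1) i

/-- `pderiv f x j = ∂_j f (x)` for a scalar function. -/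
noncomputable def pderiv (f : Plane → ℝ) (x : Plane) (j : Fin 2) : ℝ :=
  fderiv ℝ f x (EuclideanSpace.single j 1)

/-- The strain tensor `½ (∇v + ᵗ∇v)`. -/
noncomputable def strain (v : Plane → Plane) (x : Plane) (i j : Fin 2) : ℝ :=
  (grad v x i j + grad v x j i) / 2

/-- The trace-free symmetric tensor orthogonal to the strain of a solenoidal field `v`:
with `b = ½ (∂₂v₁ + ∂₁v₂)`, its rows are `(b, ∂₂v₂)` and `(∂₂v₂, -b)`. -/
noncomputable def strainPerp (v : Plane → Plane) (x : Plane) : Matrix (Fin 2) (Fin 2) ℝ :=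
  !![strain v x 0 1, grad v x 1 1; grad v x 1 1, -strain v x 0 1]

/-! ### Function spaces -/

/-- Smooth solenoidal vector fields with compact support in `Ω`. -/
def IsSolenoidalTest (Ω : Set Plane) (φ : Plane → Plane) : Prop :=
  ContDiff ℝ ∞ φ ∧ HasCompactSupport φ ∧ tsupport φ ⊆ Ω ∧ ∀ x, ∑ i, grad φ x i i = 0

/-- The space `H` of square integrable fields with `∇·v = 0` in `Ω` and `n·v = 0` on `∂Ω`:
the closure in `L²(Ω)` of the smooth compactly supported solenoidal fields. -/
def MemH (Ω : Set Plane) (v : Plane → Plane) : Prop :=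
  MemLp v 2 (volume.restrict Ω) ∧
    ∃ φ : ℕ → Plane → Plane, (∀ k, IsSolenoidalTest Ω (φ k)) ∧
      Tendsto (fun k => eLpNorm (φ k - v) 2 (volume.restrict Ω)) atTop (𝓝 0)

/-- `v` belongs to the space `V` of `H¹` fields with `∇·v = 0` in `Ω` and `v = 0` on `∂Ω`, and has
gradient `G`: `V` is the closure in `H¹(Ω)` of the smooth compactly supported solenoidal fields. -/
def MemV (Ω : Set Plane) (v : Plane → Plane) (G : Plane → Fin 2 → Fin 2 → ℝ) : Prop :=
  MemLp v 2 (volume.restrict Ω) ∧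
  (∀ i j, MemLp (fun x => G x i j) 2 (volume.restrict Ω)) ∧
    ∃ φ : ℕ → Plane → Plane, (∀ k, IsSolenoidalTest Ω (φ k)) ∧
      Tendsto (fun k => eLpNorm (φ k - v) 2 (volume.restrict Ω)) atTop (𝓝 0) ∧
      ∀ i j, Tendsto (fun k => eLpNorm (fun x => grad (φ k) x i j - G x i j) 2
        (volume.restrict Ω)) atTop (𝓝 0)

/-- `G` is the weak gradient of `v` in `Ω`, `G i j = ∂_j v_i`, both being square integrable. -/
def HasWeakGrad (Ω : Set Plane) (v : Plane → Plane) (G : Plane → Fin 2 → Fin 2 → ℝ) : Prop :=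
  MemLp v 2 (volume.restrict Ω) ∧
  (∀ i j, MemLp (fun x => G x i j) 2 (volume.restrict Ω)) ∧
    ∀ f : Plane → ℝ, ContDiff ℝ ∞ f → HasCompactSupport f → tsupport f ⊆ Ω → ∀ i j,
      ∫ x in Ω, v x i * pderiv f x j = -∫ x in Ω, G x i j * f x

/-- `u ∈ C([0,T]; H)` with `u(0) = u₀`. -/
structure IsSolenoidalCurve (Ω : Set Plane) (T : ℝ) (u₀ : Plane → Plane) (u : ℝ → Plane → Plane) :
    Prop where
  measurable : AEStronglyMeasurable (fun p : ℝ × Plane => u p.1 p.2)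
    (volume.restrict (cylinder Ω T))
  memH : ∀ t ∈ Icc 0 T, MemH Ω (u t)
  continuous : ∀ t ∈ Icc 0 T,
    Tendsto (fun s => eLpNorm (u s - u t) 2 (volume.restrict Ω)) (𝓝[Icc 0 T] t) (𝓝 0)
  initial : u 0 =ᵐ[volume.restrict Ω] u₀

/-! ### Solutions of the equations of motion -/

/-- Solution on `[0,T]` of the incompressible Euler equations in `Ω` with the impermeability
condition and initial velocity `u₀`, in the uniqueness class of flows with bounded vorticity:
the velocity is bounded, has gradients bounded in `L²(Ω)` uniformly in time, bounded vorticity, and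
`d/dt ∫ u·φ = ∫ (u ⊗ u) : ∇φ` for all solenoidal test fields `φ`
(which eliminate the pressure gradient). -/
structure IsEulerSolution (Ω : Set Plane) (T : ℝ) (u₀ : Plane → Plane) (u : ℝ → Plane → Plane) :
    Prop where
  curve : IsSolenoidalCurve Ω T u₀ u
  regular : ∃ (G : ℝ → Plane → Fin 2 → Fin 2 → ℝ) (C : ℝ≥0),
    (∀ i j, AEStronglyMeasurable (fun p : ℝ × Plane => G p.1 p.2 i j)
      (volume.restrict (cylinder Ω T))) ∧
    (∀ᵐ t ∂(volume.restrict (Ioo 0 T)), HasWeakGrad Ω (u t) (G t) ∧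
      ∀ i j, eLpNorm (fun x => G t x i j) 2 (volume.restrict Ω) ≤ C) ∧
    (∀ᵐ p ∂(volume.restrict (cylinder Ω T)), ‖u p.1 p.2‖ ≤ C) ∧
    (∀ᵐ p ∂(volume.restrict (cylinder Ω T)), |G p.1 p.2 1 0 - G p.1 p.2 0 1| ≤ C)
  weak_form : ∀ φ, IsSolenoidalTest Ω φ → ∀ t ∈ Icc 0 T,
    (∫ x in Ω, ∑ i, u t x i * φ x i) - ∫ x in Ω, ∑ i, u₀ x i * φ x i =
      ∫ s in (0 : ℝ)..t, ∫ x in Ω, ∑ i, ∑ j, u s x i * u s x j * grad φ x i j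

/-- Solution on `[0,T]` of the incompressible Navier–Stokes equations in `Ω` with viscosity `κ`, the
no-slip boundary condition and initial velocity `u₀`: `u ∈ C([0,T]; H) ∩ L²(0,T; V)` and
`d/dt ∫ u·φ + κ ∫ ∇u : ∇φ = ∫ (u ⊗ u) : ∇φ` for all solenoidal test fields `φ`. -/
structure IsNavierStokesSolution (Ω : Set Plane) (T κ : ℝ) (u₀ : Plane → Plane)
    (u : ℝ → Plane → Plane) : Prop where
  curve : IsSolenoidalCurve Ω T u₀ u
  weak_form : ∃ G : ℝ → Plane → Fin 2 → Fin 2 → ℝ,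
    (∀ i j, MemLp (fun p : ℝ × Plane => G p.1 p.2 i j) 2 (volume.restrict (cylinder Ω T))) ∧
    (∀ᵐ t ∂(volume.restrict (Ioo 0 T)), MemV Ω (u t) (G t)) ∧
    ∀ φ, IsSolenoidalTest Ω φ → ∀ t ∈ Icc 0 T,
      (∫ x in Ω, ∑ i, u t x i * φ x i) - ∫ x in Ω, ∑ i, u₀ x i * φ x i =
        ∫ s in (0 : ℝ)..t, ∫ x in Ω, ∑ i, ∑ j,
          (u s x i * u s x j * grad φ x i j - κ * (G s x i j * grad φ x i j))

/-! ### Limits -/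

/-- `uₙ → u` in the weak-* topology of `L^∞(0,T; L²(Ω))`, the dual of `L¹(0,T; L²(Ω))`. -/
def WeakStarTendsto (Ω : Set Plane) (T : ℝ) (un : ℕ → ℝ → Plane → Plane)
    (u : ℝ → Plane → Plane) : Prop :=
  AEStronglyMeasurable (fun p : ℝ × Plane => u p.1 p.2) (volume.restrict (cylinder Ω T)) ∧
  (∃ C : ℝ≥0, ∀ᵐ t ∂(volume.restrict (Ioo 0 T)), eLpNorm (u t) 2 (volume.restrict Ω) ≤ C) ∧
  ∀ g : ℝ → Plane → Plane,
    AEStronglyMeasurable (fun p : ℝ × Plane => g p.1 p.2) (volume.restrict (cylinder Ω T)) →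
    ∫⁻ t in Ioo 0 T, eLpNorm (g t) 2 (volume.restrict Ω) < (⊤ : ℝ≥0∞) →
    Tendsto (fun n => ∫ p in cylinder Ω T, ∑ i, un n p.1 p.2 i * g p.1 p.2 i) atTop
      (𝓝 (∫ p in cylinder Ω T, ∑ i, u p.1 p.2 i * g p.1 p.2 i))

/-- Strong convergence `uₙ → u` in `L²(Ω × [0,T])`. -/
def StrongTendsto (Ω : Set Plane) (T : ℝ) (un : ℕ → ℝ → Plane → Plane)
    (u : ℝ → Plane → Plane) : Prop :=
  Tendsto (fun n => eLpNorm (fun p : ℝ × Plane => un n p.1 p.2 - u p.1 p.2) 2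
    (volume.restrict (cylinder Ω T))) atTop (𝓝 0)

/-- Scalar test functions on `(0,T) × Ω`. -/
def IsScalarTest (Ω : Set Plane) (T : ℝ) (ψ : ℝ × Plane → ℝ) : Prop :=
  ContDiff ℝ ∞ ψ ∧ HasCompactSupport ψ ∧ tsupport ψ ⊆ cylinder Ω T

/-- `R` is the turbulent Reynolds tensor `lim (uₙ - u) ⊗ (uₙ - u)`,
the limit being taken in the sense of distributions on `(0,T) × Ω`. -/
def IsReynoldsTensor (Ω : Set Plane) (T : ℝ) (un : ℕ → ℝ → Plane → Plane)
    (u : ℝ → Plane → Plane) (R : Fin 2 → Fin 2 → (ℝ × Plane → ℝ) → ℝ) : Prop :=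
  ∀ ψ, IsScalarTest Ω T ψ → ∀ i j, Tendsto
    (fun n => ∫ p in cylinder Ω T,
      ψ p * ((un n p.1 p.2 i - u p.1 p.2 i) * (un n p.1 p.2 j - u p.1 p.2 j))) atTop
    (𝓝 (R i j ψ))

/-- The trace-free part `R - ½ (tr R) I` of the distribution `R` is given by the function `S`. -/
def IsTraceFreePart (Ω : Set Plane) (T : ℝ) (R : Fin 2 → Fin 2 → (ℝ × Plane → ℝ) → ℝ)
    (S : ℝ → Plane → Fin 2 → Fin 2 → ℝ) : Prop :=
  ∀ ψ, IsScalarTest Ω T ψ → ∀ i j,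
    R i j ψ - (if i = j then (R 0 0 ψ + R 1 1 ψ) / 2 else 0) =
      ∫ p in cylinder Ω T, ψ p * S p.1 p.2 i j

/-! ### Regularity of the limit -/

/-- `u` is of class `C¹` on `(0,T] × closure Ω` (being the restriction of a `C¹` map), with
`u`, `∇u` bounded and `u`, `∂ₜu`, `∇u` bounded in `L²(Ω)`, uniformly on each `[s,T]`, `0 < s`.
When `Ω` is bounded the bounds are consequences of the first condition. -/
structure IsRegularVelocity (Ω : Set Plane) (T : ℝ) (u : ℝ → Plane → Plane) : Prop where
  contDiff : ContDiffOn ℝ 1 (fun p : ℝ × Plane => u p.1 p.2) (Ioi 0 ×ˢ univ)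
  bounds : ∀ s ∈ Ioo 0 T, ∃ C : ℝ≥0, ∀ t ∈ Icc s T,
    (∀ x ∈ Ω, ‖u t x‖ ≤ C ∧ ∀ i j, |grad (u t) x i j| ≤ C) ∧
    eLpNorm (u t) 2 (volume.restrict Ω) ≤ C ∧
    eLpNorm (fun x => deriv (fun r => u r x) t) 2 (volume.restrict Ω) ≤ C ∧
    ∀ i j, eLpNorm (fun x => grad (u t) x i j) 2 (volume.restrict Ω) ≤ C

/-- `S` is of class `C¹` on `(0,T] × closure Ω` (being the restriction of a `C¹` map), with
`S` and `∇·S` bounded in `L²(Ω)`, uniformly on each `[s,T]`, `0 < s`.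
When `Ω` is bounded the bounds are consequences of the first condition. -/
structure IsRegularStress (Ω : Set Plane) (T : ℝ) (S : ℝ → Plane → Fin 2 → Fin 2 → ℝ) : Prop where
  contDiff : ∀ i j, ContDiffOn ℝ 1 (fun p : ℝ × Plane => S p.1 p.2 i j) (Ioi 0 ×ˢ univ)
  bounds : ∀ s ∈ Ioo 0 T, ∃ C : ℝ≥0, ∀ t ∈ Icc s T, ∀ i,
    (∀ j, eLpNorm (fun x => S t x i j) 2 (volume.restrict Ω) ≤ C) ∧
    eLpNorm (fun x => ∑ j, pderiv (fun y => S t y i j) x j) 2 (volume.restrict Ω) ≤ C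

end WeakTurbulence

/-!
The proof compares the limit `u` with the initial data through the energy deficit
`r(t) = ‖u₀‖² - ‖u(t)‖²` (`energyDeficit`).

Both kinds of solutions do not increase the energy: Euler solutions conserve it
(`IsEulerSolution.norm_eq`), since they may be tested with themselves, and Navier–Stokes solutions
satisfy the energy inequality (`IsNavierStokesSolution.norm_le`), by Ladyzhenskaya's inequality.
Hence `r ≥ 0`. Moreover `r(0+) = 0`: the velocities are equi-Lipschitz in time in a weak sense, so
that `u(t)` tends weakly to `u₀` while its norm does not exceed that of `u₀`
(`tendsto_toL2_nhdsGT_zero`).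

In the limit, `u` solves the Euler equations with the additional stress `S`, the trace of the
Reynolds tensor being absorbed by the pressure (`inner_limit_sub_eq`). As `u` is smooth, this gives
the energy balance `r(b) - r(a) = -2 ∫ₐᵇ ∫ S : ∇u` (`norm_sq_sub_eq_integral_stressPower`). There is
no contribution of the boundary, where `u` or `S` vanishes. Moreover `S : ∇u = -½ ν |∇u + ᵗ∇u|²`,
since the other component of `S` is orthogonal to the strain (`stress_contraction`), so that the
turbulent viscosity governs the evolution of the deficit.

Conversely the deficit controls the stress. The energy of the fluctuations `uₙ - u` is, in the
limit, at most the deficit (`exists_fluctuation_bound`), and the entries of `(uₙ - u) ⊗ (uₙ - u)` are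
dominated by it. Hence `|∫ η S(t)| ≤ 2 sup |η| r(t)` at each time, and `|r'| ≤ C r` where `C` depends
on the supremum of `∇u` (`abs_stressPower_le`). By Grönwall's inequality, forward and backward in
time, `r` vanishes identically on `(0,T)` as soon as it vanishes at the time `T`; and the vanishing of
`r` is strong convergence (`strongTendsto_of_energyDeficit_eq_zero`).

If the convergence is strong, then `S = 0`, hence `ν |∇u + ᵗ∇u|² = 0` and `ν = 0`. If the integral of
`½ ν |∇u + ᵗ∇u|²` is nonpositive, then so is `r(T)`, which is twice this integral; thus `r(T) = 0` and
the convergence is strong. If `∇u` is bounded up to the time `0`, then Grönwall's inequality starting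
from `r(0+) = 0` shows that `r` vanishes in any case; all the assertions then hold.
-/

namespace WeakTurbulence

section

/-! ### Calculus in the plane -/

lemma pderiv_mul {f g : Plane → ℝ} {x : Plane} (hf : DifferentiableAt ℝ f x)
    (hg : DifferentiableAt ℝ g x) (j : Fin 2) :
    pderiv (fun y => f y * g y) x j = f x * pderiv g x j + pderiv f x j * g x := by
  simp only [pderiv]
  rw [fderiv_fun_mul hf hg]
  simp [mul_comm]

lemma pderiv_add {f g : Plane → ℝ} {x : Plane} (hf : DifferentiableAt ℝ f x)
    (hg : DifferentiableAt ℝ g x) (j : Fin 2) :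
    pderiv (fun y => f y + g y) x j = pderiv f x j + pderiv g x j := by
  simp only [pderiv]
  rw [fderiv_fun_add hf hg]
  simp

lemma pderiv_sum {ι : Type*} {s : Finset ι} {f : ι → Plane → ℝ} {x : Plane}
    (hf : ∀ i ∈ s, DifferentiableAt ℝ (f i) x) (j : Fin 2) :
    pderiv (fun y => ∑ i ∈ s, f i y) x j = ∑ i ∈ s, pderiv (f i) x j := by
  simp only [pderiv]
  rw [fderiv_fun_sum hf]
  simp

lemma pderiv_comp {η : ℝ → ℝ} {f : Plane → ℝ} {x : Plane} (hη : DifferentiableAt ℝ η (f x))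
    (hf : DifferentiableAt ℝ f x) (j : Fin 2) :
    pderiv (fun y => η (f y)) x j = deriv η (f x) * pderiv f x j := by
  have := (hη.hasDerivAt.comp_hasFDerivAt x hf.hasFDerivAt).fderiv
  simp only [Function.comp_def] at this
  simp [pderiv, this]

lemma continuous_pderiv {f : Plane → ℝ} (hf : ContDiff ℝ 1 f) (j : Fin 2) :
    Continuous fun x => pderiv f x j :=
  (hf.continuous_fderiv one_ne_zero).clm_apply continuous_const

lemma contDiff_pderiv {f : Plane → ℝ} (hf : ContDiff ℝ ∞ f) (j : Fin 2) :
    ContDiff ℝ ∞ fun x => pderiv f x j :=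
  (hf.fderiv_right (m := ∞) (by simp)).clm_apply contDiff_const

lemma tsupport_pderiv_subset (f : Plane → ℝ) (j : Fin 2) :
    tsupport (fun x => pderiv f x j) ⊆ tsupport f := by
  refine closure_minimal (fun x hx => ?_) isClosed_closure
  by_contra h
  refine hx ?_
  have : fderiv ℝ f x = 0 := by
    by_contra h'
    exact h (support_fderiv_subset ℝ h')
  simp [pderiv, this]

lemma hasCompactSupport_pderiv {f : Plane → ℝ} (hf : HasCompactSupport f) (j : Fin 2) :
    HasCompactSupport fun x => pderiv f x j :=
  hf.mono' ((subset_tsupport _).trans (tsupport_pderiv_subset f j))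

lemma contDiff_component {n : WithTop ℕ∞} {v : Plane → Plane} (hv : ContDiff ℝ n v) (i : Fin 2) :
    ContDiff ℝ n fun x => v x i := by
  have := contDiff_euclidean.1 hv i
  exact this

lemma tsupport_component_subset (v : Plane → Plane) (i : Fin 2) :
    tsupport (fun x => v x i) ⊆ tsupport v :=
  closure_mono fun x hx h => hx (by simp [h])

lemma hasCompactSupport_component {v : Plane → Plane} (hv : HasCompactSupport v) (i : Fin 2) :
    HasCompactSupport fun x => v x i :=
  hv.mono' ((subset_tsupport _).trans (tsupport_component_subset v i))

lemma grad_eq_pderiv {v : Plane → Plane} {x : Plane} (hv : DifferentiableAt ℝ v x) (i j : Fin 2) :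
    grad v x i j = pderiv (fun y => v y i) x j := by
  have : HasFDerivAt (fun y => v y i) ((EuclideanSpace.proj (𝕜 := ℝ) i).comp (fderiv ℝ v x)) x :=
    (EuclideanSpace.proj (𝕜 := ℝ) i).hasFDerivAt.comp x hv.hasFDerivAt
  simp [pderiv, grad, this.fderiv]

lemma norm_fderiv_le_sum_pderiv (f : Plane → ℝ) (x : Plane) :
    ‖fderiv ℝ f x‖ ≤ ∑ j, |pderiv f x j| := by
  refine ContinuousLinearMap.opNorm_le_bound _ (by positivity) fun y => ?_
  have hy : y = ∑ j, y j • (EuclideanSpace.single j (1 : ℝ) : Plane) := by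
    ext k
    fin_cases k <;> simp [Fin.sum_univ_two]
  conv_lhs => rw [hy]
  rw [map_sum, Finset.sum_mul]
  refine (norm_sum_le _ _).trans (Finset.sum_le_sum fun j _ => ?_)
  rw [map_smul, norm_smul, mul_comm, Real.norm_eq_abs]
  exact mul_le_mul_of_nonneg_left (PiLp.norm_apply_le y j) (abs_nonneg _)

lemma integral_mul_pderiv {f g : Plane → ℝ} (hf : ContDiff ℝ 1 f) (hg : ContDiff ℝ 1 g)
    (hc : HasCompactSupport g) (j : Fin 2) :
    ∫ x, f x * pderiv g x j = -∫ x, pderiv f x j * g x := by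
  refine integral_mul_fderiv_eq_neg_fderiv_mul_of_integrable ?_ ?_ ?_
    (fun x _ => hf.differentiable one_ne_zero x) (fun x _ => hg.differentiable one_ne_zero x)
  · exact ((continuous_pderiv hf j).mul hg.continuous).integrable_of_hasCompactSupport
      hc.mul_left
  · exact (hf.continuous.mul (continuous_pderiv hg j)).integrable_of_hasCompactSupport
      (hasCompactSupport_pderiv hc j).mul_left
  · exact (hf.continuous.mul hg.continuous).integrable_of_hasCompactSupport hc.mul_left

lemma integral_pderiv_eq_zero {g : Plane → ℝ} (hg : ContDiff ℝ 1 g) (hc : HasCompactSupport g)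
    (j : Fin 2) : ∫ x, pderiv g x j = 0 := by
  simpa [pderiv] using integral_mul_pderiv (f := fun _ => 1) contDiff_const hg hc j

lemma setIntegral_eq_integral_of_tsupport {Ω : Set Plane} {F : Type*} [NormedAddCommGroup F]
    [NormedSpace ℝ F] {f : Plane → F} (h : tsupport f ⊆ Ω) : ∫ x in Ω, f x = ∫ x, f x :=
  setIntegral_eq_integral_of_forall_compl_eq_zero fun _ hx =>
    image_eq_zero_of_notMem_tsupport fun h' => hx (h h')

/-- Approximations `η_k` of the identity of `ℝ` which vanish near `0`. -/
lemma exists_flat_approx_id : ∃ η : ℕ → ℝ → ℝ, ∃ C : ℝ, (∀ k, ContDiff ℝ ∞ (η k)) ∧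
    (∀ k, ∀ᶠ s in 𝓝 0, η k s = 0) ∧ (∀ k s, |η k s| ≤ |s|) ∧ (∀ k s, |deriv (η k) s| ≤ C) ∧
    (∀ s, ∀ᶠ k in atTop, η k s = s) ∧ ∀ s ≠ 0, ∀ᶠ k in atTop, deriv (η k) s = 1 := by
  let b : ContDiffBump (0 : ℝ) := ⟨1, 2, one_pos, one_lt_two⟩
  let θ : ℝ → ℝ := fun s => s * (1 - b s)
  have hθ : ContDiff ℝ ∞ θ := contDiff_id.mul (contDiff_const.sub b.contDiff)
  have hout : ∀ s : ℝ, 2 < |s| → θ =ᶠ[𝓝 s] id := fun s hs => by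
    have : ∀ᶠ y in 𝓝 s, 2 < |y| := continuousAt_id.abs.eventually (lt_mem_nhds hs)
    filter_upwards [this] with y hy
    simp [θ, b.zero_of_le_dist (show b.rOut ≤ dist y 0 by simpa using hy.le)]
  obtain ⟨C, hC⟩ : ∃ C, ∀ s, |deriv θ s| ≤ C := by
    obtain ⟨C, hC⟩ := (isCompact_Icc (a := (-2 : ℝ)) (b := 2)).exists_bound_of_continuousOn
      (hθ.continuous_deriv (by simp)).continuousOn
    refine ⟨max C 1, fun s => ?_⟩
    by_cases hs : 2 < |s|
    · rw [(hout s hs).deriv_eq]; simp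
    · exact (hC s (abs_le.1 (not_lt.1 hs))).trans (le_max_left _ _)
  let c : ℕ → ℝ := fun k => k + 1
  have hc : ∀ k, 0 < c k := fun k => by positivity
  have hcs : ∀ s ≠ 0, ∀ᶠ k in atTop, 2 < |c k * s| := fun s hs => by
    have : Tendsto (fun k => |c k * s|) atTop atTop := by
      simp only [abs_mul, abs_of_pos (hc _)]
      exact (tendsto_atTop_add_const_right _ _ tendsto_natCast_atTop_atTop).atTop_mul_const
        (abs_pos.2 hs)
    exact this.eventually_gt_atTop 2
  have hder : ∀ k s, deriv (fun s => (c k)⁻¹ * θ (c k * s)) s = deriv θ (c k * s) := fun k s => by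
    have h1 : HasDerivAt (fun s => θ (c k * s)) (deriv θ (c k * s) * c k) s := by
      have := (hθ.differentiable (by simp) (c k * s)).hasDerivAt.comp s
        ((hasDerivAt_id s).const_mul (c k))
      simpa [Function.comp_def] using this
    rw [(h1.const_mul (c k)⁻¹).deriv]
    field_simp [(hc k).ne']
  refine ⟨fun k s => (c k)⁻¹ * θ (c k * s), C, fun k => ?_, fun k => ?_, fun k s => ?_,
    fun k s => ?_, fun s => ?_, fun s hs => ?_⟩
  · exact contDiff_const.mul (hθ.comp (contDiff_const.mul contDiff_id))
  · have : ∀ᶠ s in 𝓝 (0 : ℝ), c k * s ∈ Metric.ball (0 : ℝ) 1 :=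
      (continuous_const.mul continuous_id).continuousAt.eventually
        (Metric.isOpen_ball.mem_nhds (by simp))
    filter_upwards [this] with s hs
    simp [θ, b.one_of_mem_closedBall (Metric.ball_subset_closedBall hs)]
  · have h0 := b.nonneg (x := c k * s)
    have h1 := b.le_one (x := c k * s)
    simp only [θ, abs_mul, abs_inv, abs_of_pos (hc k)]
    rw [← mul_assoc, ← mul_assoc, inv_mul_cancel₀ (hc k).ne', one_mul]
    refine mul_le_of_le_one_right (abs_nonneg _) (abs_le.2 ⟨?_, ?_⟩) <;> linarith
  · simp only [hder]; exact hC _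
  · by_cases hs : s = 0
    · simp [hs, θ]
    · filter_upwards [hcs s hs] with k hk
      rw [(hout _ hk).eq_of_nhds]
      field_simp [(hc k).ne']
      simp
  · filter_upwards [hcs s hs] with k hk
    simp only [hder]
    rw [(hout _ hk).deriv_eq]
    simp

/-- The derivatives of a `C¹` function vanish almost everywhere on its zero set. -/
lemma ae_pderiv_eq_zero {f : Plane → ℝ} (hf : ContDiff ℝ 1 f) (j : Fin 2) :
    ∀ᵐ x, f x = 0 → pderiv f x j = 0 := by
  obtain ⟨η, C, hη, hη0, hηs, hηC, hηlim, hηd⟩ := exists_flat_approx_id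
  have hcp := continuous_pderiv hf j
  have hmeas : MeasurableSet {x | f x = 0} := (isClosed_eq hf.continuous continuous_const).measurableSet
  have hloc : LocallyIntegrable ({x | f x = 0}.indicator fun x => pderiv f x j) :=
    hcp.locallyIntegrable.indicator hmeas
  refine (ae_eq_zero_of_integral_contDiff_smul_eq_zero hloc fun g hg hgc => ?_).mono
    fun x hx h => by simpa [indicator_of_mem (show x ∈ {x | f x = 0} from h)] using hx
  have hg1 : ContDiff ℝ 1 g := hg.of_le (by simp)
  have hηf : ∀ k, ContDiff ℝ 1 fun x => η k (f x) := fun k => ((hη k).of_le (by simp)).comp hf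
  have hcη' : ∀ k, Continuous (deriv (η k)) := fun k => (hη k).continuous_deriv (by simp)
  have hder : ∀ k x, pderiv (fun y => η k (f y)) x j = deriv (η k) (f x) * pderiv f x j :=
    fun k x => pderiv_comp ((hη k).differentiable (by simp) _) (hf.differentiable one_ne_zero x) j
  have hgp : HasCompactSupport fun x => pderiv g x j := hasCompactSupport_pderiv hgc j
  -- integrate by parts against `η_k ∘ f` and let `k → ∞`
  have hL : Tendsto (fun k => ∫ x, g x * (deriv (η k) (f x) * pderiv f x j)) atTop
      (𝓝 (∫ x, g x * ({x | f x ≠ 0}.indicator (fun x => pderiv f x j) x))) := by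
    refine tendsto_integral_of_dominated_convergence (fun x => C * |g x * pderiv f x j|)
      (fun k => ?_) ?_ (fun k => .of_forall fun x => ?_) (.of_forall fun x => ?_)
    · exact (hg.continuous.mul (((hcη' k).comp hf.continuous).mul hcp)).aestronglyMeasurable
    · exact ((hg.continuous.mul hcp).integrable_of_hasCompactSupport hgc.mul_right).abs.const_mul C
    · rw [Real.norm_eq_abs, show g x * (deriv (η k) (f x) * pderiv f x j)
        = deriv (η k) (f x) * (g x * pderiv f x j) by ring, abs_mul]
      exact mul_le_mul_of_nonneg_right (hηC _ _) (abs_nonneg _)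
    · by_cases hx : f x = 0
      · have : ∀ k, deriv (η k) 0 = 0 := fun k => by
          rw [(show η k =ᶠ[𝓝 0] fun _ => 0 from hη0 k).deriv_eq]; simp
        simp [hx, this]
      · refine tendsto_const_nhds.congr' ?_
        filter_upwards [hηd _ hx] with k hk
        simp [hk, hx]
  have hR : Tendsto (fun k => -∫ x, pderiv g x j * η k (f x)) atTop
      (𝓝 (-∫ x, pderiv g x j * f x)) := by
    refine (tendsto_integral_of_dominated_convergence (fun x => |pderiv g x j * f x|)
      (fun k => ?_) ?_ (fun k => .of_forall fun x => ?_) (.of_forall fun x => ?_)).neg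
    · exact ((continuous_pderiv hg1 j).mul (hηf k).continuous).aestronglyMeasurable
    · exact (((continuous_pderiv hg1 j).mul hf.continuous).integrable_of_hasCompactSupport
        hgp.mul_right).abs
    · rw [Real.norm_eq_abs, abs_mul, abs_mul]
      exact mul_le_mul_of_nonneg_left (hηs _ _) (abs_nonneg _)
    · refine tendsto_const_nhds.congr' ?_
      filter_upwards [hηlim (f x)] with k hk
      simp [hk]
  have hparts : ∀ F : Plane → ℝ, ContDiff ℝ 1 F →
      ∫ x, g x * pderiv F x j = -∫ x, pderiv g x j * F x := fun F hF => by
    have := integral_mul_pderiv hF hg1 hgc j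
    simp only [mul_comm (g _), mul_comm (pderiv g _ _)]
    linarith
  have hlim := tendsto_nhds_unique (hL.congr fun k => by
    rw [← hparts _ (hηf k)]; simp only [hder]) (hR.congr fun k => rfl) |>.trans (hparts f hf).symm
  have hi1 : Integrable fun x => g x * pderiv f x j :=
    (hg.continuous.mul hcp).integrable_of_hasCompactSupport hgc.mul_right
  have hi2 : Integrable fun x => g x * ({x | f x ≠ 0}.indicator (fun x => pderiv f x j) x) := by
    refine (hi1.indicator hmeas.compl).congr (.of_forall fun x => ?_)
    simp only [indicator, mem_compl_iff, mem_ofPred_eq]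
    split_ifs <;> simp_all
  rw [show (fun x => g x • {x | f x = 0}.indicator (fun x => pderiv f x j) x) = fun x =>
    g x * pderiv f x j - g x * ({x | f x ≠ 0}.indicator (fun x => pderiv f x j) x) by
      ext x; by_cases hx : f x = 0 <;> simp [hx, indicator], integral_sub hi1 hi2, hlim, sub_self]

/-- The divergence theorem in an arbitrary open set, for functions which vanish on its boundary. -/
lemma setIntegral_pderiv_eq_zero {Ω : Set Plane} (hΩ : IsOpen Ω) {f : Plane → ℝ}
    (hf : ContDiff ℝ 1 f) (hc : HasCompactSupport f) (h0 : ∀ x ∈ frontier Ω, f x = 0) (j : Fin 2) :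
    ∫ x in Ω, pderiv f x j = 0 := by
  obtain ⟨η, C, hη, hη0, hηs, hηC, hηlim, hηd⟩ := exists_flat_approx_id
  have hcp := continuous_pderiv hf j
  have hη00 : ∀ k, η k 0 = 0 := fun k => (hη0 k).self_of_nhds
  have hηf : ∀ k, ContDiff ℝ 1 fun x => η k (f x) := fun k => ((hη k).of_le (by simp)).comp hf
  -- the functions `1_Ω · η_k ∘ f` are `C¹` since they vanish near the boundary
  have hF : ∀ k, ContDiff ℝ 1 (Ω.indicator fun x => η k (f x)) := fun k => by
    refine contDiff_iff_contDiffAt.2 fun x => ?_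
    by_cases hx : x ∈ Ω
    · refine (hηf k).contDiffAt.congr_of_eventuallyEq ?_
      filter_upwards [hΩ.mem_nhds hx] with y hy
      simp [hy]
    · refine (contDiffAt_const (c := (0 : ℝ))).congr_of_eventuallyEq ?_
      by_cases hx' : x ∈ closure Ω
      · have hfx : f x = 0 := h0 x ⟨hx', by rwa [hΩ.interior_eq]⟩
        have : ∀ᶠ y in 𝓝 x, η k (f y) = 0 :=
          (hf.continuous.tendsto' x 0 hfx).eventually (hη0 k)
        filter_upwards [this] with y hy
        simp [indicator, hy]
      · filter_upwards [isClosed_closure.isOpen_compl.mem_nhds hx'] with y hy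
        exact indicator_of_notMem (fun h => hy (subset_closure h)) _
  have hFc : ∀ k, HasCompactSupport (Ω.indicator fun x => η k (f x)) := fun k =>
    hc.mono fun x hx hfx => hx (by simp [indicator, hfx, hη00])
  have hk : ∀ k, ∫ x in Ω, deriv (η k) (f x) * pderiv f x j = 0 := fun k => by
    rw [← integral_pderiv_eq_zero (hF k) (hFc k) j, ← integral_indicator hΩ.measurableSet]
    refine integral_congr_ae ?_
    filter_upwards [ae_pderiv_eq_zero (hF k) j] with x hx
    by_cases hxΩ : x ∈ Ω
    · rw [indicator_of_mem hxΩ, ← pderiv_comp ((hη k).differentiable (by simp) _)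
        (hf.differentiable one_ne_zero x)]
      have : (Ω.indicator fun x => η k (f x)) =ᶠ[𝓝 x] fun x => η k (f x) := by
        filter_upwards [hΩ.mem_nhds hxΩ] with y hy
        simp [hy]
      simp only [pderiv, this.fderiv_eq]
    · rw [indicator_of_notMem hxΩ, hx (indicator_of_notMem hxΩ _)]
  have hint : IntegrableOn (fun x => pderiv f x j) Ω :=
    (hcp.integrable_of_hasCompactSupport (hasCompactSupport_pderiv hc j)).integrableOn
  have hlim : Tendsto (fun k => ∫ x in Ω, deriv (η k) (f x) * pderiv f x j) atTop
      (𝓝 (∫ x in Ω, pderiv f x j)) := by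
    refine tendsto_integral_of_dominated_convergence (fun x => C * |pderiv f x j|)
      (fun k => ?_) (hint.abs.const_mul C) (fun k => .of_forall fun x => ?_) ?_
    · exact ((((hη k).continuous_deriv (by simp)).comp hf.continuous).mul hcp).aestronglyMeasurable
    · rw [Real.norm_eq_abs, abs_mul]
      exact mul_le_mul_of_nonneg_right (hηC _ _) (abs_nonneg _)
    · filter_upwards [ae_restrict_of_ae (ae_pderiv_eq_zero hf j)] with x hx
      by_cases hfx : f x = 0
      · simp [hx hfx]
      · refine tendsto_const_nhds.congr' ?_
        filter_upwards [hηd _ hfx] with k hk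
        simp [hk]
  simp only [hk] at hlim
  exact (tendsto_nhds_unique hlim tendsto_const_nhds)

/-- Smooth cut-off functions exhausting the plane. -/
lemma exists_cutoff : ∃ χ : ℕ → Plane → ℝ, ∃ C : ℝ, (∀ k, ContDiff ℝ ∞ (χ k)) ∧
    (∀ k, HasCompactSupport (χ k)) ∧ (∀ k x, |χ k x| ≤ 1) ∧ (∀ k x j, |pderiv (χ k) x j| ≤ C) ∧
    (∀ x, ∀ᶠ k in atTop, χ k x = 1) ∧ ∀ x j, ∀ᶠ k in atTop, pderiv (χ k) x j = 0 := by
  let b : ContDiffBump (0 : Plane) := ⟨1, 2, one_pos, one_lt_two⟩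
  let c : ℕ → ℝ := fun k => (k + 1 : ℝ)⁻¹
  have hc : ∀ k, 0 < c k := fun k => by positivity
  have hc1 : ∀ k, c k ≤ 1 := fun k => by
    apply inv_le_one_of_one_le₀
    have : (0 : ℝ) ≤ k := by positivity
    linarith
  have hc0 : Tendsto c atTop (𝓝 0) :=
    tendsto_inv_atTop_zero.comp (tendsto_atTop_add_const_right _ _ tendsto_natCast_atTop_atTop)
  have hder : ∀ k x j, pderiv (fun x => b (c k • x)) x j = c k * pderiv b (c k • x) j :=
    fun k x j => by
    have h : fderiv ℝ (fun x => b (c k • x)) x = (c k) • fderiv ℝ b (c k • x) :=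
      fderiv_comp_smul (c k)
    simp [pderiv, h]
  have hb : Continuous (fderiv ℝ b) := (b.contDiff (n := 1)).continuous_fderiv one_ne_zero
  obtain ⟨C, hC⟩ := hb.bounded_above_of_compact_support (b.hasCompactSupport.fderiv ℝ)
  have hev : ∀ x : Plane, ∀ᶠ k in atTop, c k • x ∈ Metric.ball (0 : Plane) 1 := fun x => by
    have : Tendsto (fun k => c k • x) atTop (𝓝 0) := by simpa using hc0.smul_const x
    exact this.eventually (Metric.ball_mem_nhds _ one_pos)
  refine ⟨fun k x => b (c k • x), C, fun k => ?_, fun k => ?_, fun k x => ?_, fun k x j => ?_,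
    fun x => ?_, fun x j => ?_⟩
  · exact b.contDiff.comp (contDiff_const_smul (c k))
  · exact b.hasCompactSupport.comp_homeomorph (Homeomorph.smulOfNeZero (c k) (hc k).ne')
  · rw [abs_of_nonneg b.nonneg]; exact b.le_one
  · rw [hder, abs_mul, abs_of_pos (hc k)]
    refine (mul_le_of_le_one_left (abs_nonneg _) (hc1 k)).trans ?_
    have := (fderiv ℝ b (c k • x)).le_opNorm (EuclideanSpace.single j (1 : ℝ))
    simp only [PiLp.norm_single, norm_one, mul_one] at this
    exact this.trans (hC _)
  · filter_upwards [hev x] with k hk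
    exact b.one_of_mem_closedBall (Metric.ball_subset_closedBall hk)
  · filter_upwards [hev x] with k hk
    rw [hder]
    have : (b : Plane → ℝ) =ᶠ[𝓝 (c k • x)] fun _ => 1 := by
      filter_upwards [Metric.isOpen_ball.mem_nhds hk] with y hy
      exact b.one_of_mem_closedBall (Metric.ball_subset_closedBall hy)
    simp [pderiv, this.fderiv_eq]

/-- The divergence theorem for an integrable field with integrable divergence which vanishes on
the boundary of an arbitrary open set. -/
lemma setIntegral_div_eq_zero {Ω : Set Plane} (hΩ : IsOpen Ω) {f : Fin 2 → Plane → ℝ}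
    (hf : ∀ j, ContDiff ℝ 1 (f j)) (h0 : ∀ j, ∀ x ∈ frontier Ω, f j x = 0)
    (hi : ∀ j, IntegrableOn (f j) Ω)
    (hdiv : IntegrableOn (fun x => ∑ j, pderiv (f j) x j) Ω) :
    ∫ x in Ω, ∑ j, pderiv (f j) x j = 0 := by
  obtain ⟨χ, C, hχ, hχc, hχ1, hχC, hχlim, hχd⟩ := exists_cutoff
  have hχ' : ∀ k, ContDiff ℝ 1 (χ k) := fun k => (hχ k).of_le (by simp)
  have hk : ∀ k, ∫ x in Ω, (χ k x * ∑ j, pderiv (f j) x j + ∑ j, pderiv (χ k) x j * f j x) = 0 :=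
    fun k => by
    have h : ∀ j, ContDiff ℝ 1 fun x => χ k x * f j x := fun j => (hχ' k).mul (hf j)
    have hcs : ∀ j, HasCompactSupport fun x => χ k x * f j x := fun j => (hχc k).mul_right
    have h1 : ∀ j, ∫ x in Ω, pderiv (fun x => χ k x * f j x) x j = 0 := fun j =>
      setIntegral_pderiv_eq_zero hΩ (h j) (hcs j)
        (fun x hx => by simp [h0 j x hx]) j
    calc _ = ∫ x in Ω, ∑ j, pderiv (fun x => χ k x * f j x) x j := by
          congr 1; ext x
          simp only [pderiv_mul ((hχ' k).differentiable one_ne_zero x)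
            ((hf _).differentiable one_ne_zero x), Finset.sum_add_distrib, Finset.mul_sum]
      _ = 0 := by
          rw [integral_finsetSum _ fun j _ => ((continuous_pderiv (h j) j).integrable_of_hasCompactSupport
            (hasCompactSupport_pderiv (hcs j) j)).integrableOn]
          simp [h1]
  have hlim : Tendsto (fun k => ∫ x in Ω, (χ k x * ∑ j, pderiv (f j) x j +
      ∑ j, pderiv (χ k) x j * f j x)) atTop (𝓝 (∫ x in Ω, ∑ j, pderiv (f j) x j)) := by
    refine tendsto_integral_of_dominated_convergence
      (fun x => |∑ j, pderiv (f j) x j| + ∑ j, C * |f j x|) (fun k => ?_) ?_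
      (fun k => .of_forall fun x => ?_) (.of_forall fun x => ?_)
    · refine Continuous.aestronglyMeasurable ?_
      refine ((hχ k).continuous.mul (continuous_finsetSum _ fun j _ => continuous_pderiv (hf j) j)).add
        (continuous_finsetSum _ fun j _ => (continuous_pderiv (hχ' k) j).mul (hf j).continuous)
    · exact hdiv.abs.add (integrable_finsetSum _ fun j _ => (hi j).abs.const_mul C)
    · refine (norm_add_le _ _).trans (add_le_add ?_ ?_)
      · rw [norm_mul]
        exact mul_le_of_le_one_left (norm_nonneg _) (hχ1 k x)
      · refine (norm_sum_le _ _).trans (Finset.sum_le_sum fun j _ => ?_)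
        rw [norm_mul]
        exact mul_le_mul_of_nonneg_right (hχC k x j) (norm_nonneg _)
    · refine tendsto_const_nhds.congr' ?_
      filter_upwards [hχlim x, hχd x 0, hχd x 1] with k h1 h2 h3
      simp [Fin.sum_univ_two, h1, h2, h3]
  simp only [hk] at hlim
  exact tendsto_nhds_unique hlim tendsto_const_nhds

end

section

/-! ### Square integrable functions -/

section SquareIntegrable

variable {α : Type*} [MeasurableSpace α] {μ : Measure α}

lemma integrable_mul_of_memLp {f g : α → ℝ} (hf : MemLp f 2 μ) (hg : MemLp g 2 μ) :
    Integrable (fun x => f x * g x) μ :=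
  hf.integrable_mul hg

lemma integral_mul_eq_inner {f g : α → ℝ} (hf : MemLp f 2 μ) (hg : MemLp g 2 μ) :
    ∫ x, f x * g x ∂μ = inner ℝ (hf.toLp f) (hg.toLp g) := by
  rw [L2.inner_def]
  refine integral_congr_ae ?_
  filter_upwards [hf.coeFn_toLp, hg.coeFn_toLp] with x h1 h2
  simp [h1, h2, mul_comm]

lemma abs_integral_mul_le {f g : α → ℝ} (hf : MemLp f 2 μ) (hg : MemLp g 2 μ) :
    |∫ x, f x * g x ∂μ| ≤ (eLpNorm f 2 μ).toReal * (eLpNorm g 2 μ).toReal := by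
  rw [integral_mul_eq_inner hf hg]
  refine (abs_real_inner_le_norm _ _).trans_eq ?_
  rw [Lp.norm_toLp, Lp.norm_toLp]

/-- Pairings of `L²` functions are continuous in the first argument. -/
lemma tendsto_integral_mul {ι : Type*} {l : Filter ι} {f : ι → α → ℝ} {f' g : α → ℝ}
    (hf : ∀ k, MemLp (f k) 2 μ) (hf' : MemLp f' 2 μ) (hg : MemLp g 2 μ)
    (h : Tendsto (fun k => eLpNorm (f k - f') 2 μ) l (𝓝 0)) :
    Tendsto (fun k => ∫ x, f k x * g x ∂μ) l (𝓝 (∫ x, f' x * g x ∂μ)) := by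
  refine tendsto_iff_norm_sub_tendsto_zero.2 (squeeze_zero (fun _ => norm_nonneg _) (fun k => ?_)
    (g := fun k => (eLpNorm (f k - f') 2 μ).toReal * (eLpNorm g 2 μ).toReal) ?_)
  · rw [← integral_sub (integrable_mul_of_memLp (hf k) hg) (integrable_mul_of_memLp hf' hg)]
    simp only [← sub_mul]
    exact abs_integral_mul_le ((hf k).sub hf') hg
  · simpa using ((ENNReal.tendsto_toReal ENNReal.zero_ne_top).comp h).mul_const
      (eLpNorm g 2 μ).toReal

end SquareIntegrable

section Translation

variable {G : Type*} [AddCommGroup G] [TopologicalSpace G] [IsTopologicalAddGroup G]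
  [LocallyCompactSpace G] [T2Space G] [SecondCountableTopology G] [MeasurableSpace G] [BorelSpace G]
  {μ : Measure G} [μ.IsAddHaarMeasure]

/-- Translation is continuous in `L²`; in the form of the continuity of the pairing over a set of
two independently translated functions. -/
lemma continuous_setIntegral_translate_mul {f g : G → ℝ} (hf : MemLp f 2 μ) (hg : MemLp g 2 μ)
    (s : Set G) :
    Continuous fun p : G × G => ∫ x in s, f (p.1 + x) * g (p.2 + x) ∂μ := by
  have : Fact ((2 : ℝ≥0∞) ≠ ⊤) := ⟨ENNReal.ofNat_ne_top⟩
  have hc : ∀ h : Lp ℝ 2 μ, Continuous fun z : G => (DomAddAct.mk z) +ᵥ h := fun h =>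
    (DomAddAct.mkHomeomorph.continuous).vadd continuous_const
  let R := LpToLpRestrictCLM G ℝ ℝ μ 2 s
  have h : ∀ p : G × G, ∫ x in s, f (p.1 + x) * g (p.2 + x) ∂μ =
      inner ℝ (R (DomAddAct.mk p.1 +ᵥ hf.toLp f)) (R (DomAddAct.mk p.2 +ᵥ hg.toLp g)) :=
    fun p => by
      have key : ∀ (z : G) {k : G → ℝ} (hk : MemLp k 2 μ),
          R (DomAddAct.mk z +ᵥ hk.toLp k) =ᵐ[μ.restrict s] fun x => k (z + x) := fun z k hk => by
        refine (LpToLpRestrictCLM_coeFn ℝ s _).trans (ae_restrict_of_ae ?_)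
        rw [DomAddAct.mk_vadd_toLp]
        exact MemLp.coeFn_toLp _
      rw [L2.inner_def]
      refine integral_congr_ae ?_
      filter_upwards [key p.1 hf, key p.2 hg] with x h1 h2
      simp only [h1, h2, RCLike.inner_apply, conj_trivial, mul_comm]
  simp only [h]
  exact (R.continuous.comp ((hc _).comp continuous_fst)).inner
    (R.continuous.comp ((hc _).comp continuous_snd))

end Translation

/-- Averages of a continuous function against normalised bump functions shrinking to the origin
converge to its value at the origin. -/
lemma tendsto_integral_bump_mul {N : Plane → ℝ} (hN : Continuous N) {ρ : ℕ → ContDiffBump (0 : Plane)}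
    (hρ : Tendsto (fun k => (ρ k).rOut) atTop (𝓝 0)) :
    Tendsto (fun k => ∫ z, (ρ k).normed volume z * N z) atTop (𝓝 (N 0)) := by
  have := ContDiffBump.convolution_tendsto_right_of_continuous (μ := (volume : Measure Plane)) hρ
    (g := fun z => N (-z)) (by fun_prop) 0
  simpa [convolution_def] using this

/-! ### Velocity fields as elements of a Hilbert space -/

/-- The class of a square integrable field in `L²(Ω)`; it is zero if the field is not square
integrable. -/
noncomputable def toL2 (Ω : Set Plane) (v : Plane → Plane) : Lp Plane 2 (volume.restrict Ω) :=
  open Classical in if h : MemLp v 2 (volume.restrict Ω) then h.toLp v else 0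

variable {Ω : Set Plane}

lemma toL2_of_memLp {v : Plane → Plane} (h : MemLp v 2 (volume.restrict Ω)) :
    toL2 Ω v = h.toLp v := by
  simp [toL2, h]

lemma coeFn_toL2 {v : Plane → Plane} (h : MemLp v 2 (volume.restrict Ω)) :
    toL2 Ω v =ᵐ[volume.restrict Ω] v := by
  rw [toL2_of_memLp h]; exact h.coeFn_toLp

lemma toL2_coeFn (f : Lp Plane 2 (volume.restrict Ω)) : toL2 Ω f = f := by
  rw [toL2_of_memLp (Lp.memLp f), Lp.toLp_coeFn]

lemma memLp_component {v : Plane → Plane} {p : ℝ≥0∞} {μ : Measure Plane} (h : MemLp v p μ)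
    (i : Fin 2) : MemLp (fun x => v x i) p μ :=
  h.eval_piLp i

/-- The field with given components. -/
noncomputable def ofComponents (w : Fin 2 → Plane → ℝ) (x : Plane) : Plane :=
  WithLp.toLp 2 fun i => w i x

@[simp] lemma ofComponents_apply (w : Fin 2 → Plane → ℝ) (x : Plane) (i : Fin 2) :
    ofComponents w x i = w i x := rfl

lemma memLp_ofComponents {w : Fin 2 → Plane → ℝ} {p : ℝ≥0∞} {μ : Measure Plane}
    (h : ∀ i, MemLp (w i) p μ) : MemLp (ofComponents w) p μ :=
  memLp_piLp_iff.2 h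

lemma inner_plane (x y : Plane) : inner ℝ x y = ∑ i, x i * y i := by
  simp [PiLp.inner_apply, mul_comm]

lemma inner_toL2 {v w : Plane → Plane} (hv : MemLp v 2 (volume.restrict Ω))
    (hw : MemLp w 2 (volume.restrict Ω)) :
    inner ℝ (toL2 Ω v) (toL2 Ω w) = ∫ x in Ω, ∑ i, v x i * w x i := by
  rw [L2.inner_def]
  refine integral_congr_ae ?_
  filter_upwards [coeFn_toL2 hv, coeFn_toL2 hw] with x h1 h2
  rw [h1, h2, inner_plane]

lemma norm_toL2 {v : Plane → Plane} (hv : MemLp v 2 (volume.restrict Ω)) :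
    ‖toL2 Ω v‖ = (eLpNorm v 2 (volume.restrict Ω)).toReal := by
  rw [toL2_of_memLp hv, Lp.norm_toLp]

lemma toL2_sub {v w : Plane → Plane} (hv : MemLp v 2 (volume.restrict Ω))
    (hw : MemLp w 2 (volume.restrict Ω)) : toL2 Ω (v - w) = toL2 Ω v - toL2 Ω w := by
  rw [toL2_of_memLp hv, toL2_of_memLp hw, toL2_of_memLp (hv.sub hw), MemLp.toLp_sub]

lemma toL2_add {v w : Plane → Plane} (hv : MemLp v 2 (volume.restrict Ω))
    (hw : MemLp w 2 (volume.restrict Ω)) : toL2 Ω (v + w) = toL2 Ω v + toL2 Ω w := by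
  rw [toL2_of_memLp hv, toL2_of_memLp hw, toL2_of_memLp (hv.add hw), MemLp.toLp_add]

lemma toL2_smul {v : Plane → Plane} (hv : MemLp v 2 (volume.restrict Ω)) (c : ℝ) :
    toL2 Ω (c • v) = c • toL2 Ω v := by
  rw [toL2_of_memLp hv, toL2_of_memLp (hv.const_smul c), MemLp.toLp_const_smul]

lemma tendsto_toL2_iff {ι : Type*} {l : Filter ι} {v : ι → Plane → Plane} {w : Plane → Plane}
    (hv : ∀ k, MemLp (v k) 2 (volume.restrict Ω)) (hw : MemLp w 2 (volume.restrict Ω)) :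
    Tendsto (fun k => toL2 Ω (v k)) l (𝓝 (toL2 Ω w)) ↔
      Tendsto (fun k => eLpNorm (v k - w) 2 (volume.restrict Ω)) l (𝓝 0) := by
  rw [tendsto_iff_norm_sub_tendsto_zero]
  simp only [← toL2_sub (hv _) hw, norm_toL2 ((hv _).sub hw)]
  rw [← ENNReal.toReal_zero,
    ENNReal.tendsto_toReal_iff (fun k => ((hv k).sub hw).eLpNorm_ne_top) ENNReal.zero_ne_top]

/-! ### Solenoidal fields -/

namespace IsSolenoidalTest

variable {φ ψ : Plane → Plane}

lemma contDiff_one (h : IsSolenoidalTest Ω φ) : ContDiff ℝ 1 φ := h.1.of_le (by simp)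

lemma contDiff_apply (h : IsSolenoidalTest Ω φ) (i : Fin 2) : ContDiff ℝ ∞ fun x => φ x i :=
  contDiff_component h.1 i

lemma contDiff_one_apply (h : IsSolenoidalTest Ω φ) (i : Fin 2) : ContDiff ℝ 1 fun x => φ x i :=
  contDiff_component h.contDiff_one i

lemma hasCompactSupport_apply (h : IsSolenoidalTest Ω φ) (i : Fin 2) :
    HasCompactSupport fun x => φ x i :=
  hasCompactSupport_component h.2.1 i

lemma tsupport_apply_subset (h : IsSolenoidalTest Ω φ) (i : Fin 2) :
    tsupport (fun x => φ x i) ⊆ Ω :=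
  (tsupport_component_subset φ i).trans h.2.2.1

lemma grad_eq (h : IsSolenoidalTest Ω φ) (x : Plane) (i j : Fin 2) :
    grad φ x i j = pderiv (fun y => φ y i) x j :=
  grad_eq_pderiv (h.contDiff_one.differentiable one_ne_zero x) i j

lemma sum_pderiv (h : IsSolenoidalTest Ω φ) (x : Plane) :
    ∑ i, pderiv (fun y => φ y i) x i = 0 := by
  simpa only [h.grad_eq] using h.2.2.2 x

lemma memLp (h : IsSolenoidalTest Ω φ) (p : ℝ≥0∞) (μ : Measure Plane)
    [IsFiniteMeasureOnCompacts μ] : MemLp φ p μ :=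
  h.1.continuous.memLp_of_hasCompactSupport h.2.1

lemma memLp_apply (h : IsSolenoidalTest Ω φ) (i : Fin 2) (p : ℝ≥0∞) (μ : Measure Plane)
    [IsFiniteMeasureOnCompacts μ] : MemLp (fun x => φ x i) p μ :=
  memLp_component (h.memLp p μ) i

lemma continuous_grad (h : IsSolenoidalTest Ω φ) (i j : Fin 2) :
    Continuous fun x => grad φ x i j := by
  simpa only [h.grad_eq] using continuous_pderiv (h.contDiff_one_apply i) j

lemma hasCompactSupport_grad (h : IsSolenoidalTest Ω φ) (i j : Fin 2) :
    HasCompactSupport fun x => grad φ x i j := by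
  simpa only [h.grad_eq] using hasCompactSupport_pderiv (h.hasCompactSupport_apply i) j

lemma memLp_grad (h : IsSolenoidalTest Ω φ) (i j : Fin 2) (p : ℝ≥0∞) (μ : Measure Plane)
    [IsFiniteMeasureOnCompacts μ] : MemLp (fun x => grad φ x i j) p μ :=
  (h.continuous_grad i j).memLp_of_hasCompactSupport (h.hasCompactSupport_grad i j)

lemma exists_bound (h : IsSolenoidalTest Ω φ) :
    ∃ C : ℝ, 0 ≤ C ∧ ∀ x, (∀ i, |φ x i| ≤ C) ∧ ∀ i j, |grad φ x i j| ≤ C := by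
  choose c hc using fun i => (h.contDiff_one_apply i).continuous.bounded_above_of_compact_support
    (h.hasCompactSupport_apply i)
  choose d hd using fun i j => (h.continuous_grad i j).bounded_above_of_compact_support
    (h.hasCompactSupport_grad i j)
  have hc0 : ∀ i, 0 ≤ c i := fun i => (norm_nonneg _).trans (hc i 0)
  have hd0 : ∀ i j, 0 ≤ d i j := fun i j => (norm_nonneg _).trans (hd i j 0)
  refine ⟨∑ i, c i + ∑ i, ∑ j, d i j, ?_, fun x => ⟨fun i => ?_, fun i j => ?_⟩⟩
  · exact add_nonneg (Finset.sum_nonneg fun i _ => hc0 i)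
      (Finset.sum_nonneg fun i _ => Finset.sum_nonneg fun j _ => hd0 i j)
  · refine ((hc i x).trans (Finset.single_le_sum (f := c) (fun i _ => hc0 i)
      (Finset.mem_univ i))).trans (le_add_of_nonneg_right ?_)
    exact Finset.sum_nonneg fun i _ => Finset.sum_nonneg fun j _ => hd0 i j
  · refine (((hd i j x).trans (Finset.single_le_sum (f := d i) (fun j _ => hd0 i j)
      (Finset.mem_univ j))).trans (Finset.single_le_sum (f := fun i => ∑ j, d i j)
      (fun i _ => Finset.sum_nonneg fun j _ => hd0 i j) (Finset.mem_univ i))).trans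
      (le_add_of_nonneg_left (Finset.sum_nonneg fun i _ => hc0 i))

lemma zero : IsSolenoidalTest Ω 0 :=
  ⟨contDiff_const, HasCompactSupport.zero, by simp [tsupport], fun x => by
    simp [grad]⟩

lemma add (h : IsSolenoidalTest Ω φ) (h' : IsSolenoidalTest Ω ψ) : IsSolenoidalTest Ω (φ + ψ) := by
  refine ⟨h.1.add h'.1, h.2.1.add h'.2.1, (tsupport_add φ ψ).trans (union_subset h.2.2.1 h'.2.2.1),
    fun x => ?_⟩
  have := h.2.2.2 x
  have := h'.2.2.2 x
  simp only [grad, fderiv_add (h.contDiff_one.differentiable one_ne_zero x)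
    (h'.contDiff_one.differentiable one_ne_zero x), Fin.sum_univ_two] at *
  simp
  linarith

lemma smul (h : IsSolenoidalTest Ω φ) (c : ℝ) : IsSolenoidalTest Ω (c • φ) := by
  refine ⟨contDiff_const.smul h.1, h.2.1.smul_left (f := fun _ => c), (closure_mono ?_).trans h.2.2.1,
    fun x => ?_⟩
  · exact fun x hx hx' => hx (by simp [hx'])
  · have := h.2.2.2 x
    simp only [grad, fderiv_const_smul (h.contDiff_one.differentiable one_ne_zero x),
      Fin.sum_univ_two] at *
    simp
    rw [← mul_add, this, mul_zero]

end IsSolenoidalTest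

/-- The space `H` of solenoidal fields tangent to the boundary, as a closed subspace of `L²(Ω)`. -/
noncomputable def solenoidalSpace (Ω : Set Plane) : Submodule ℝ (Lp Plane 2 (volume.restrict Ω)) :=
  Submodule.topologicalClosure
    { carrier := {f | ∃ φ, IsSolenoidalTest Ω φ ∧ toL2 Ω φ = f}
      zero_mem' := ⟨0, .zero, by rw [toL2_of_memLp MemLp.zero]; exact MemLp.toLp_zero _⟩
      add_mem' := by
        rintro _ _ ⟨φ, hφ, rfl⟩ ⟨ψ, hψ, rfl⟩
        exact ⟨φ + ψ, hφ.add hψ, toL2_add (hφ.memLp 2 _) (hψ.memLp 2 _)⟩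
      smul_mem' := by
        rintro c _ ⟨φ, hφ, rfl⟩
        exact ⟨c • φ, hφ.smul c, toL2_smul (hφ.memLp 2 _) c⟩ }

lemma isClosed_solenoidalSpace : IsClosed (solenoidalSpace Ω : Set (Lp Plane 2 (volume.restrict Ω))) :=
  Submodule.isClosed_topologicalClosure _

lemma mem_solenoidalSpace_iff {f : Lp Plane 2 (volume.restrict Ω)} :
    f ∈ solenoidalSpace Ω ↔ f ∈ closure {f | ∃ φ, IsSolenoidalTest Ω φ ∧ toL2 Ω φ = f} := by
  rw [solenoidalSpace, ← SetLike.mem_coe, Submodule.topologicalClosure_coe]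
  rfl

lemma IsSolenoidalTest.toL2_mem {φ : Plane → Plane} (h : IsSolenoidalTest Ω φ) :
    toL2 Ω φ ∈ solenoidalSpace Ω :=
  mem_solenoidalSpace_iff.2 (subset_closure ⟨φ, h, rfl⟩)

/-- A closed condition which holds for test fields holds for all solenoidal fields. -/
lemma solenoidalSpace_induction {P : Lp Plane 2 (volume.restrict Ω) → Prop}
    (hP : IsClosed {f | P f}) (h : ∀ φ, IsSolenoidalTest Ω φ → P (toL2 Ω φ))
    {f : Lp Plane 2 (volume.restrict Ω)} (hf : f ∈ solenoidalSpace Ω) : P f :=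
  closure_minimal (t := {f | P f}) (by rintro _ ⟨φ, hφ, rfl⟩; exact h φ hφ) hP
    (mem_solenoidalSpace_iff.1 hf)

lemma MemH.toL2_mem {v : Plane → Plane} (h : MemH Ω v) : toL2 Ω v ∈ solenoidalSpace Ω := by
  obtain ⟨hv, φ, hφ, hlim⟩ := h
  exact isClosed_solenoidalSpace.mem_of_tendsto
    ((tendsto_toL2_iff (fun k => (hφ k).memLp 2 _) hv).2 hlim) (.of_forall fun k => (hφ k).toL2_mem)

/-- A square integrable field orthogonal to the test fields is orthogonal to `H`. -/
lemma integral_eq_zero_of_toL2_mem {v : Plane → Plane} (hv : MemLp v 2 (volume.restrict Ω))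
    (hvm : toL2 Ω v ∈ solenoidalSpace Ω) {w : Fin 2 → Plane → ℝ}
    (hw : ∀ j, MemLp (w j) 2 (volume.restrict Ω))
    (h : ∀ ψ, IsSolenoidalTest Ω ψ → ∫ x in Ω, ∑ j, ψ x j * w j x = 0) :
    ∫ x in Ω, ∑ j, v x j * w j x = 0 := by
  have hw' := memLp_ofComponents hw
  have := solenoidalSpace_induction (P := fun f => inner ℝ f (toL2 Ω (ofComponents w)) = 0)
    (isClosed_eq (by fun_prop) continuous_const)
    (fun φ hφ => by rw [inner_toL2 (hφ.memLp 2 _) hw']; exact h φ hφ) hvm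
  rwa [inner_toL2 hv hw'] at this

end

section

variable {Ω : Set Plane}

lemma memLp_mul_of_bound {α : Type*} [MeasurableSpace α] {μ : Measure α} {p : ℝ≥0∞} {f g : α → ℝ}
    {C : ℝ} (hf : MemLp f p μ) (hg : AEStronglyMeasurable g μ) (hC : ∀ᵐ x ∂μ, |g x| ≤ C) :
    MemLp (fun x => f x * g x) p μ :=
  hf.of_le_mul (c := C) (hf.1.mul hg) (by
    filter_upwards [hC] with x hx
    rw [norm_mul, mul_comm]
    exact mul_le_mul_of_nonneg_right hx (norm_nonneg _))

lemma integral_sum_sum {α : Type*} [MeasurableSpace α] {μ : Measure α} {F : Fin 2 → Fin 2 → α → ℝ}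
    (h : ∀ i j, Integrable (F i j) μ) :
    ∫ x, ∑ i, ∑ j, F i j x ∂μ = ∑ i, ∑ j, ∫ x, F i j x ∂μ := by
  rw [integral_finsetSum _ fun i _ => integrable_finsetSum _ fun j _ => h i j]
  exact Finset.sum_congr rfl fun i _ => integral_finsetSum _ fun j _ => h i j

/-! ### Convection of weakly differentiable fields -/

/-- If `v` solenoidal is weakly differentiable, then `v ⊗ v` has the divergence `v · ∇v`. -/
lemma integral_convection_by_parts {v : Plane → Plane} {G : Plane → Fin 2 → Fin 2 → ℝ}
    (hv : MemH Ω v) (hG : HasWeakGrad Ω v G) {φ : Plane → Plane} (hφ : IsSolenoidalTest Ω φ) :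
    ∫ x in Ω, ∑ i, ∑ j, v x i * v x j * grad φ x i j =
      -∫ x in Ω, ∑ i, ∑ j, G x i j * v x j * φ x i := by
  obtain ⟨hv2, hG2, hw⟩ := hG
  obtain ⟨C, hC0, hC⟩ := hφ.exists_bound
  have hm1 : ∀ i j, MemLp (fun x => v x i * grad φ x i j) 2 (volume.restrict Ω) := fun i j =>
    memLp_mul_of_bound (memLp_component hv2 i) (hφ.continuous_grad i j).aestronglyMeasurable
      (.of_forall fun x => (hC x).2 i j)
  have hm2 : ∀ i j, MemLp (fun x => G x i j * φ x i) 2 (volume.restrict Ω) := fun i j =>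
    memLp_mul_of_bound (hG2 i j) (hφ.contDiff_apply i).continuous.aestronglyMeasurable
      (.of_forall fun x => (hC x).1 i)
  -- by density it suffices to replace one factor `v` by a smooth solenoidal field
  have key := integral_eq_zero_of_toL2_mem hv2 hv.toL2_mem
    (w := fun j x => ∑ i, (v x i * grad φ x i j + G x i j * φ x i))
    (fun j => memLp_finsetSum _ fun i _ => (hm1 i j).add (hm2 i j)) fun ψ hψ => by
      have hψ2 := fun j => hψ.memLp_apply j 2 (volume.restrict Ω)
      have hsupp : ∀ i j, tsupport (fun x => ψ x j * φ x i) ⊆ Ω := fun i j =>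
        (tsupport_mul_subset_left (f := fun x => ψ x j)).trans (hψ.tsupport_apply_subset j)
      have hp : ∀ i j x, pderiv (fun x => ψ x j * φ x i) x j =
          ψ x j * grad φ x i j + pderiv (fun x => ψ x j) x j * φ x i := fun i j x => by
        rw [pderiv_mul ((hψ.contDiff_one_apply j).differentiable one_ne_zero x)
          ((hφ.contDiff_one_apply i).differentiable one_ne_zero x), hφ.grad_eq]
      have hi1 : ∀ i j, IntegrableOn (fun x => v x i * pderiv (fun x => ψ x j * φ x i) x j) Ω :=
        fun i j => by
          have hcd : ContDiff ℝ 1 fun x => ψ x j * φ x i :=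
            (hψ.contDiff_one_apply j).mul (hφ.contDiff_one_apply i)
          exact integrable_mul_of_memLp (memLp_component hv2 i)
            ((continuous_pderiv hcd j).memLp_of_hasCompactSupport
              (hasCompactSupport_pderiv (hψ.hasCompactSupport_apply j).mul_right j))
      have hi2 : ∀ i j, IntegrableOn (fun x => G x i j * (ψ x j * φ x i)) Ω := fun i j => by
        refine (integrable_mul_of_memLp (hm2 i j) (hψ2 j)).congr (.of_forall fun x => ?_)
        simp only; ring
      have h0 : ∫ x in Ω, ∑ i, ∑ j, (v x i * pderiv (fun x => ψ x j * φ x i) x j +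
          G x i j * (ψ x j * φ x i)) = 0 := by
        rw [integral_sum_sum (F := fun i j x => v x i * pderiv (fun x => ψ x j * φ x i) x j +
          G x i j * (ψ x j * φ x i)) fun i j => (hi1 i j).add (hi2 i j)]
        refine Finset.sum_eq_zero fun i _ => Finset.sum_eq_zero fun j _ => ?_
        rw [integral_add (hi1 i j) (hi2 i j), hw _ ((hψ.contDiff_apply j).mul (hφ.contDiff_apply i))
          (hψ.hasCompactSupport_apply j).mul_right (hsupp i j) i j, neg_add_cancel]
      rw [← h0]
      refine integral_congr_ae (.of_forall fun x => ?_)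
      have hdiv := hψ.sum_pderiv x
      simp only [hp, Fin.sum_univ_two] at hdiv ⊢
      linear_combination (v x 0 * φ x 0 + v x 1 * φ x 1) * (-hdiv)
  have hi1 : ∀ i j, IntegrableOn (fun x => v x i * v x j * grad φ x i j) Ω := fun i j =>
    (integrable_mul_of_memLp (hm1 i j) (memLp_component hv2 j)).congr
      (.of_forall fun x => by simp only; ring)
  have hi2 : ∀ i j, IntegrableOn (fun x => G x i j * v x j * φ x i) Ω := fun i j =>
    (integrable_mul_of_memLp (hm2 i j) (memLp_component hv2 j)).congr
      (.of_forall fun x => by simp only; ring)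
  rw [← add_eq_zero_iff_eq_neg, ← integral_add
    (integrable_finsetSum _ fun i _ => integrable_finsetSum _ fun j _ => hi1 i j)
    (integrable_finsetSum _ fun i _ => integrable_finsetSum _ fun j _ => hi2 i j), ← key]
  refine integral_congr_ae (.of_forall fun x => ?_)
  simp only [Fin.sum_univ_two]
  ring

lemma integrable_kernel_mul {κ a b : Plane → ℝ} (hκ : Continuous κ) (hκc : HasCompactSupport κ)
    (ha : Integrable a) (hb : Integrable b) :
    Integrable (fun p : Plane × Plane => κ (p.1 - p.2) * (a p.1 * b p.2))
      (volume.prod volume) := by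
  obtain ⟨C, hC⟩ := hκ.bounded_above_of_compact_support hκc
  exact (ha.mul_prod hb).bdd_mul (hκ.comp (by fun_prop)).aestronglyMeasurable
    (.of_forall fun p => hC _)

/-- Weak convergence of mollifications, in bilinear form. -/
lemma tendsto_integral_mollify {a b : Plane → ℝ} (ha : MemLp a 2 volume) (hb : MemLp b 2 volume)
    (ha1 : Integrable a) (hb1 : Integrable b) {ρ : ℕ → ContDiffBump (0 : Plane)}
    (hρ : Tendsto (fun k => (ρ k).rOut) atTop (𝓝 0)) :
    Tendsto (fun k => ∫ x, ∫ y, (ρ k).normed volume (x - y) * (a x * b y)) atTop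
      (𝓝 (∫ x, a x * b x)) := by
  have hN : Continuous fun z : Plane => ∫ x, a x * b (x - z) := by
    have h := (continuous_setIntegral_translate_mul ha hb univ).comp
      (f := fun z : Plane => ((0 : Plane), -z)) (by fun_prop)
    simpa [Function.comp_def, sub_eq_add_neg, add_comm] using h
  have h := tendsto_integral_bump_mul hN hρ
  simp only [sub_zero] at h
  refine h.congr fun k => ?_
  have hint := integrable_kernel_mul ((ρ k).continuous_normed (μ := volume))
    (ρ k).hasCompactSupport_normed ha1 hb1
  have hint' : Integrable (fun p : Plane × Plane => (ρ k).normed volume p.2 *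
      (a p.1 * b (p.1 - p.2))) (volume.prod volume) := by
    have hmp : MeasurePreserving (fun p : Plane × Plane => (p.1, p.1 - p.2))
        (volume.prod volume) (volume.prod volume) :=
      (MeasurePreserving.id volume).skew_product (g := fun x y => x - y)
        (by fun_prop) (.of_forall fun x => (Measure.measurePreserving_sub_left volume x).map_eq)
    refine (hmp.integrable_comp_of_integrable hint).congr (.of_forall fun p => ?_)
    simp
  calc ∫ z, (ρ k).normed volume z * ∫ x, a x * b (x - z)
      = ∫ z, ∫ x, (ρ k).normed volume z * (a x * b (x - z)) := by
        simp only [integral_const_mul]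
    _ = ∫ x, ∫ z, (ρ k).normed volume z * (a x * b (x - z)) :=
        (integral_integral_swap (f := fun x z => (ρ k).normed volume z * (a x * b (x - z)))
          hint').symm
    _ = _ := by
        congr 1; ext x
        rw [← integral_sub_left_eq_self _ volume x]
        simp

/-- The convection of a weakly differentiable function `V` along a smooth solenoidal field is
orthogonal to `V`: the chain rule `V ψ·∇V = ψ·∇(V²/2)` holds in the weak sense. -/
lemma integral_convection_self_eq_zero (hΩ : IsOpen Ω) {V : Plane → ℝ} {Γ : Fin 2 → Plane → ℝ}
    (hV : MemLp V 2 (volume.restrict Ω)) (hΓ : ∀ j, MemLp (Γ j) 2 (volume.restrict Ω))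
    (hw : ∀ f : Plane → ℝ, ContDiff ℝ ∞ f → HasCompactSupport f → tsupport f ⊆ Ω → ∀ j,
      ∫ x in Ω, V x * pderiv f x j = -∫ x in Ω, Γ j x * f x)
    {ψ : Plane → Plane} (hψ : IsSolenoidalTest Ω ψ) :
    ∫ x in Ω, ∑ j, ψ x j * (V x * Γ j x) = 0 := by
  -- localise `V` and its gradient to a compact neighbourhood of the support of `ψ`
  obtain ⟨δ, hδ, hδΩ⟩ := hψ.2.1.isCompact.exists_cthickening_subset_open hΩ hψ.2.2.1
  set K := Metric.cthickening δ (tsupport ψ) with hK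
  have hKc : IsCompact K := hψ.2.1.isCompact.cthickening
  have hψK : ∀ x ∉ K, ∀ j, ψ x j = 0 := fun x hx j => by
    have : ψ x = 0 := image_eq_zero_of_notMem_tsupport fun h =>
      hx (Metric.self_subset_cthickening _ h)
    simp [this]
  have hloc : ∀ {f : Plane → ℝ}, MemLp f 2 (volume.restrict Ω) →
      MemLp (K.indicator f) 2 volume ∧ Integrable (K.indicator f) := fun {f} hf => by
    have h2 : MemLp f 2 (volume.restrict K) := hf.mono_measure (Measure.restrict_mono hδΩ le_rfl)
    have : IsFiniteMeasure (volume.restrict K) := ⟨by simpa using hKc.measure_lt_top⟩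
    exact ⟨(memLp_indicator_iff_restrict hKc.measurableSet).2 h2,
      (integrable_indicator_iff hKc.measurableSet).2 (h2.integrable one_le_two)⟩
  obtain ⟨C, hC0, hC⟩ := hψ.exists_bound
  set V' := K.indicator V
  set Γ' := fun j => K.indicator (Γ j)
  have hV' : MemLp V' 2 volume ∧ Integrable V' := hloc hV
  have hΓ' : ∀ j, MemLp (Γ' j) 2 volume ∧ Integrable (Γ' j) := fun j => hloc (hΓ j)
  have hmulψ : ∀ {f : Plane → ℝ} (j : Fin 2), MemLp f 2 volume ∧ Integrable f →
      MemLp (fun x => f x * ψ x j) 2 volume ∧ Integrable fun x => f x * ψ x j :=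
    fun {f} j hf => by
      have hm := (hψ.contDiff_apply j).continuous.aestronglyMeasurable (μ := volume)
      have hb : ∀ᵐ x, |ψ x j| ≤ C := .of_forall fun x => (hC x).1 j
      exact ⟨memLp_mul_of_bound hf.1 hm hb,
        memLp_one_iff_integrable.1 (memLp_mul_of_bound (memLp_one_iff_integrable.2 hf.2) hm hb)⟩
  set a : Fin 2 → Plane → ℝ := fun j x => V' x * ψ x j
  set c : Fin 2 → Plane → ℝ := fun j x => Γ' j x * ψ x j
  have ha : ∀ j, MemLp (a j) 2 volume ∧ Integrable (a j) := fun j => hmulψ j hV'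
  have hc : ∀ j, MemLp (c j) 2 volume ∧ Integrable (c j) := fun j => hmulψ j (hΓ' j)
  -- the identity for the mollified products
  have key : ∀ ρ : ContDiffBump (0 : Plane), ρ.rOut ≤ δ →
      ∑ j, ((∫ x, ∫ y, ρ.normed volume (x - y) * (a j x * Γ' j y)) +
        ∫ x, ∫ y, ρ.normed volume (x - y) * (c j x * V' y)) = 0 := fun ρ hρ => by
    set r := ρ.normed (volume : Measure Plane)
    have hr : ContDiff ℝ ∞ r := ρ.contDiff_normed
    have hr1 : ContDiff ℝ 1 r := ρ.contDiff_normed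
    have hrc : HasCompactSupport r := ρ.hasCompactSupport_normed
    have hr' : ∀ j, Continuous fun z => pderiv r z j := continuous_pderiv hr1
    have hrc' : ∀ j, HasCompactSupport fun z => pderiv r z j := hasCompactSupport_pderiv hrc
    have hleft : ∀ x y j, pderiv (fun x => r (x - y)) x j = pderiv r (x - y) j := fun x y j => by
      simp only [pderiv, fderiv_comp_sub]
    have hright : ∀ x y j, pderiv (fun y => r (x - y)) y j = -pderiv r (x - y) j :=
      fun x y j => by
        have h : HasFDerivAt (fun y => r (x - y)) (-(fderiv ℝ r (x - y))) y := by
          have := (hr1.differentiable one_ne_zero (x - y)).hasFDerivAt.comp y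
            ((hasFDerivAt_id y).const_sub x)
          simpa [Function.comp_def] using this
        simp [pderiv, h.fderiv]
    have hsub : ∀ (W h : Plane → ℝ), tsupport h ⊆ K →
        ∫ x in Ω, W x * h x = ∫ x, K.indicator W x * h x := fun W h hh => by
      have h0 : ∀ x ∉ K, h x = 0 := fun x hx => image_eq_zero_of_notMem_tsupport fun h' =>
        hx (hh h')
      rw [setIntegral_eq_integral_of_forall_compl_eq_zero fun x hx => by
        rw [h0 x fun h => hx (hδΩ h), mul_zero]]
      refine integral_congr_ae (.of_forall fun x => ?_)
      by_cases hx : x ∈ K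
      · simp [hx]
      · simp [h0 x hx]
    -- the weak gradient tested with `x ↦ r (x - y) ψ(x)` and with `y ↦ r (x - y)`
    have h1 : ∀ y, ∑ j, ∫ x, a j x * pderiv r (x - y) j = -∑ j, ∫ x, c j x * r (x - y) :=
      fun y => by
        have hry : ContDiff ℝ ∞ fun x => r (x - y) := hr.comp (contDiff_id.sub contDiff_const)
        have hf : ∀ j, ContDiff ℝ ∞ fun x => r (x - y) * ψ x j := fun j =>
          hry.mul (hψ.contDiff_apply j)
        have hfc : ∀ j, HasCompactSupport fun x => r (x - y) * ψ x j := fun j =>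
          (hψ.hasCompactSupport_apply j).mul_left
        have hfs : ∀ j, tsupport (fun x => r (x - y) * ψ x j) ⊆ tsupport ψ := fun j =>
          (tsupport_mul_subset_right (g := fun x => ψ x j)).trans (tsupport_component_subset ψ j)
        have hψsub : tsupport ψ ⊆ K := Metric.self_subset_cthickening _
        have hj : ∀ j, ∫ x, V' x * pderiv (fun x => r (x - y) * ψ x j) x j =
            -∫ x, c j x * r (x - y) := fun j => by
          have := hw _ (hf j) (hfc j) ((hfs j).trans hψ.2.2.1) j
          rw [hsub _ _ (((tsupport_pderiv_subset _ j).trans (hfs j)).trans hψsub),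
            hsub _ _ ((hfs j).trans hψsub)] at this
          rw [this]
          refine neg_inj.2 (integral_congr_ae (.of_forall fun x => ?_))
          simp only [c, Γ']
          ring
        have hmem : ∀ j, MemLp (fun x => pderiv r (x - y) j * ψ x j) 2 volume := fun j =>
          (((hr' j).comp (continuous_id.sub continuous_const)).mul
            (hψ.contDiff_apply j).continuous).memLp_of_hasCompactSupport
            (hψ.hasCompactSupport_apply j).mul_left
        have hmem' : ∀ j, MemLp (fun x => pderiv (fun x => r (x - y) * ψ x j) x j) 2 volume :=
          fun j => (continuous_pderiv ((hf j).of_le (by simp)) j).memLp_of_hasCompactSupport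
            (hasCompactSupport_pderiv (hfc j) j)
        rw [← Finset.sum_neg_distrib, ← Finset.sum_congr rfl fun j _ => hj j,
          ← integral_finsetSum _ fun j _ => integrable_mul_of_memLp hV'.1 (hmem' j),
          ← integral_finsetSum _ fun j _ =>
            (integrable_mul_of_memLp hV'.1 (hmem j)).congr (.of_forall fun x => by
              simp only [a]; ring)]
        refine integral_congr_ae (.of_forall fun x => ?_)
        have hdiv := hψ.sum_pderiv x
        simp only [pderiv_mul (hry.differentiable (by simp) x)
          ((hψ.contDiff_one_apply _).differentiable one_ne_zero x), hleft, a,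
          Fin.sum_univ_two] at hdiv ⊢
        linear_combination (-V' x * r (x - y)) * hdiv
    have h2 : ∀ x j, a j x * ∫ y, V' y * pderiv r (x - y) j = a j x * ∫ y, Γ' j y * r (x - y) :=
      fun x j => by
        by_cases hx : x ∈ tsupport ψ
        · have hry : ContDiff ℝ ∞ fun y => r (x - y) := hr.comp (contDiff_const.sub contDiff_id)
          have hball : tsupport (fun y => r (x - y)) ⊆ K := by
            refine closure_minimal (fun y hy => ?_) Metric.isClosed_cthickening
            have : x - y ∈ Metric.ball (0 : Plane) ρ.rOut := by
              rw [← ρ.support_normed_eq (μ := volume)]; exact hy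
            refine Metric.mem_cthickening_of_dist_le y x δ _ hx ?_
            rw [dist_comm, dist_eq_norm]
            exact (mem_ball_zero_iff.1 this).le.trans hρ
          have hyc : HasCompactSupport fun y => r (x - y) :=
            HasCompactSupport.of_support_subset_isCompact hKc ((subset_tsupport _).trans hball)
          have := hw _ hry hyc (hball.trans hδΩ) j
          rw [hsub _ _ ((tsupport_pderiv_subset _ j).trans hball), hsub _ _ hball] at this
          simp only [hright, mul_neg, integral_neg, neg_inj] at this
          rw [this]
        · have : ψ x = 0 := image_eq_zero_of_notMem_tsupport hx
          simp [a, this]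
    have hF1 : ∀ j, ∫ x, ∫ y, pderiv r (x - y) j * (a j x * V' y) =
        ∫ y, ∫ x, pderiv r (x - y) j * (a j x * V' y) := fun j =>
      integral_integral_swap (integrable_kernel_mul (hr' j) (hrc' j) (ha j).2 hV'.2)
    have hF2 : ∀ j, ∫ x, ∫ y, r (x - y) * (c j x * V' y) =
        ∫ y, ∫ x, r (x - y) * (c j x * V' y) := fun j =>
      integral_integral_swap (integrable_kernel_mul hr.continuous hrc (hc j).2 hV'.2)
    have hF3 : ∀ j, ∫ x, ∫ y, r (x - y) * (a j x * Γ' j y) =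
        ∫ x, ∫ y, pderiv r (x - y) j * (a j x * V' y) := fun j => by
      congr 1; ext x
      have := h2 x j
      rw [← integral_const_mul, ← integral_const_mul] at this
      rw [show (fun y => r (x - y) * (a j x * Γ' j y)) = fun y => a j x * (Γ' j y * r (x - y)) by
        ext y; ring, ← this]
      congr 1; ext y; ring
    rw [Finset.sum_add_distrib, Finset.sum_congr rfl fun j _ => (hF3 j).trans (hF1 j),
      Finset.sum_congr rfl fun j _ => hF2 j, ← integral_finsetSum _ fun j _ =>
        (integrable_kernel_mul (hr' j) (hrc' j) (ha j).2 hV'.2).integral_prod_right,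
      ← integral_finsetSum _ fun j _ =>
        (integrable_kernel_mul hr.continuous hrc (hc j).2 hV'.2).integral_prod_right,
      add_eq_zero_iff_eq_neg, ← integral_neg]
    congr 1; ext y
    have := congrArg (fun s => V' y * s) (h1 y)
    simp only [mul_neg, Finset.mul_sum, ← integral_const_mul] at this
    refine (Eq.trans ?_ this).trans (neg_inj.2 ?_) <;>
      exact Finset.sum_congr rfl fun j _ => integral_congr_ae (.of_forall fun x => by
        simp only; ring)
  let ρ : ℕ → ContDiffBump (0 : Plane) := fun k =>
    ⟨δ / (2 * (k + 1)), δ / (k + 1), by positivity, by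
      apply div_lt_div_of_pos_left hδ (by positivity); linarith [(k.cast_nonneg : (0 : ℝ) ≤ k)]⟩
  have hρ : Tendsto (fun k => (ρ k).rOut) atTop (𝓝 0) :=
    tendsto_const_nhds.div_atTop (tendsto_atTop_add_const_right _ _ tendsto_natCast_atTop_atTop)
  have hlim := tendsto_finsetSum Finset.univ fun j (_ : j ∈ Finset.univ) =>
    (tendsto_integral_mollify (ha j).1 (hΓ' j).1 (ha j).2 (hΓ' j).2 hρ).add
    (tendsto_integral_mollify (hc j).1 hV'.1 (hc j).2 hV'.2 hρ)
  have hzero := tendsto_nhds_unique (hlim.congr fun k => key (ρ k) (div_le_self hδ.le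
    (by linarith [(k.cast_nonneg : (0 : ℝ) ≤ k)]))) tendsto_const_nhds
  have hac : ∀ j x, a j x * Γ' j x = ψ x j * (V x * Γ j x) ∧
      c j x * V' x = ψ x j * (V x * Γ j x) := fun j x => by
    by_cases hx : x ∈ K
    · constructor <;> simp only [a, c, V', Γ', indicator_of_mem hx] <;> ring
    · simp [a, c, hψK x hx]
  have hint : ∀ j, Integrable fun x => ψ x j * (V x * Γ j x) := fun j =>
    (integrable_mul_of_memLp (ha j).1 (hΓ' j).1).congr (.of_forall fun x => (hac j x).1)
  rw [integral_finsetSum _ fun j _ => (hint j).integrableOn]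
  simp only [(hac _ _).1, (hac _ _).2, ← two_mul, ← Finset.mul_sum, mul_eq_zero, two_ne_zero,
    false_or] at hzero
  rw [← hzero]
  refine Finset.sum_congr rfl fun j _ => setIntegral_eq_integral_of_forall_compl_eq_zero
    fun x hx => ?_
  simp [hψK x (fun h => hx (hδΩ h)) j]

end

section

variable {Ω : Set Plane}

/-! ### Energy balance of weakly differentiable curves in a Hilbert space -/

lemma eq_of_abs_sub_le_sq {f : ℝ → ℝ} {a b K : ℝ} (hab : a ≤ b)
    (h : ∀ s t, a ≤ s → s ≤ t → t ≤ b → |f t - f s| ≤ K * (t - s) ^ 2) : f b = f a := by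
  have hder : ∀ x ∈ Ico a b, HasDerivWithinAt f 0 (Ici x) x := fun x hx => by
    rw [hasDerivWithinAt_iff_isLittleO]
    simp only [smul_zero, sub_zero]
    have : (fun y => f y - f x) =O[𝓝[Ici x] x] fun y => (y - x) ^ 2 := by
      refine Asymptotics.IsBigO.of_bound K ?_
      have : ∀ᶠ y in 𝓝[Ici x] x, y ≤ b :=
        nhdsWithin_le_nhds (Iic_mem_nhds hx.2)
      filter_upwards [this, self_mem_nhdsWithin] with y hy hy'
      rw [Real.norm_eq_abs, Real.norm_of_nonneg (sq_nonneg _)]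
      exact h x y hx.1 hy' hy
    refine this.trans_isLittleO ?_
    have h2 : (fun y : ℝ => (y - x) ^ 2) =o[𝓝 x] fun y => y - x :=
      (Asymptotics.isLittleO_pow_sub_sub x one_lt_two).congr_left fun y => by
        rw [Real.norm_eq_abs, sq_abs]
    exact h2.mono nhdsWithin_le_nhds
  have hcont : ContinuousOn f (Icc a b) := fun x hx => by
    rw [ContinuousWithinAt, tendsto_iff_norm_sub_tendsto_zero]
    refine squeeze_zero' (.of_forall fun _ => norm_nonneg _) (g := fun y => K * (y - x) ^ 2) ?_ ?_
    · filter_upwards [self_mem_nhdsWithin] with y hy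
      rcases le_total x y with hxy | hxy
      · exact h x y hx.1 hxy hy.2
      · rw [norm_sub_rev, ← neg_sub x y, neg_sq]
        exact h y x hy.1 hxy hx.2
    · have : Continuous fun y => K * (y - x) ^ 2 := by fun_prop
      exact (this.tendsto' x 0 (by simp)).mono_left nhdsWithin_le_nhds
  exact constant_of_has_deriv_right_zero hcont hder b ⟨hab, le_rfl⟩

section Energy

variable {E : Type*} [NormedAddCommGroup E] [InnerProductSpace ℝ E] {U B : ℝ → E} {a b C : ℝ}

lemma abs_integral_inner_le {s t : ℝ} (hst : s ≤ t) (hB : ∀ r ∈ Icc s t, ‖B r‖ ≤ C) (φ : E) :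
    |∫ r in s..t, inner ℝ (B r) φ| ≤ C * ‖φ‖ * (t - s) := by
  have := intervalIntegral.norm_integral_le_of_norm_le_const (a := s) (b := t)
    (f := fun r => inner ℝ (B r) φ) (C := C * ‖φ‖) fun r hr => by
      rw [uIoc_of_le hst] at hr
      exact (norm_inner_le_norm _ _).trans
        (mul_le_mul_of_nonneg_right (hB r ⟨hr.1.le, hr.2⟩) (norm_nonneg _))
  rwa [abs_of_nonneg (sub_nonneg.2 hst)] at this

lemma continuous_integral_inner {s t : ℝ} (hst : s ≤ t) (hB : ∀ r ∈ Icc s t, ‖B r‖ ≤ C)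
    (hint : ∀ φ, IntervalIntegrable (fun r => inner ℝ (B r) φ) volume s t) :
    Continuous fun φ => ∫ r in s..t, inner ℝ (B r) φ := by
  have hC : 0 ≤ C := (norm_nonneg _).trans (hB s ⟨le_rfl, hst⟩)
  refine LipschitzWith.continuous (K := (C * (t - s)).toNNReal)
    (LipschitzWith.of_dist_le_mul fun φ ψ => ?_)
  rw [Real.dist_eq, dist_eq_norm, ← intervalIntegral.integral_sub (hint φ) (hint ψ),
    Real.coe_toNNReal _ (mul_nonneg hC (sub_nonneg.2 hst))]
  simp only [← inner_sub_right]
  exact (abs_integral_inner_le hst hB _).trans_eq (by ring)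

lemma norm_sub_le_of_weak_deriv {K : Submodule ℝ E} (hU : ∀ t ∈ Icc a b, U t ∈ K)
    (hB : ∀ t ∈ Icc a b, ‖B t‖ ≤ C)
    (h : ∀ s t, a ≤ s → s ≤ t → t ≤ b → ∀ φ ∈ K,
      inner ℝ (U t - U s) φ = ∫ r in s..t, inner ℝ (B r) φ)
    {s t : ℝ} (hs : a ≤ s) (hst : s ≤ t) (ht : t ≤ b) : ‖U t - U s‖ ≤ C * (t - s) := by
  have h1 := h s t hs hst ht (U t - U s)
    (K.sub_mem (hU t ⟨hs.trans hst, ht⟩) (hU s ⟨hs, hst.trans ht⟩))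
  have h2 := abs_integral_inner_le hst (fun r hr => hB r ⟨hs.trans hr.1, hr.2.trans ht⟩) (U t - U s)
  rw [← h1, real_inner_self_eq_norm_sq, abs_of_nonneg (sq_nonneg _)] at h2
  rcases (norm_nonneg (U t - U s)).eq_or_lt with h0 | h0
  · rw [← h0]
    exact mul_nonneg ((norm_nonneg _).trans (hB s ⟨hs, hst.trans ht⟩)) (sub_nonneg.2 hst)
  · nlinarith

/-- Energy balance: if the curve `U`, with values in `K`, has the bounded weak derivative `B` when
tested with vectors of `K`, then `d/dt ‖U‖² = 2 ⟪B, U⟫`. -/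
lemma norm_sq_sub_eq_of_weak_deriv (hab : a ≤ b) {K : Submodule ℝ E}
    (hU : ∀ t ∈ Icc a b, U t ∈ K) (hB : ∀ t ∈ Icc a b, ‖B t‖ ≤ C)
    (hint : ∀ φ, IntervalIntegrable (fun r => inner ℝ (B r) φ) volume a b)
    (hintU : IntervalIntegrable (fun r => inner ℝ (B r) (U r)) volume a b)
    (h : ∀ s t, a ≤ s → s ≤ t → t ≤ b → ∀ φ ∈ K,
      inner ℝ (U t - U s) φ = ∫ r in s..t, inner ℝ (B r) φ) :
    ‖U b‖ ^ 2 - ‖U a‖ ^ 2 = 2 * ∫ r in a..b, inner ℝ (B r) (U r) := by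
  have hsub : ∀ {f : ℝ → ℝ} {s t}, IntervalIntegrable f volume a b → a ≤ s → s ≤ t → t ≤ b →
      IntervalIntegrable f volume s t := fun {f s t} hf hs hst ht =>
    hf.mono_set (by rw [uIcc_of_le hst, uIcc_of_le hab]; exact Icc_subset_Icc hs ht)
  have hC : 0 ≤ C := (norm_nonneg _).trans (hB a ⟨le_rfl, hab⟩)
  have hL := fun {s t : ℝ} (hs : a ≤ s) (hst : s ≤ t) (ht : t ≤ b) =>
    norm_sub_le_of_weak_deriv hU hB h hs hst ht
  have key := eq_of_abs_sub_le_sq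
    (f := fun t => ‖U t‖ ^ 2 - 2 * ∫ r in a..t, inner ℝ (B r) (U r)) (K := 2 * C ^ 2) hab
    fun s t hs hst ht => by
      have hsI : s ∈ Icc a b := ⟨hs, hst.trans ht⟩
      have htI : t ∈ Icc a b := ⟨hs.trans hst, ht⟩
      have h1 := h s t hs hst ht (U t + U s) (K.add_mem (hU t htI) (hU s hsI))
      have h2 : inner ℝ (U t - U s) (U t + U s) = ‖U t‖ ^ 2 - ‖U s‖ ^ 2 := by
        simp only [inner_sub_left, inner_add_right, real_inner_self_eq_norm_sq,
          real_inner_comm (U t) (U s)]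
        ring
      have h3 : (∫ r in a..t, inner ℝ (B r) (U r)) - ∫ r in a..s, inner ℝ (B r) (U r) =
          ∫ r in s..t, inner ℝ (B r) (U r) :=
        intervalIntegral.integral_interval_sub_left (hsub hintU le_rfl htI.1 ht)
          (hsub hintU le_rfl hs hsI.2)
      have h4 : ‖U t‖ ^ 2 - 2 * (∫ r in a..t, inner ℝ (B r) (U r)) -
          (‖U s‖ ^ 2 - 2 * ∫ r in a..s, inner ℝ (B r) (U r)) =
          ∫ r in s..t, (inner ℝ (B r) (U t + U s) - 2 * inner ℝ (B r) (U r)) := by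
        rw [intervalIntegral.integral_sub (hsub (hint _) hs hst ht)
          ((hsub hintU hs hst ht).const_mul 2), intervalIntegral.integral_const_mul, ← h3, ← h1, h2]
        ring
      rw [h4]
      have h5 := intervalIntegral.norm_integral_le_of_norm_le_const (a := s) (b := t)
        (f := fun r => inner ℝ (B r) (U t + U s) - 2 * inner ℝ (B r) (U r))
        (C := 2 * C ^ 2 * (t - s)) fun r hr => by
          rw [uIoc_of_le hst] at hr
          have e : inner ℝ (B r) (U t + U s) - 2 * inner ℝ (B r) (U r) =
              inner ℝ (B r) ((U t - U r) - (U r - U s)) := by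
            simp only [inner_sub_right, inner_add_right]; ring
          rw [e]
          refine (norm_inner_le_norm _ _).trans ?_
          have n1 := hL (hs.trans hr.1.le) hr.2 ht
          have n2 := hL hs hr.1.le (hr.2.trans ht)
          have n3 := hB r ⟨hs.trans hr.1.le, hr.2.trans ht⟩
          calc ‖B r‖ * ‖(U t - U r) - (U r - U s)‖
              ≤ C * (C * (t - r) + C * (r - s)) :=
                mul_le_mul n3 ((norm_sub_le _ _).trans (add_le_add n1 n2)) (norm_nonneg _) hC
            _ = C ^ 2 * (t - s) := by ring
            _ ≤ 2 * C ^ 2 * (t - s) := by nlinarith [sq_nonneg C, sub_nonneg.2 hst]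
      rw [abs_of_nonneg (sub_nonneg.2 hst)] at h5
      exact h5.trans_eq (by ring)
  simp only [intervalIntegral.integral_same, mul_zero, sub_zero] at key
  linarith

end Energy

/-! ### Fields on the space-time cylinder -/

variable {T : ℝ}

lemma volume_restrict_cylinder (Ω : Set Plane) (T : ℝ) : (volume : Measure (ℝ × Plane)).restrict
    (cylinder Ω T) = (volume.restrict (Ioo 0 T)).prod (volume.restrict Ω) := by
  rw [Measure.prod_restrict]; rfl

lemma memLp_cylinder {F : Type*} [NormedAddCommGroup F] {f : ℝ → Plane → F} {C : ℝ≥0}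
    (hf : AEStronglyMeasurable (fun p : ℝ × Plane => f p.1 p.2) (volume.restrict (cylinder Ω T)))
    (hC : ∀ᵐ t ∂(volume.restrict (Ioo 0 T)), eLpNorm (f t) 2 (volume.restrict Ω) ≤ C) :
    MemLp (fun p : ℝ × Plane => f p.1 p.2) 2 (volume.restrict (cylinder Ω T)) := by
  refine ⟨hf, ?_⟩
  rw [eLpNorm_lt_top_iff_lintegral_rpow_enorm_lt_top two_ne_zero ENNReal.ofNat_ne_top]
  rw [volume_restrict_cylinder] at hf ⊢
  rw [lintegral_prod _ (hf.enorm.pow_const _)]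
  refine (lintegral_mono_ae (g := fun _ => (C : ℝ≥0∞) ^ (2 : ℝ)) ?_).trans_lt ?_
  · filter_upwards [hC] with t ht
    rw [eLpNorm_eq_lintegral_rpow_enorm_toReal two_ne_zero ENNReal.ofNat_ne_top] at ht
    simp only [ENNReal.toReal_ofNat, one_div] at ht ⊢
    rwa [ENNReal.rpow_inv_le_iff two_pos] at ht
  · rw [lintegral_const]
    refine ENNReal.mul_lt_top (by finiteness) (by simp)

lemma ae_slice {P : ℝ → Plane → Prop}
    (h : ∀ᵐ p ∂((volume : Measure (ℝ × Plane)).restrict (cylinder Ω T)), P p.1 p.2) :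
    ∀ᵐ t ∂(volume.restrict (Ioo 0 T)), ∀ᵐ x ∂(volume.restrict Ω), P t x := by
  rw [volume_restrict_cylinder] at h
  exact Measure.ae_ae_of_ae_prod h

lemma aestronglyMeasurable_comp_snd {F : Type*} [TopologicalSpace F] {w : Plane → F}
    (hw : AEStronglyMeasurable w (volume.restrict Ω)) :
    AEStronglyMeasurable (fun p : ℝ × Plane => w p.2)
      ((volume : Measure (ℝ × Plane)).restrict (cylinder Ω T)) := by
  rw [volume_restrict_cylinder]
  exact hw.comp_snd

lemma aestronglyMeasurable_component {α : Type*} [MeasurableSpace α] {μ : Measure α}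
    {v : α → Plane} (h : AEStronglyMeasurable v μ) (i : Fin 2) :
    AEStronglyMeasurable (fun x => v x i) μ :=
  (EuclideanSpace.proj (𝕜 := ℝ) i).continuous.comp_aestronglyMeasurable h

lemma memLp_comp_snd {w : Plane → ℝ} (hw : MemLp w 2 (volume.restrict Ω)) :
    MemLp (fun p : ℝ × Plane => w p.2) 2 (volume.restrict (cylinder Ω T)) := by
  lift eLpNorm w 2 (volume.restrict Ω) to ℝ≥0 using hw.eLpNorm_ne_top with C hC
  exact memLp_cylinder (f := fun _ => w) (aestronglyMeasurable_comp_snd hw.1)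
    (.of_forall fun _ => hC.ge)

lemma integral_cylinder {F : Type*} [NormedAddCommGroup F] [NormedSpace ℝ F] {f : ℝ × Plane → F}
    (hf : IntegrableOn f (cylinder Ω T)) :
    ∫ p in cylinder Ω T, f p = ∫ t in Ioo 0 T, ∫ x in Ω, f (t, x) := by
  rw [IntegrableOn, volume_restrict_cylinder] at hf
  rw [volume_restrict_cylinder, integral_prod _ hf]

/-- Slicing an integrable function on the cylinder. -/
lemma intervalIntegrable_slice {f : ℝ × Plane → ℝ} (hT : 0 ≤ T) (hf : IntegrableOn f (cylinder Ω T)) :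
    IntervalIntegrable (fun t => ∫ x in Ω, f (t, x)) volume 0 T := by
  rw [intervalIntegrable_iff_integrableOn_Ioo_of_le hT]
  rw [IntegrableOn, volume_restrict_cylinder] at hf
  exact hf.integral_prod_left

lemma intervalIntegrable_mono_Icc {f : ℝ → ℝ} {a b s t : ℝ} (hf : IntervalIntegrable f volume a b)
    (hs : a ≤ s) (hst : s ≤ t) (ht : t ≤ b) : IntervalIntegrable f volume s t :=
  hf.mono_set (by rw [uIcc_of_le hst, uIcc_of_le (hs.trans (hst.trans ht))]; exact Icc_subset_Icc hs ht)

lemma ae_of_ae_Ioo {P : ℝ → Prop} {s t : ℝ} (hs : 0 ≤ s) (ht : t ≤ T)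
    (h : ∀ᵐ r ∂(volume.restrict (Ioo 0 T)), P r) : ∀ᵐ r, r ∈ Ioc s t → P r := by
  rw [ae_restrict_iff' measurableSet_Ioo] at h
  filter_upwards [h, (Measure.ae_ne volume T)] with r hr hrT hrst
  exact hr ⟨hs.trans_lt hrst.1, lt_of_le_of_ne (hrst.2.trans ht) hrT⟩

lemma eLpNorm_fun_sum_le {α ι : Type*} [MeasurableSpace α] {μ : Measure α} {p : ℝ≥0∞}
    {s : Finset ι} {f : ι → α → ℝ} (hf : ∀ i ∈ s, AEStronglyMeasurable (f i) μ) (hp : 1 ≤ p) :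
    eLpNorm (fun x => ∑ i ∈ s, f i x) p μ ≤ ∑ i ∈ s, eLpNorm (f i) p μ := by
  convert eLpNorm_sum_le hf hp using 2
  ext x
  simp

lemma eLpNorm_ofComponents_le {w : Fin 2 → Plane → ℝ} {μ : Measure Plane}
    (hw : ∀ i, AEStronglyMeasurable (w i) μ) :
    eLpNorm (ofComponents w) 2 μ ≤ ∑ i, eLpNorm (w i) 2 μ := by
  refine (eLpNorm_mono_real (g := fun x => ∑ i, ‖w i x‖) fun x => ?_).trans
    ((eLpNorm_fun_sum_le (fun i _ => (hw i).norm) one_le_two).trans_eq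
      (Finset.sum_congr rfl fun i _ => eLpNorm_norm _))
  rw [EuclideanSpace.norm_eq]
  refine Real.sqrt_le_iff.2 ⟨by positivity, ?_⟩
  simp only [ofComponents_apply, Fin.sum_univ_two]
  nlinarith [mul_nonneg (norm_nonneg (w 0 x)) (norm_nonneg (w 1 x))]

namespace IsSolenoidalCurve

variable {u₀ : Plane → Plane} {u : ℝ → Plane → Plane}

lemma memLp (h : IsSolenoidalCurve Ω T u₀ u) {t : ℝ} (ht : t ∈ Icc 0 T) :
    MemLp (u t) 2 (volume.restrict Ω) :=
  (h.memH t ht).1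

lemma continuousOn (h : IsSolenoidalCurve Ω T u₀ u) :
    ContinuousOn (fun t => toL2 Ω (u t)) (Icc 0 T) := fun t ht => by
  have hev := h.continuous t ht
  rw [ContinuousWithinAt, tendsto_iff_norm_sub_tendsto_zero]
  have := (ENNReal.tendsto_toReal ENNReal.zero_ne_top).comp hev
  refine (this.congr' ?_)
  filter_upwards [self_mem_nhdsWithin] with s hs
  rw [Function.comp, ← toL2_sub (h.memLp hs) (h.memLp ht),
    norm_toL2 ((h.memLp hs).sub (h.memLp ht))]

lemma exists_bound (h : IsSolenoidalCurve Ω T u₀ u) :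
    ∃ M : ℝ≥0, ∀ t ∈ Icc 0 T, ‖toL2 Ω (u t)‖ ≤ M ∧ eLpNorm (u t) 2 (volume.restrict Ω) ≤ M := by
  obtain ⟨M, hM⟩ := isCompact_Icc.exists_bound_of_continuousOn h.continuousOn
  refine ⟨M.toNNReal, fun t ht => ?_⟩
  have h1 := (hM t ht).trans (Real.le_coe_toNNReal M)
  refine ⟨h1, ?_⟩
  rw [norm_toL2 (h.memLp ht)] at h1
  rw [← ENNReal.ofReal_toReal (h.memLp ht).eLpNorm_ne_top, ← ENNReal.ofReal_coe_nnreal]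
  exact ENNReal.ofReal_le_ofReal h1

lemma memLp_cylinder (h : IsSolenoidalCurve Ω T u₀ u) :
    MemLp (fun p : ℝ × Plane => u p.1 p.2) 2 (volume.restrict (cylinder Ω T)) := by
  obtain ⟨M, hM⟩ := h.exists_bound
  refine WeakTurbulence.memLp_cylinder (C := M) h.measurable ?_
  filter_upwards [ae_restrict_mem measurableSet_Ioo] with t ht
  exact (hM t (Ioo_subset_Icc_self ht)).2

lemma memLp_cylinder_apply (h : IsSolenoidalCurve Ω T u₀ u) (i : Fin 2) :
    MemLp (fun p : ℝ × Plane => u p.1 p.2 i) 2 (volume.restrict (cylinder Ω T)) :=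
  h.memLp_cylinder.eval_piLp i

lemma integrableOn_convection (h : IsSolenoidalCurve Ω T u₀ u) {φ : Plane → Plane}
    (hφ : IsSolenoidalTest Ω φ) (i j : Fin 2) :
    IntegrableOn (fun p : ℝ × Plane => u p.1 p.2 i * u p.1 p.2 j * grad φ p.2 i j)
      (cylinder Ω T) := by
  obtain ⟨C, -, hC⟩ := hφ.exists_bound
  have := memLp_mul_of_bound (h.memLp_cylinder_apply i) (g := fun p : ℝ × Plane => grad φ p.2 i j)
    (C := C) ((hφ.continuous_grad i j).comp continuous_snd).aestronglyMeasurable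
    (.of_forall fun p => (hC p.2).2 i j)
  exact (integrable_mul_of_memLp this (h.memLp_cylinder_apply j)).congr
    (.of_forall fun p => by simp only; ring)

/-- The weak form of an equation of motion on an interval of time. -/
lemma inner_sub_eq (h : IsSolenoidalCurve Ω T u₀ u) {φ : Plane → Plane}
    (hφ : IsSolenoidalTest Ω φ) {F : ℝ × Plane → ℝ} (hF : IntegrableOn F (cylinder Ω T))
    (hw : ∀ t ∈ Icc 0 T, (∫ x in Ω, ∑ i, u t x i * φ x i) - ∫ x in Ω, ∑ i, u₀ x i * φ x i =
      ∫ s in (0 : ℝ)..t, ∫ x in Ω, F (s, x)) {r s : ℝ} (hr : 0 ≤ r) (hrs : r ≤ s) (hs : s ≤ T) :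
    inner ℝ (toL2 Ω (u s) - toL2 Ω (u r)) (toL2 Ω φ) = ∫ q in r..s, ∫ x in Ω, F (q, x) := by
  have hT : 0 ≤ T := hr.trans (hrs.trans hs)
  have hrI : r ∈ Icc 0 T := ⟨hr, hrs.trans hs⟩
  have hsI : s ∈ Icc 0 T := ⟨hr.trans hrs, hs⟩
  have hF := intervalIntegrable_slice hT hF
  have e := intervalIntegral.integral_interval_sub_left
    (intervalIntegrable_mono_Icc hF le_rfl hsI.1 hs)
    (intervalIntegrable_mono_Icc hF le_rfl hr hrI.2)
  rw [← hw s hsI, ← hw r hrI] at e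
  rw [inner_sub_left, inner_toL2 (h.memLp hsI) (hφ.memLp 2 _),
    inner_toL2 (h.memLp hrI) (hφ.memLp 2 _), ← e]
  ring

end IsSolenoidalCurve

/-! ### Conservation of energy for the Euler equations -/

/-- The convection term is orthogonal to the velocity. -/
lemma HasWeakGrad.integral_trilinear_eq_zero (hΩ : IsOpen Ω) {v : Plane → Plane}
    {G : Plane → Fin 2 → Fin 2 → ℝ} (h : HasWeakGrad Ω v G) (hv : toL2 Ω v ∈ solenoidalSpace Ω)
    (hm : ∀ i j, MemLp (fun x => v x i * G x i j) 2 (volume.restrict Ω)) :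
    ∫ x in Ω, ∑ j, v x j * ∑ i, v x i * G x i j = 0 := by
  refine integral_eq_zero_of_toL2_mem h.1 hv
    (w := fun j x => ∑ i, v x i * G x i j) (fun j => memLp_finsetSum _ fun i _ => hm i j) fun ψ hψ => ?_
  have h0 := fun i => integral_convection_self_eq_zero hΩ (memLp_component h.1 i)
    (Γ := fun j x => G x i j) (fun j => h.2.1 i j)
    (fun f h1 h2 h3 j => h.2.2 f h1 h2 h3 i j) hψ
  have hi : ∀ i j, Integrable (fun x => ψ x j * (v x i * G x i j)) (volume.restrict Ω) := fun i j =>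
    integrable_mul_of_memLp (hψ.memLp_apply j 2 _) (hm i j)
  calc _ = ∫ x in Ω, ∑ i, ∑ j, ψ x j * (v x i * G x i j) := by
        congr 1; ext x
        rw [Finset.sum_comm]
        simp only [Finset.mul_sum]
    _ = 0 := by
        rw [integral_finsetSum _ fun i _ => integrable_finsetSum _ fun j _ => hi i j]
        exact Finset.sum_eq_zero fun i _ => h0 i

/-- The weak solutions of the Euler equations with bounded velocity and square integrable gradients
conserve the energy: their convection term is square integrable, so that they may be tested with
themselves. -/
lemma IsEulerSolution.norm_eq {u₀ : Plane → Plane} {u : ℝ → Plane → Plane} (hΩ : IsOpen Ω)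
    (h : IsEulerSolution Ω T u₀ u) {t : ℝ} (ht : t ∈ Icc 0 T) :
    ‖toL2 Ω (u t)‖ = ‖toL2 Ω (u 0)‖ := by
  obtain ⟨hc, ⟨G, C, hGm, hG, hub, -⟩, hw⟩ := h
  have hT : 0 ≤ T := ht.1.trans ht.2
  -- the convection term `u · ∇u` is bounded in `L²(Ω)`
  let conv : ℝ → Fin 2 → Plane → ℝ := fun s i x => ∑ j, G s x i j * u s x j
  have hconv : ∀ᵐ s ∂(volume.restrict (Ioo 0 T)), (HasWeakGrad Ω (u s) (G s) ∧
      ∀ᵐ x ∂(volume.restrict Ω), ‖u s x‖ ≤ C) ∧ (∀ i, MemLp (conv s i) 2 (volume.restrict Ω)) ∧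
      ‖toL2 Ω (ofComponents (conv s))‖ ≤ 4 * C ^ 2 := by
    filter_upwards [hG, ae_slice (P := fun s x => ‖u s x‖ ≤ C) hub] with s hs hus
    have hm : ∀ i j, MemLp (fun x => G s x i j * u s x j) 2 (volume.restrict Ω) := fun i j =>
      memLp_mul_of_bound (hs.1.2.1 i j) (memLp_component hs.1.1 j).1 (C := C) (by
        filter_upwards [hus] with x hx
        exact (PiLp.norm_apply_le (u s x) j).trans hx)
    have hm' : ∀ i, MemLp (conv s i) 2 (volume.restrict Ω) := fun i =>
      memLp_finsetSum _ fun j _ => hm i j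
    refine ⟨⟨hs.1, hus⟩, hm', ?_⟩
    rw [norm_toL2 (memLp_ofComponents hm')]
    refine ENNReal.toReal_le_of_le_ofReal (by positivity) ?_
    have h1 : ∀ i j, eLpNorm (fun x => G s x i j * u s x j) 2 (volume.restrict Ω) ≤ C ^ 2 :=
      fun i j => by
        refine (eLpNorm_le_nnreal_smul_eLpNorm_of_ae_le_mul (c := C) (g := fun x => G s x i j)
          ?_ 2).trans ?_
        · filter_upwards [hus] with x hx
          rw [nnnorm_mul, mul_comm]
          exact mul_le_mul_left ((PiLp.nnnorm_apply_le (u s x) j).trans hx) _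
        · rw [sq, ENNReal.smul_def, smul_eq_mul]
          exact mul_le_mul_right (hs.2 i j) _
    calc eLpNorm (ofComponents (conv s)) 2 (volume.restrict Ω)
        ≤ ∑ i, eLpNorm (conv s i) 2 (volume.restrict Ω) :=
          eLpNorm_ofComponents_le fun i => (hm' i).1
      _ ≤ ∑ i, ∑ j, eLpNorm (fun x => G s x i j * u s x j) 2 (volume.restrict Ω) :=
          Finset.sum_le_sum fun i _ => eLpNorm_fun_sum_le (fun j _ => (hm i j).1) one_le_two
      _ ≤ ∑ i : Fin 2, ∑ j : Fin 2, (C : ℝ≥0∞) ^ 2 :=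
          Finset.sum_le_sum fun i _ => Finset.sum_le_sum fun j _ => h1 i j
      _ = ENNReal.ofReal (4 * (C : ℝ) ^ 2) := by
          rw [ENNReal.ofReal_mul (by norm_num), ENNReal.ofReal_pow C.coe_nonneg,
            ENNReal.ofReal_coe_nnreal]
          simp only [Finset.sum_const, Finset.card_univ, Fintype.card_fin, nsmul_eq_mul,
            ← mul_assoc]
          norm_num
  -- the time derivative of `u`, redefined on a null set of times so as to be bounded
  classical
  let B : ℝ → Lp Plane 2 (volume.restrict Ω) := fun s =>
    if ‖toL2 Ω (ofComponents (conv s))‖ ≤ 4 * C ^ 2 then -toL2 Ω (ofComponents (conv s)) else 0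
  have hB : ∀ s, ‖B s‖ ≤ 4 * C ^ 2 := fun s => by
    simp only [B]
    split_ifs with hs
    · rwa [norm_neg]
    · rw [norm_zero]; positivity
  have hBinner : ∀ᵐ s ∂(volume.restrict (Ioo 0 T)), ∀ w, MemLp w 2 (volume.restrict Ω) →
      inner ℝ (B s) (toL2 Ω w) = -∫ x in Ω, ∑ i, conv s i x * w x i := by
    filter_upwards [hconv] with s hs w hw
    simp only [B, if_pos hs.2.2, inner_neg_left]
    rw [inner_toL2 (memLp_ofComponents hs.2.1) hw]
    rfl
  have hint : ∀ φ, IntervalIntegrable (fun s => inner ℝ (B s) φ) volume 0 T := fun φ => by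
    rw [intervalIntegrable_iff_integrableOn_Ioo_of_le hT]
    refine Integrable.of_bound ?_ (4 * C ^ 2 * ‖φ‖)
      (.of_forall fun s => (norm_inner_le_norm _ _).trans
        (mul_le_mul_of_nonneg_right (hB s) (norm_nonneg _)))
    have hmeas : AEStronglyMeasurable (fun p : ℝ × Plane => ∑ i, conv p.1 i p.2 * φ p.2 i)
        ((volume.restrict (Ioo 0 T)).prod (volume.restrict Ω)) := by
      rw [← volume_restrict_cylinder]
      refine Finset.aestronglyMeasurable_fun_sum _ fun i _ =>
        (Finset.aestronglyMeasurable_fun_sum _ fun j _ => ?_).mul (aestronglyMeasurable_comp_snd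
          (memLp_component (Lp.memLp φ) i).1)
      exact (hGm i j).mul (hc.memLp_cylinder_apply j).1
    refine hmeas.integral_prod_right'.neg.congr ?_
    filter_upwards [hBinner] with s hs
    rw [← toL2_coeFn φ, hs φ (Lp.memLp φ), toL2_coeFn]
    rfl
  have hweak : ∀ r s, 0 ≤ r → r ≤ s → s ≤ T → ∀ φ ∈ solenoidalSpace Ω,
      inner ℝ (toL2 Ω (u s) - toL2 Ω (u r)) φ = ∫ q in r..s, inner ℝ (B q) φ :=
    fun r s hr hrs hs φ hφ => by
      refine solenoidalSpace_induction (P := fun φ => inner ℝ (toL2 Ω (u s) - toL2 Ω (u r)) φ =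
        ∫ q in r..s, inner ℝ (B q) φ) (isClosed_eq (by fun_prop) (continuous_integral_inner hrs
          (fun q _ => hB q) fun ψ => intervalIntegrable_mono_Icc (hint ψ) hr hrs hs)) (fun ψ hψ => ?_) hφ
      refine (hc.inner_sub_eq hψ (F := fun p => ∑ i, ∑ j, u p.1 p.2 i * u p.1 p.2 j *
        grad ψ p.2 i j) (integrable_finsetSum _ fun i _ => integrable_finsetSum _ fun j _ =>
          hc.integrableOn_convection hψ i j) (hw ψ hψ) hr hrs hs).trans
            (intervalIntegral.integral_congr_ae ?_)
      rw [uIoc_of_le hrs]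
      filter_upwards [ae_of_ae_Ioo hr hs hBinner, ae_of_ae_Ioo hr hs hconv] with q h1 h2 hq
      rw [h1 hq ψ (hψ.memLp 2 _), integral_convection_by_parts (hc.memH q
        ⟨hr.trans hq.1.le, hq.2.trans hs⟩) (h2 hq).1.1 hψ]
      simp only [conv, Finset.sum_mul]
  -- the convection term is orthogonal to the velocity
  have horth : ∀ᵐ s ∂(volume.restrict (Ioo 0 T)), inner ℝ (B s) (toL2 Ω (u s)) = 0 := by
    filter_upwards [hBinner, hconv, ae_restrict_mem measurableSet_Ioo] with s h1 h2 hs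
    have hsI := Ioo_subset_Icc_self hs
    obtain ⟨⟨⟨hu2, hG2, hgrad⟩, hus⟩, -⟩ := h2
    rw [h1 _ (hc.memLp hsI), neg_eq_zero]
    have hm : ∀ i j, MemLp (fun x => u s x i * G s x i j) 2 (volume.restrict Ω) := fun i j => by
      have := memLp_mul_of_bound (hG2 i j) (memLp_component hu2 i).1 (C := C) (by
        filter_upwards [hus] with x hx
        exact (PiLp.norm_apply_le (u s x) i).trans hx)
      simpa only [mul_comm] using this
    have := HasWeakGrad.integral_trilinear_eq_zero hΩ ⟨hu2, hG2, hgrad⟩ (hc.memH s hsI).toL2_mem hm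
    rw [← this]
    congr 1; ext x
    simp only [conv, Fin.sum_univ_two]
    ring
  have horth' : ∀ᵐ s, s ∈ Ioc 0 t → inner ℝ (B s) (toL2 Ω (u s)) = 0 :=
    ae_of_ae_Ioo le_rfl ht.2 horth
  have hzero : ∫ s in (0 : ℝ)..t, inner ℝ (B s) (toL2 Ω (u s)) = 0 := by
    rw [intervalIntegral.integral_zero_ae]
    rwa [uIoc_of_le ht.1]
  have henergy := norm_sq_sub_eq_of_weak_deriv (U := fun s => toL2 Ω (u s)) ht.1
    (K := solenoidalSpace Ω) (fun s hs => (hc.memH s ⟨hs.1, hs.2.trans ht.2⟩).toL2_mem)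
    (fun s _ => hB s) (fun φ => intervalIntegrable_mono_Icc (hint φ) le_rfl ht.1 ht.2)
    (by
      rw [intervalIntegrable_iff_integrableOn_Ioc_of_le ht.1]
      refine (integrable_zero ℝ ℝ _).congr ?_
      filter_upwards [(ae_restrict_iff' measurableSet_Ioc).2 horth'] with s hs
      exact hs.symm)
    fun r s hr hrs hs φ hφ => hweak r s hr hrs (hs.trans ht.2) φ hφ
  rw [hzero, mul_zero, sub_eq_zero] at henergy
  exact (pow_left_inj₀ (norm_nonneg _) (norm_nonneg _) two_ne_zero).1 henergy

end

section

variable {Ω : Set Plane}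

/-! ### The space `V` and Ladyzhenskaya's inequality -/

lemma holderTriple_four : ENNReal.HolderTriple 4 4 2 := ⟨by
  have : ((4 : ℝ≥0∞))⁻¹ = 2⁻¹ * 2⁻¹ := by
    rw [← ENNReal.mul_inv (by simp) (by simp)]; norm_num
  rw [this, ← mul_add, ENNReal.inv_two_add_inv_two, mul_one]⟩

lemma eLpNorm_mul_le_four {α : Type*} [MeasurableSpace α] {μ : Measure α} {f g : α → ℝ}
    (hf : AEStronglyMeasurable f μ) (hg : AEStronglyMeasurable g μ) :
    eLpNorm (fun x => f x * g x) 2 μ ≤ eLpNorm f 4 μ * eLpNorm g 4 μ :=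
  have := holderTriple_four
  eLpNorm_smul_le_mul_eLpNorm (p := 4) (q := 4) (r := 2) (φ := f) (f := g) hg hf

lemma eLpNorm_mul_le_two {α : Type*} [MeasurableSpace α] {μ : Measure α} {f g : α → ℝ}
    (hf : AEStronglyMeasurable f μ) (hg : AEStronglyMeasurable g μ) :
    eLpNorm (fun x => f x * g x) 1 μ ≤ eLpNorm f 2 μ * eLpNorm g 2 μ :=
  eLpNorm_smul_le_mul_eLpNorm (p := 2) (q := 2) (r := 1) (φ := f) (f := g) hg hf

/-- **Ladyzhenskaya's inequality** in the plane. -/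
lemma exists_ladyzhenskaya : ∃ C : ℝ≥0, ∀ f : Plane → ℝ, ContDiff ℝ 1 f → HasCompactSupport f →
    eLpNorm f 4 volume ≤
      (C * (eLpNorm f 2 volume * ∑ j, eLpNorm (fun x => pderiv f x j) 2 volume)) ^ (1 / 2 : ℝ) := by
  have hp : NNReal.HolderConjugate (Module.finrank ℝ Plane) 2 := by
    rw [finrank_euclideanSpace_fin]
    exact NNReal.holderConjugate_iff.2 ⟨by norm_num, by
      rw [Nat.cast_ofNat, ← two_mul]; norm_num⟩
  refine ⟨eLpNormLESNormFDerivOneConst (volume : Measure Plane) 2 * 2, fun f hf hc => ?_⟩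
  have hf2 : ContDiff ℝ 1 fun x => f x * f x := hf.mul hf
  have h1 := eLpNorm_le_eLpNorm_fderiv_one volume hf2 hc.mul_left hp
  have h4 : eLpNorm (fun x => f x * f x) ((2 : ℝ≥0) : ℝ≥0∞) volume = eLpNorm f 4 volume ^ (2 : ℝ) := by
    have := eLpNorm_norm_rpow (μ := volume) f (p := 2) (q := 2) two_pos
    rw [show (2 : ℝ≥0∞) * ENNReal.ofReal 2 = 4 by
      rw [show (2 : ℝ) = ((2 : ℝ≥0) : ℝ) by simp, ENNReal.ofReal_coe_nnreal]; norm_num] at this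
    rw [← this]
    congr 1
    ext x
    rw [Real.rpow_two, Real.norm_eq_abs, sq_abs, sq]
  have hp' : ∀ j x, pderiv (fun x => f x * f x) x j = 2 * (f x * pderiv f x j) := fun j x => by
    rw [pderiv_mul (hf.differentiable one_ne_zero x) (hf.differentiable one_ne_zero x)]
    ring
  have h2 : eLpNorm (fderiv ℝ fun x => f x * f x) 1 volume ≤
      2 * (eLpNorm f 2 volume * ∑ j, eLpNorm (fun x => pderiv f x j) 2 volume) := by
    calc eLpNorm (fderiv ℝ fun x => f x * f x) 1 volume
        ≤ eLpNorm (fun x => ∑ j, ‖2 * (f x * pderiv f x j)‖) 1 volume :=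
          eLpNorm_mono_real fun x => by
            refine (norm_fderiv_le_sum_pderiv _ x).trans_eq ?_
            simp only [hp', Real.norm_eq_abs]
      _ ≤ ∑ j, eLpNorm (fun x => ‖2 * (f x * pderiv f x j)‖) 1 volume :=
          eLpNorm_fun_sum_le (fun j _ => (continuous_const.mul
            (hf.continuous.mul (continuous_pderiv hf j))).norm.aestronglyMeasurable) le_rfl
      _ ≤ ∑ j, 2 * (eLpNorm f 2 volume * eLpNorm (fun x => pderiv f x j) 2 volume) := by
          refine Finset.sum_le_sum fun j _ => ?_
          rw [eLpNorm_norm]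
          have := eLpNorm_const_smul (2 : ℝ) (fun x => f x * pderiv f x j) 1 volume
          simp only [Pi.smul_def, smul_eq_mul] at this
          rw [this, show ‖(2 : ℝ)‖ₑ = 2 by simp [enorm_eq_nnnorm]]
          exact mul_le_mul_right (eLpNorm_mul_le_two hf.continuous.aestronglyMeasurable
            (continuous_pderiv hf j).aestronglyMeasurable) _
      _ = _ := by rw [← Finset.mul_sum, ← Finset.mul_sum]
  rw [one_div, ENNReal.le_rpow_inv_iff two_pos, ← h4]
  refine h1.trans ((mul_le_mul_right h2 _).trans_eq ?_)
  push_cast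
  ring

lemma IsSolenoidalTest.sub {φ ψ : Plane → Plane} (h : IsSolenoidalTest Ω φ)
    (h' : IsSolenoidalTest Ω ψ) : IsSolenoidalTest Ω (φ - ψ) := by
  simpa [sub_eq_add_neg] using h.add (h'.smul (-1))

lemma IsSolenoidalTest.grad_sub {φ ψ : Plane → Plane} (h : IsSolenoidalTest Ω φ)
    (h' : IsSolenoidalTest Ω ψ) (x : Plane) (i j : Fin 2) :
    grad (φ - ψ) x i j = grad φ x i j - grad ψ x i j := by
  simp [grad, fderiv_sub (h.contDiff_one.differentiable one_ne_zero x)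
    (h'.contDiff_one.differentiable one_ne_zero x)]

lemma eLpNorm_component_le {v : Plane → Plane} {p : ℝ≥0∞} {μ : Measure Plane} (i : Fin 2) :
    eLpNorm (fun x => v x i) p μ ≤ eLpNorm v p μ :=
  eLpNorm_mono fun x => PiLp.norm_apply_le (v x) i

/-- Joint continuity of the `L²` pairing. -/
lemma tendsto_integral_mul_mul {α ι : Type*} [MeasurableSpace α] {μ : Measure α} {l : Filter ι}
    {f g : ι → α → ℝ} {f' g' : α → ℝ}
    (hf : ∀ k, MemLp (f k) 2 μ) (hf' : MemLp f' 2 μ) (hg : ∀ k, MemLp (g k) 2 μ)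
    (hg' : MemLp g' 2 μ) (h : Tendsto (fun k => eLpNorm (f k - f') 2 μ) l (𝓝 0))
    (h' : Tendsto (fun k => eLpNorm (g k - g') 2 μ) l (𝓝 0)) :
    Tendsto (fun k => ∫ x, f k x * g k x ∂μ) l (𝓝 (∫ x, f' x * g' x ∂μ)) := by
  rw [integral_mul_eq_inner hf' hg']
  simp only [integral_mul_eq_inner (hf _) (hg _)]
  exact ((Lp.tendsto_Lp_iff_tendsto_eLpNorm'' _ hf _ hf').2 h).inner
    ((Lp.tendsto_Lp_iff_tendsto_eLpNorm'' _ hg _ hg').2 h')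

namespace MemV

variable {v : Plane → Plane} {G : Plane → Fin 2 → Fin 2 → ℝ}

lemma tendsto_component {φ : ℕ → Plane → Plane}
    (hlim : Tendsto (fun k => eLpNorm (φ k - v) 2 (volume.restrict Ω)) atTop (𝓝 0)) (i : Fin 2) :
    Tendsto (fun k => eLpNorm ((fun x => φ k x i) - fun x => v x i) 2 (volume.restrict Ω))
      atTop (𝓝 0) :=
  tendsto_of_tendsto_of_tendsto_of_le_of_le tendsto_const_nhds hlim (fun _ => zero_le)
    fun k => eLpNorm_component_le (v := φ k - v) i

lemma hasWeakGrad (h : MemV Ω v G) : HasWeakGrad Ω v G := by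
  obtain ⟨hv, hG, φ, hφ, hlim, hlim'⟩ := h
  refine ⟨hv, hG, fun f hf hc hs i j => ?_⟩
  have hf1 : ContDiff ℝ 1 f := hf.of_le (by simp)
  have h1 := tendsto_integral_mul (fun k => (hφ k).memLp_apply i 2 _) (memLp_component hv i)
    ((continuous_pderiv hf1 j).memLp_of_hasCompactSupport (hasCompactSupport_pderiv hc j))
    (tendsto_component hlim i)
  have h2 := tendsto_integral_mul (fun k => (hφ k).memLp_grad i j 2 _) (hG i j)
    (hf.continuous.memLp_of_hasCompactSupport hc) (hlim' i j)
  refine tendsto_nhds_unique h1 (h2.neg.congr fun k => ?_)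
  rw [setIntegral_eq_integral_of_tsupport ((tsupport_mul_subset_right (g := f)).trans hs),
    setIntegral_eq_integral_of_tsupport ((tsupport_mul_subset_left
      (f := fun x => φ k x i)).trans ((hφ k).tsupport_apply_subset i)),
    integral_mul_pderiv ((hφ k).contDiff_one_apply i) hf1 hc]
  simp only [(hφ k).grad_eq]

lemma sub_test (h : MemV Ω v G) {ψ : Plane → Plane} (hψ : IsSolenoidalTest Ω ψ) :
    MemV Ω (v - ψ) fun x i j => G x i j - grad ψ x i j := by
  obtain ⟨hv, hG, φ, hφ, hlim, hlim'⟩ := h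
  refine ⟨hv.sub (hψ.memLp 2 _), fun i j => (hG i j).sub (hψ.memLp_grad i j 2 _),
    fun k => φ k - ψ, fun k => (hφ k).sub hψ, ?_, fun i j => ?_⟩
  · simpa only [sub_sub_sub_cancel_right] using hlim
  · simpa only [(hφ _).grad_sub hψ, sub_sub_sub_cancel_right] using hlim' i j

end MemV

/-- Ladyzhenskaya's inequality on `V`. -/
lemma exists_ladyzhenskaya_memV (Ω : Set Plane) : ∃ C : ℝ≥0, ∀ v G, MemV Ω v G → ∀ i,
    eLpNorm (fun x => v x i) 4 (volume.restrict Ω) ≤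
      (C * (eLpNorm v 2 (volume.restrict Ω) *
        ∑ j, eLpNorm (fun x => G x i j) 2 (volume.restrict Ω))) ^ (1 / 2 : ℝ) := by
  obtain ⟨C, hC⟩ := exists_ladyzhenskaya
  refine ⟨C, fun v G ⟨hv, hG, φ, hφ, hlim, hlim'⟩ i => ?_⟩
  set μ := (volume : Measure Plane).restrict Ω
  have hnorm : ∀ {φ' : ℕ → Plane → ℝ} {f' : Plane → ℝ}, (∀ k, MemLp (φ' k) 2 μ) → MemLp f' 2 μ →
      Tendsto (fun k => eLpNorm (φ' k - f') 2 μ) atTop (𝓝 0) →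
      Tendsto (fun k => eLpNorm (φ' k) 2 μ) atTop (𝓝 (eLpNorm f' 2 μ)) := by
    intro φ' f' h1 h2 h3
    have := ((Lp.tendsto_Lp_iff_tendsto_eLpNorm'' _ h1 _ h2).2 h3).enorm
    simpa only [Lp.enorm_toLp] using this
  have hφv : Tendsto (fun k => eLpNorm (φ k) 2 μ) atTop (𝓝 (eLpNorm v 2 μ)) := by
    have := ((Lp.tendsto_Lp_iff_tendsto_eLpNorm'' _ (fun k => (hφ k).memLp 2 μ) _ hv).2 hlim).enorm
    simpa only [Lp.enorm_toLp] using this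
  have hsupp : ∀ k, ∀ f : Plane → ℝ, tsupport f ⊆ tsupport (φ k) → ∀ p,
      eLpNorm f p μ = eLpNorm f p volume := fun k f hf p =>
    eLpNorm_restrict_eq_of_support_subset ((subset_tsupport f).trans (hf.trans (hφ k).2.2.1))
  have hk : ∀ k, eLpNorm (fun x => φ k x i) 4 μ ≤
      (C * (eLpNorm (φ k) 2 μ * ∑ j, eLpNorm (fun x => grad (φ k) x i j) 2 μ)) ^ (1 / 2 : ℝ) :=
    fun k => by
      refine (hsupp k _ (tsupport_component_subset _ i) 4).trans_le
        ((hC _ ((hφ k).contDiff_one_apply i) ((hφ k).hasCompactSupport_apply i)).trans ?_)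
      simp only [(hφ k).grad_eq]
      refine ENNReal.rpow_le_rpow (mul_le_mul_right (mul_le_mul' ?_ (Finset.sum_le_sum
        fun j _ => ?_)) _) (by norm_num)
      · rw [← hsupp k _ (tsupport_component_subset _ i)]
        exact eLpNorm_component_le i
      · rw [hsupp k _ ((tsupport_pderiv_subset _ j).trans (tsupport_component_subset _ i))]
  have hrhs : Tendsto (fun k => (C * (eLpNorm (φ k) 2 μ *
      ∑ j, eLpNorm (fun x => grad (φ k) x i j) 2 μ)) ^ (1 / 2 : ℝ)) atTop
      (𝓝 ((C * (eLpNorm v 2 μ * ∑ j, eLpNorm (fun x => G x i j) 2 μ)) ^ (1 / 2 : ℝ))) := by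
    refine (ENNReal.Tendsto.const_mul (ENNReal.Tendsto.mul hφv (.inr ?_)
      (tendsto_finsetSum _ fun j _ => hnorm
        (fun k => (hφ k).memLp_grad i j 2 _) (hG i j) (hlim' i j)) (.inr hv.eLpNorm_ne_top))
      (.inr ENNReal.coe_ne_top)).ennrpow_const _
    exact ENNReal.sum_ne_top.2 fun j _ => (hG i j).eLpNorm_ne_top
  obtain ⟨ns, hns, hae⟩ := (tendstoInMeasure_of_tendsto_eLpNorm two_ne_zero
    (fun k => ((hφ k).memLp_apply i 2 μ).1) (memLp_component hv i).1
    (MemV.tendsto_component hlim i)).exists_seq_tendsto_ae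
  refine (Lp.eLpNorm_lim_le_liminf_eLpNorm (fun k => ((hφ (ns k)).memLp_apply i 2 μ).1) _
    hae).trans ?_
  refine (liminf_le_liminf (.of_forall fun k => hk (ns k))).trans_eq ?_
  exact (hrhs.comp hns.tendsto_atTop).liminf_eq

lemma MemV.memLp_four {v : Plane → Plane} {G : Plane → Fin 2 → Fin 2 → ℝ} (h : MemV Ω v G)
    (i : Fin 2) : MemLp (fun x => v x i) 4 (volume.restrict Ω) := by
  obtain ⟨C, hC⟩ := exists_ladyzhenskaya_memV Ω
  refine ⟨(memLp_component h.1 i).1, (hC v G h i).trans_lt ?_⟩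
  have := h.1.eLpNorm_ne_top
  have : ∀ j, eLpNorm (fun x => G x i j) 2 (volume.restrict Ω) ≠ ⊤ :=
    fun j => (h.2.1 i j).eLpNorm_ne_top
  have : ∑ j, eLpNorm (fun x => G x i j) 2 (volume.restrict Ω) ≠ ⊤ :=
    ENNReal.sum_ne_top.2 fun j _ => this j
  finiteness

lemma MemV.memLp_mul {v : Plane → Plane} {G : Plane → Fin 2 → Fin 2 → ℝ} (h : MemV Ω v G)
    (i j : Fin 2) : MemLp (fun x => v x i * v x j) 2 (volume.restrict Ω) :=
  have := holderTriple_four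
  (h.memLp_four j).mul' (h.memLp_four i)

/-- The trilinear form `∫ (v ⊗ v) : ∇v` vanishes on `V`. -/
lemma MemV.integral_trilinear_eq_zero (hΩ : IsOpen Ω) {v : Plane → Plane}
    {G : Plane → Fin 2 → Fin 2 → ℝ} (h : MemV Ω v G) :
    ∫ x in Ω, ∑ i, ∑ j, v x i * v x j * G x i j = 0 := by
  obtain ⟨C, hC⟩ := exists_ladyzhenskaya_memV Ω
  obtain ⟨hv, hG, φ, hφ, hlim, hlim'⟩ := id h
  set μ := (volume : Measure Plane).restrict Ω
  -- convergence in `L⁴`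
  have h4 : ∀ i, Tendsto (fun k => eLpNorm (fun x => v x i - φ k x i) 4 μ) atTop (𝓝 0) := fun i => by
    have hr : Tendsto (fun k => (C * (eLpNorm (v - φ k) 2 μ *
        ∑ j, eLpNorm (fun x => G x i j - grad (φ k) x i j) 2 μ)) ^ (1 / 2 : ℝ)) atTop (𝓝 0) := by
      have h1 : Tendsto (fun k => eLpNorm (v - φ k) 2 μ) atTop (𝓝 0) := by
        simpa only [eLpNorm_sub_comm v] using hlim
      have h2 : Tendsto (fun k => ∑ j, eLpNorm (fun x => G x i j - grad (φ k) x i j) 2 μ) atTop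
          (𝓝 0) := by
        rw [show (0 : ℝ≥0∞) = ∑ j : Fin 2, 0 by simp]
        refine tendsto_finsetSum _ fun j _ => ?_
        refine (hlim' i j).congr fun k => ?_
        exact eLpNorm_sub_comm (fun x => grad (φ k) x i j) (fun x => G x i j) 2 μ
      have := (ENNReal.Tendsto.const_mul (a := (C : ℝ≥0∞)) (ENNReal.Tendsto.mul h1
        (.inr ENNReal.zero_ne_top) h2 (.inr ENNReal.zero_ne_top))
        (.inr ENNReal.coe_ne_top)).ennrpow_const (1 / 2 : ℝ)
      simpa using this
    exact tendsto_of_tendsto_of_tendsto_of_le_of_le tendsto_const_nhds hr (fun _ => zero_le)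
      fun k => hC _ _ (h.sub_test (hφ k)) i
  have hv4 := h.memLp_four
  have hφ4 : ∀ k i, MemLp (fun x => φ k x i) 4 μ := fun k i => (hφ k).memLp_apply i 4 _
  have hprod : ∀ i j, Tendsto (fun k => eLpNorm ((fun x => φ k x i * φ k x j) -
      fun x => v x i * v x j) 2 μ) atTop (𝓝 0) := fun i j => by
    have hb : ∀ k, eLpNorm ((fun x => φ k x i * φ k x j) - fun x => v x i * v x j) 2 μ ≤
        eLpNorm (fun x => v x i - φ k x i) 4 μ *
          (eLpNorm (fun x => v x j - φ k x j) 4 μ + eLpNorm (fun x => v x j) 4 μ) +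
        eLpNorm (fun x => v x i) 4 μ * eLpNorm (fun x => v x j - φ k x j) 4 μ := fun k => by
      have m1 := ((hv4 i).sub (hφ4 k i)).1
      have m2 := ((hv4 j).sub (hφ4 k j)).1
      have e : ((fun x => φ k x i * φ k x j) - fun x => v x i * v x j) =
          (fun x => (v x i - φ k x i) * (v x j - φ k x j)) -
          ((fun x => (v x i - φ k x i) * v x j) + fun x => v x i * (v x j - φ k x j)) := by
        ext x; simp only [Pi.sub_apply, Pi.add_apply]; ring
      rw [e]
      refine (eLpNorm_sub_le (m1.mul m2) ((m1.mul (hv4 j).1).add ((hv4 i).1.mul m2))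
        one_le_two).trans ?_
      rw [mul_add, add_assoc]
      refine add_le_add (eLpNorm_mul_le_four m1 m2) ((eLpNorm_add_le (m1.mul (hv4 j).1)
        ((hv4 i).1.mul m2) one_le_two).trans (add_le_add (eLpNorm_mul_le_four m1 (hv4 j).1)
        (eLpNorm_mul_le_four (hv4 i).1 m2)))
    refine tendsto_of_tendsto_of_tendsto_of_le_of_le tendsto_const_nhds ?_ (fun _ => zero_le) hb
    have := (ENNReal.Tendsto.mul (h4 i) (.inr (by simpa using (hv4 j).eLpNorm_ne_top))
      ((h4 j).add_const (eLpNorm (fun x => v x j) 4 μ)) (.inr ENNReal.zero_ne_top)).add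
      (ENNReal.Tendsto.const_mul (h4 j) (.inr (hv4 i).eLpNorm_ne_top))
    simpa using this
  have hzero : ∀ k, ∑ i, ∑ j, ∫ x in Ω, φ k x i * φ k x j * grad (φ k) x i j = 0 := fun k => by
    have hint : ∀ i j, IntegrableOn (fun x => φ k x i * φ k x j * grad (φ k) x i j) Ω := fun i j =>
      ((((hφ k).contDiff_apply i).continuous.mul ((hφ k).contDiff_apply j).continuous).mul
        ((hφ k).continuous_grad i j)).integrable_of_hasCompactSupport
          ((hφ k).hasCompactSupport_grad i j).mul_left |>.integrableOn
    refine Finset.sum_eq_zero fun i _ => ?_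
    rw [← integral_finsetSum _ fun j _ => hint i j,
      ← integral_convection_self_eq_zero hΩ ((hφ k).memLp_apply i 2 μ)
      (Γ := fun j x => grad (φ k) x i j) (fun j => (hφ k).memLp_grad i j 2 _) (fun f hf hc hs j => by
        have hf1 : ContDiff ℝ 1 f := hf.of_le (by simp)
        rw [setIntegral_eq_integral_of_tsupport ((tsupport_mul_subset_right (g := f)).trans hs),
          setIntegral_eq_integral_of_tsupport ((tsupport_mul_subset_left
            (f := fun x => φ k x i)).trans ((hφ k).tsupport_apply_subset i)),
          integral_mul_pderiv ((hφ k).contDiff_one_apply i) hf1 hc]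
        simp only [(hφ k).grad_eq]) (hφ k)]
    congr 1; ext x
    exact Finset.sum_congr rfl fun j _ => by ring
  have hint : ∀ i j, IntegrableOn (fun x => v x i * v x j * G x i j) Ω := fun i j =>
    integrable_mul_of_memLp (h.memLp_mul i j) (hG i j)
  rw [integral_sum_sum hint]
  refine tendsto_nhds_unique (tendsto_finsetSum _ fun i _ => tendsto_finsetSum _ fun j _ =>
    tendsto_integral_mul_mul (fun k => ?_) (h.memLp_mul i j)
      (fun k => (hφ k).memLp_grad i j 2 μ) (hG i j) (hprod i j) (hlim' i j))
    (tendsto_const_nhds.congr fun k => (hzero k).symm)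
  exact have := holderTriple_four; (hφ4 k j).mul' (hφ4 k i)

end

section

variable {Ω : Set Plane} {T : ℝ}

/-! ### Energy inequality for the Navier–Stokes equations -/

lemma intervalIntegral_slice {f : ℝ × Plane → ℝ} (hf : IntegrableOn f (cylinder Ω T)) {r s : ℝ}
    (hr : 0 ≤ r) (hrs : r ≤ s) (hs : s ≤ T) :
    ∫ q in r..s, ∫ x in Ω, f (q, x) = ∫ p in Ioo r s ×ˢ Ω, f p := by
  have hf' : IntegrableOn f (Ioo r s ×ˢ Ω) :=
    hf.mono_set (prod_mono (Ioo_subset_Ioo hr hs) subset_rfl)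
  rw [IntegrableOn, show (volume : Measure (ℝ × Plane)) = volume.prod volume from rfl,
    ← Measure.prod_restrict] at hf'
  rw [intervalIntegral.integral_of_le hrs, integral_Ioc_eq_integral_Ioo,
    show (volume : Measure (ℝ × Plane)) = volume.prod volume from rfl,
    ← Measure.prod_restrict, integral_prod _ hf']

lemma eLpNorm_comp_snd_slab {w : Plane → ℝ} (hw : AEStronglyMeasurable w (volume.restrict Ω))
    (r s : ℝ) : eLpNorm (fun p : ℝ × Plane => w p.2) 2 (volume.restrict (Ioo r s ×ˢ Ω)) =
      (ENNReal.ofReal (s - r)) ^ (1 / 2 : ℝ) * eLpNorm w 2 (volume.restrict Ω) := by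
  rw [show (volume : Measure (ℝ × Plane)) = volume.prod volume from rfl, ← Measure.prod_restrict]
  have hmap : Measure.map Prod.snd ((volume.restrict (Ioo r s)).prod (volume.restrict Ω)) =
      ENNReal.ofReal (s - r) • volume.restrict Ω := by
    rw [Measure.map_snd_prod]; simp
  have := eLpNorm_map_measure (p := 2) (g := w) (f := Prod.snd)
    (μ := (volume.restrict (Ioo r s)).prod (volume.restrict Ω))
    (by rw [hmap]; exact hw.smul_measure _) measurable_snd.aemeasurable
  rw [hmap] at this
  rw [show (fun p : ℝ × Plane => w p.2) = w ∘ Prod.snd from rfl, ← this,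
    eLpNorm_smul_measure_of_ne_top ENNReal.ofNat_ne_top]
  simp

/-- Fubini's theorem for products of translated functions on space-time. -/
lemma integral_translate_swap {f g : ℝ × Plane → ℝ} (hf : MemLp f 2 volume) (hg : MemLp g 2 volume)
    (a b : ℝ) {h : ℝ} (hh : 0 ≤ h) :
    IntegrableOn (fun t => ∫ σ in (0 : ℝ)..h, ∫ x, f (σ + t, x) * g (h + t, x)) (Ioo a b) ∧
    ∫ t in Ioo a b, ∫ σ in (0 : ℝ)..h, ∫ x, f (σ + t, x) * g (h + t, x) =
      ∫ σ in (0 : ℝ)..h, ∫ y in Ioo a b ×ˢ univ, f ((σ, 0) + y) * g ((h, 0) + y) := by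
  set ν : Measure ℝ := volume.restrict (Ioc 0 h)
  set μ : Measure (ℝ × Plane) := volume.restrict (Ioo a b ×ˢ univ)
  have hμ : μ = (volume.restrict (Ioo a b)).prod volume := by
    rw [← Measure.restrict_univ (μ := (volume : Measure Plane)), Measure.prod_restrict]; rfl
  have : (volume : Measure (ℝ × Plane)).IsAddHaarMeasure := Measure.prod.instIsAddHaarMeasure _ _
  have hft : ∀ z, MemLp (fun y => f (z + y)) 2 volume := fun z =>
    hf.comp_measurePreserving (measurePreserving_add_left volume z)
  have hgt : ∀ z, MemLp (fun y => g (z + y)) 2 volume := fun z =>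
    hg.comp_measurePreserving (measurePreserving_add_left volume z)
  have hnorm : ∀ z, eLpNorm (fun y => f (z + y)) 2 volume = eLpNorm f 2 volume := fun z =>
    eLpNorm_comp_measurePreserving hf.1 (measurePreserving_add_left volume z)
  -- joint integrability in the shift, the time and the position
  have hF : Integrable (fun p : ℝ × ℝ × Plane => f ((p.1, 0) + p.2) * g ((h, 0) + p.2))
      (ν.prod μ) := by
    have hmeas : AEStronglyMeasurable
        (fun p : ℝ × ℝ × Plane => f ((p.1, 0) + p.2) * g ((h, 0) + p.2)) (ν.prod volume) := by
      refine AEStronglyMeasurable.mul ?_ ?_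
      · have hmp : MeasurePreserving (fun p : ℝ × ℝ × Plane => (p.1, (p.1, (0 : Plane)) + p.2))
            (ν.prod volume) (ν.prod volume) :=
          (MeasurePreserving.id ν).skew_product (g := fun σ y => (σ, (0 : Plane)) + y)
            (by fun_prop) (.of_forall fun σ => (measurePreserving_add_left volume _).map_eq)
        exact (hf.1.comp_snd (μ := ν)).comp_measurePreserving hmp
      · exact (hgt _).1.comp_snd
    have h1 : Integrable (fun p : ℝ × ℝ × Plane => f ((p.1, 0) + p.2) * g ((h, 0) + p.2))
        (ν.prod volume) := by
      rw [integrable_prod_iff hmeas]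
      refine ⟨.of_forall fun σ =>
        integrable_mul_of_memLp (hft (σ, 0)) (hgt (h, 0)), ?_⟩
      refine Integrable.of_bound hmeas.norm.integral_prod_right'
        ((eLpNorm f 2 volume).toReal * (eLpNorm (fun y => g ((h, 0) + y)) 2 volume).toReal)
        (.of_forall fun σ => ?_)
      rw [Real.norm_eq_abs]
      simp only [norm_mul]
      have := abs_integral_mul_le (hft (σ, 0)).norm (hgt (h, 0)).norm
      rwa [eLpNorm_norm, eLpNorm_norm, hnorm] at this
    have e : ν.prod μ = (ν.prod volume).restrict (univ ×ˢ (Ioo a b ×ˢ univ)) := by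
      rw [← Measure.prod_restrict, Measure.restrict_univ]
    rw [e]
    exact h1.restrict
  have hg2 : ∀ᵐ t, MemLp (fun x => g (h + t, x)) 2 volume := by
    have h1 := (hgt (h, 0)).integrable_sq
    have h2 : AEStronglyMeasurable (fun y : ℝ × Plane => g ((h, 0) + y)) (volume.prod volume) :=
      (hgt (h, 0)).1
    filter_upwards [h1.prod_right_ae, h2.prodMk_left] with t ht ht'
    simp only [Prod.mk_add_mk, zero_add] at ht ht'
    exact (memLp_two_iff_integrable_sq ht').2 ht
  -- for almost every time, integrate first in the position
  have hswap : ∀ᵐ t, ∫ x, ∫ σ, f ((σ, 0) + (t, x)) * g ((h, 0) + (t, x)) ∂ν =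
      ∫ σ in (0 : ℝ)..h, ∫ x, f (σ + t, x) * g (h + t, x) := by
    filter_upwards [hg2] with t ht
    rw [intervalIntegral.integral_of_le hh]
    simp only [Prod.mk_add_mk, zero_add]
    refine (integral_integral_swap (f := fun σ x => f (σ + t, x) * g (h + t, x)) ?_).symm
    have m1 : MemLp (fun p : ℝ × Plane => f (p.1 + t, p.2)) 2 (ν.prod volume) := by
      have e : ν.prod (volume : Measure Plane) = (volume : Measure (ℝ × Plane)).restrict
          (Ioc 0 h ×ˢ univ) := by
        rw [← Measure.restrict_univ (μ := (volume : Measure Plane)), Measure.prod_restrict]; rfl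
      rw [e]
      refine ((hft (t, 0)).restrict _).ae_eq (.of_forall fun p => ?_)
      rw [← Prod.mk.eta (p := p), Prod.mk_add_mk, zero_add, add_comm]
    have m2 : MemLp (fun p : ℝ × Plane => g (h + t, p.2)) 2 (ν.prod volume) :=
      ht.comp_snd ν
    exact integrable_mul_of_memLp m1 m2
  have hK := hF.integral_prod_right
  have hK2 := hK
  rw [hμ] at hK2
  refine ⟨hK2.integral_prod_left.congr (ae_restrict_of_ae hswap), ?_⟩
  rw [intervalIntegral.integral_of_le hh, integral_integral_swap hF, hμ, integral_prod _ hK2]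
  exact (integral_congr_ae (ae_restrict_of_ae hswap)).symm

lemma lintegral_enorm_sq_eq {f : Plane → ℝ} {μ : Measure Plane} :
    ∫⁻ x, ‖f x‖ₑ ^ (2 : ℝ) ∂μ = eLpNorm f 2 μ ^ (2 : ℝ) := by
  rw [eLpNorm_eq_lintegral_rpow_enorm_toReal two_ne_zero ENNReal.ofNat_ne_top]
  simp only [ENNReal.toReal_ofNat, one_div]
  rw [← ENNReal.rpow_mul]; norm_num

lemma memLp_cylinder_of_slice {ι : Type*} [Fintype ι] {f : ℝ → Plane → ℝ}
    {g : ι → ℝ → Plane → ℝ} {C : ℝ≥0}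
    (hf : AEStronglyMeasurable (fun p : ℝ × Plane => f p.1 p.2) (volume.restrict (cylinder Ω T)))
    (hg : ∀ i, MemLp (fun p : ℝ × Plane => g i p.1 p.2) 2 (volume.restrict (cylinder Ω T)))
    (h : ∀ᵐ t ∂(volume.restrict (Ioo 0 T)), eLpNorm (f t) 2 (volume.restrict Ω) ≤
      C * ∑ i, eLpNorm (g i t) 2 (volume.restrict Ω)) :
    MemLp (fun p : ℝ × Plane => f p.1 p.2) 2 (volume.restrict (cylinder Ω T)) := by
  refine ⟨hf, ?_⟩
  rw [eLpNorm_lt_top_iff_lintegral_rpow_enorm_lt_top two_ne_zero ENNReal.ofNat_ne_top]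
  have hgfin : ∀ i, ∫⁻ t in Ioo 0 T, eLpNorm (g i t) 2 (volume.restrict Ω) ^ (2 : ℝ) < ⊤ :=
    fun i => by
      have h1 := (hg i).2
      have h2 := (hg i).1
      rw [eLpNorm_lt_top_iff_lintegral_rpow_enorm_lt_top two_ne_zero ENNReal.ofNat_ne_top] at h1
      rw [volume_restrict_cylinder] at h1 h2
      rw [lintegral_prod _ (h2.enorm.pow_const _)] at h1
      simp only [ENNReal.toReal_ofNat, lintegral_enorm_sq_eq (f := g i _)] at h1
      exact h1
  have hgm : ∀ i, AEMeasurable (fun t => eLpNorm (g i t) 2 (volume.restrict Ω) ^ (2 : ℝ))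
      (volume.restrict (Ioo 0 T)) := fun i => by
    have h2 := (hg i).1
    rw [volume_restrict_cylinder] at h2
    have := (h2.enorm.pow_const (2 : ℝ)).lintegral_prod_right'
    simpa only [lintegral_enorm_sq_eq (f := g i _)] using this
  rw [volume_restrict_cylinder] at hf ⊢
  rw [lintegral_prod _ (hf.enorm.pow_const _)]
  simp only [ENNReal.toReal_ofNat, lintegral_enorm_sq_eq (f := f _)]
  refine (lintegral_mono_ae (g := fun t => ((C : ℝ≥0∞) ^ (2 : ℝ) * (Fintype.card ι : ℝ≥0∞)) *
    ∑ i, eLpNorm (g i t) 2 (volume.restrict Ω) ^ (2 : ℝ)) ?_).trans_lt ?_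
  · filter_upwards [h] with t ht
    refine (ENNReal.rpow_le_rpow ht two_pos.le).trans ?_
    rw [ENNReal.mul_rpow_of_nonneg _ _ two_pos.le, mul_assoc]
    gcongr
    have := ENNReal.rpow_sum_le_const_mul_sum_rpow (s := Finset.univ)
      (fun i => eLpNorm (g i t) 2 (volume.restrict Ω)) (p := 2) one_le_two
    rw [show (2 : ℝ) - 1 = 1 by norm_num, ENNReal.rpow_one] at this
    exact this
  · rw [lintegral_const_mul' _ _ (by finiteness), lintegral_finsetSum' _ fun i _ => hgm i]
    exact ENNReal.mul_lt_top (by finiteness) (ENNReal.sum_lt_top.2 fun i _ => hgfin i)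

variable {u₀ : Plane → Plane} {u : ℝ → Plane → Plane} {G : ℝ → Plane → Fin 2 → Fin 2 → ℝ}

/-- By Ladyzhenskaya's inequality the products of the components of a curve in
`L^∞(0,T; H) ∩ L²(0,T; V)` are square integrable in space-time. -/
lemma IsSolenoidalCurve.memLp_mul (hc : IsSolenoidalCurve Ω T u₀ u)
    (hG : ∀ i j, MemLp (fun p : ℝ × Plane => G p.1 p.2 i j) 2 (volume.restrict (cylinder Ω T)))
    (hV : ∀ᵐ t ∂(volume.restrict (Ioo 0 T)), MemV Ω (u t) (G t)) (i j : Fin 2) :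
    MemLp (fun p : ℝ × Plane => u p.1 p.2 i * u p.1 p.2 j) 2 (volume.restrict (cylinder Ω T)) := by
  obtain ⟨M, hM⟩ := hc.exists_bound
  obtain ⟨C, hC⟩ := exists_ladyzhenskaya_memV Ω
  refine memLp_cylinder_of_slice (f := fun t x => u t x i * u t x j)
    (g := fun (k : Fin 2 × Fin 2) t x => G t x k.1 k.2) (C := C * M)
    ((hc.memLp_cylinder_apply i).1.mul (hc.memLp_cylinder_apply j).1) (fun k => hG k.1 k.2) ?_
  filter_upwards [hV, ae_restrict_mem measurableSet_Ioo] with t ht htI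
  have htI' := Ioo_subset_Icc_self htI
  have hb : ∀ i, eLpNorm (fun x => u t x i) 4 (volume.restrict Ω) ≤
      ((C * M : ℝ≥0) * ∑ k : Fin 2 × Fin 2, eLpNorm (fun x => G t x k.1 k.2) 2 (volume.restrict Ω))
        ^ (1 / 2 : ℝ) := fun i => by
    refine (hC _ _ ht i).trans (ENNReal.rpow_le_rpow ?_ (by norm_num))
    rw [ENNReal.coe_mul, mul_assoc]
    refine mul_le_mul_right (mul_le_mul' (hM t htI').2 ?_) _
    rw [Fintype.sum_prod_type]
    exact Finset.single_le_sum (f := fun i => ∑ j, eLpNorm (fun x => G t x i j) 2 (volume.restrict Ω))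
      (fun _ _ => zero_le) (Finset.mem_univ i)
  refine (eLpNorm_mul_le_four (memLp_component ht.1 i).1 (memLp_component ht.1 j).1).trans
    ((mul_le_mul' (hb i) (hb j)).trans_eq ?_)
  rw [← ENNReal.rpow_add_of_nonneg _ _ (by norm_num) (by norm_num)]
  norm_num

/-- The equation may be tested with fields of `V`. -/
lemma weak_form_memV (hc : IsSolenoidalCurve Ω T u₀ u) {A : Fin 2 → Fin 2 → ℝ × Plane → ℝ}
    (hA : ∀ i j, MemLp (A i j) 2 (volume.restrict (cylinder Ω T)))
    (hw : ∀ φ, IsSolenoidalTest Ω φ → ∀ t ∈ Icc 0 T,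
      (∫ x in Ω, ∑ i, u t x i * φ x i) - ∫ x in Ω, ∑ i, u₀ x i * φ x i =
        ∫ s in (0 : ℝ)..t, ∫ x in Ω, ∑ i, ∑ j, A i j (s, x) * grad φ x i j)
    {r s : ℝ} (hr : 0 ≤ r) (hrs : r ≤ s) (hs : s ≤ T) {v : Plane → Plane}
    {Γ : Plane → Fin 2 → Fin 2 → ℝ} (hv : MemV Ω v Γ) :
    inner ℝ (toL2 Ω (u s) - toL2 Ω (u r)) (toL2 Ω v) =
      ∑ i, ∑ j, ∫ q in r..s, ∫ x in Ω, A i j (q, x) * Γ x i j := by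
  have hT : 0 ≤ T := hr.trans (hrs.trans hs)
  have hrI : r ∈ Icc 0 T := ⟨hr, hrs.trans hs⟩
  have hsI : s ∈ Icc 0 T := ⟨hr.trans hrs, hs⟩
  have hint : ∀ {Γ : Plane → Fin 2 → Fin 2 → ℝ}, (∀ i j, MemLp (fun x => Γ x i j) 2
      (volume.restrict Ω)) → ∀ i j, IntegrableOn (fun p : ℝ × Plane => A i j p * Γ p.2 i j)
      (cylinder Ω T) := fun hΓ i j =>
    integrable_mul_of_memLp (hA i j) (memLp_comp_snd (hΓ i j))
  have hslab : ∀ {Γ : Plane → Fin 2 → Fin 2 → ℝ}, (∀ i j, MemLp (fun x => Γ x i j) 2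
      (volume.restrict Ω)) → ∫ q in r..s, ∫ x in Ω, ∑ i, ∑ j, A i j (q, x) * Γ x i j =
      ∑ i, ∑ j, ∫ p in Ioo r s ×ˢ Ω, Γ p.2 i j * A i j p := fun {Γ} hΓ => by
    rw [intervalIntegral_slice (f := fun p => ∑ i, ∑ j, A i j p * Γ p.2 i j)
      (integrable_finsetSum _ fun i _ => integrable_finsetSum _ fun j _ => hint hΓ i j) hr hrs hs,
      integral_sum_sum fun i j => (hint hΓ i j).mono_set
        (prod_mono (Ioo_subset_Ioo hr hs) subset_rfl)]
    simp only [mul_comm]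
  have htest : ∀ φ, IsSolenoidalTest Ω φ → inner ℝ (toL2 Ω (u s) - toL2 Ω (u r)) (toL2 Ω φ) =
      ∫ q in r..s, ∫ x in Ω, ∑ i, ∑ j, A i j (q, x) * grad φ x i j := fun φ hφ => by
    exact hc.inner_sub_eq hφ (F := fun p => ∑ i, ∑ j, A i j p * grad φ p.2 i j)
      (integrable_finsetSum _ fun i _ => integrable_finsetSum _ fun j _ =>
        hint (fun i j => hφ.memLp_grad i j 2 _) i j) (hw φ hφ) hr hrs hs
  obtain ⟨hv2, hΓ, φ, hφ, hlim, hlim'⟩ := hv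
  have h1 := tendsto_const_nhds (x := toL2 Ω (u s) - toL2 Ω (u r)).inner (𝕜 := ℝ)
    ((tendsto_toL2_iff (fun k => (hφ k).memLp 2 _) hv2).2 hlim)
  have e0 : ∀ i j, ∫ q in r..s, ∫ x in Ω, A i j (q, x) * Γ x i j =
      ∫ p in Ioo r s ×ˢ Ω, Γ p.2 i j * A i j p := fun i j => by
    simpa only [mul_comm] using intervalIntegral_slice (hint hΓ i j) hr hrs hs
  simp only [e0]
  refine tendsto_nhds_unique h1 (Tendsto.congr (fun k => ((htest _ (hφ k)).trans
    (hslab fun i j => (hφ k).memLp_grad i j 2 _)).symm) ?_)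
  have hμ : (volume : Measure (ℝ × Plane)).restrict (Ioo r s ×ˢ Ω) ≤
      volume.restrict (cylinder Ω T) :=
    Measure.restrict_mono_set _ (prod_mono (Ioo_subset_Ioo hr hs) subset_rfl)
  refine tendsto_finsetSum _ fun i _ => tendsto_finsetSum _ fun j _ =>
    tendsto_integral_mul (fun k => (memLp_comp_snd ((hφ k).memLp_grad i j 2 _)).mono_measure hμ)
      ((memLp_comp_snd (hΓ i j)).mono_measure hμ) ((hA i j).mono_measure hμ) ?_
  have e : ∀ k, eLpNorm ((fun p : ℝ × Plane => grad (φ k) p.2 i j) - fun p => Γ p.2 i j) 2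
      (volume.restrict (Ioo r s ×ˢ Ω)) = (ENNReal.ofReal (s - r)) ^ (1 / 2 : ℝ) *
      eLpNorm (fun x => grad (φ k) x i j - Γ x i j) 2 (volume.restrict Ω) := fun k =>
    eLpNorm_comp_snd_slab (((hφ k).memLp_grad i j 2 _).sub (hΓ i j)).1 r s
  simp only [e]
  have := ENNReal.Tendsto.const_mul (a := (ENNReal.ofReal (s - r)) ^ (1 / 2 : ℝ)) (hlim' i j)
    (.inr (by finiteness))
  rwa [mul_zero] at this

lemma norm_sq_sub_le_inner {E : Type*} [NormedAddCommGroup E] [InnerProductSpace ℝ E] (x y : E) :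
    ‖x‖ ^ 2 - ‖y‖ ^ 2 ≤ 2 * inner ℝ (x - y) x := by
  have h1 := norm_sub_sq_real x y
  have h2 := sq_nonneg ‖x - y‖
  rw [inner_sub_left, real_inner_self_eq_norm_sq, real_inner_comm]
  linarith

/-- The difference quotient of the energy controls the energy: if the increments of the continuous
function `θ` over time steps `h` are bounded in the mean by `2 ∫₀ʰ Φ(σ, h) dσ` with a
continuous `Φ` satisfying `Φ(0, 0) ≤ 0`, then `θ` decreases. -/
lemma le_of_mean_increment_le {θ : ℝ → ℝ} {Φ : ℝ → ℝ → ℝ} {a b c d : ℝ}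
    (hθ : ContinuousOn θ (Icc c d)) (hca : c < a) (hab : a < b) (hbd : b < d)
    (hΦ : Continuous fun p : ℝ × ℝ => Φ p.1 p.2) (h0 : Φ 0 0 ≤ 0)
    (h : ∀ h, 0 < h → b + h ≤ d →
      ∫ t in a..b, (θ (t + h) - θ t) ≤ 2 * ∫ σ in (0 : ℝ)..h, Φ σ h) : θ b ≤ θ a := by
  refine le_of_forall_pos_le_add fun ε hε => ?_
  have hε4 : 0 < ε / 4 := by positivity
  have ha : ContinuousAt θ a := hθ.continuousAt (Icc_mem_nhds hca (hab.trans hbd))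
  have hb : ContinuousAt θ b := hθ.continuousAt (Icc_mem_nhds (hca.trans hab) hbd)
  obtain ⟨δ₁, hδ₁, H1⟩ := Metric.continuousAt_iff.1 ha _ hε4
  obtain ⟨δ₂, hδ₂, H2⟩ := Metric.continuousAt_iff.1 hb _ hε4
  obtain ⟨δ₃, hδ₃, H3⟩ := Metric.continuousAt_iff.1 (hΦ.continuousAt (x := (0, 0))) _ hε4
  obtain ⟨η, hη, hηlt⟩ := exists_between (show 0 < min (min δ₁ δ₂) (min δ₃ (d - b)) from
    lt_min (lt_min hδ₁ hδ₂) (lt_min hδ₃ (sub_pos.2 hbd)))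
  simp only [lt_min_iff] at hηlt
  obtain ⟨⟨hη1, hη2⟩, hη3, hη4⟩ := hηlt
  have hcont : ∀ {x y}, c ≤ x → x ≤ y → y ≤ d → IntervalIntegrable θ volume x y :=
    fun hx hxy hy => (hθ.mono (Icc_subset_Icc hx hy)).intervalIntegrable_of_Icc hxy
  have hη5 : b + η ≤ d := by linarith
  have key := h η hη hη5
  have e1 : ∫ t in a..b, (θ (t + η) - θ t) =
      (∫ t in b..b + η, θ t) - ∫ t in a..a + η, θ t := by
    rw [intervalIntegral.integral_sub ?_ (hcont hca.le hab.le hbd.le),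
      intervalIntegral.integral_comp_add_right]
    · rw [intervalIntegral.integral_interval_sub_interval_comm'
        (hcont (by linarith) (by linarith) hη5) (hcont hca.le hab.le hbd.le) ?_]
      exact (hcont hca.le (by linarith : a ≤ a + η) (by linarith)).symm
    · simpa using (hcont (x := a + η) (y := b + η) (by linarith) (by linarith) hη5).comp_add_right η
  have e2 : η * (θ b - ε / 4) ≤ ∫ t in b..b + η, θ t := by
    have := intervalIntegral.integral_mono_on (by linarith : b ≤ b + η)
      (intervalIntegrable_const (c := θ b - ε / 4)) (hcont (by linarith) (by linarith) hη5)
      fun t ht => by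
        have := abs_lt.1 (H2 (x := t) (by
          rw [Real.dist_eq, abs_of_nonneg (by linarith [ht.1])]; linarith [ht.2]))
        linarith
    rwa [intervalIntegral.integral_const, add_sub_cancel_left, smul_eq_mul] at this
  have e3 : ∫ t in a..a + η, θ t ≤ η * (θ a + ε / 4) := by
    have := intervalIntegral.integral_mono_on (by linarith : a ≤ a + η)
      (hcont hca.le (by linarith) (by linarith)) (intervalIntegrable_const (c := θ a + ε / 4))
      fun t ht => by
        have := abs_lt.1 (H1 (x := t) (by
          rw [Real.dist_eq, abs_of_nonneg (by linarith [ht.1])]; linarith [ht.2]))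
        linarith
    rwa [intervalIntegral.integral_const, add_sub_cancel_left, smul_eq_mul] at this
  have e4 : ∫ σ in (0 : ℝ)..η, Φ σ η ≤ η * (ε / 4) := by
    have := intervalIntegral.integral_mono_on (μ := volume) (f := fun σ => Φ σ η) hη.le
      ((hΦ.comp (f := fun σ : ℝ => (σ, η)) (by fun_prop)).intervalIntegrable 0 η)
      (intervalIntegrable_const (c := ε / 4))
      fun t ht => by
        have : _ ∧ Φ t η - Φ 0 0 < _ := abs_lt.1 (H3 (x := (t, η)) (by
          rw [Prod.dist_eq, max_lt_iff]
          simp only [Real.dist_eq, sub_zero]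
          rw [abs_of_nonneg ht.1, abs_of_pos hη]
          exact ⟨by linarith [ht.2], hη3⟩))
        exact (by linarith [this.2] : Φ t η ≤ ε / 4)
    rwa [intervalIntegral.integral_const, sub_zero, smul_eq_mul] at this
  rw [e1] at key
  have : η * (θ b - ε / 4 - (θ a + ε / 4) - 2 * (ε / 4)) ≤ 0 := by nlinarith
  have := nonpos_of_mul_nonpos_right this hη
  linarith

/-- The energy of a Navier–Stokes solution does not increase. Formally, the solution is itself used
as test field; here it is tested, at almost every time `t + h`, over the interval `(t, t + h)`, and
`h → 0` after averaging in `t`. -/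
lemma IsNavierStokesSolution.norm_le {κ : ℝ} (hΩ : IsOpen Ω) (hκ : 0 < κ)
    (hns : IsNavierStokesSolution Ω T κ u₀ u) {t : ℝ} (ht : t ∈ Icc 0 T) :
    ‖toL2 Ω (u t)‖ ≤ ‖toL2 Ω (u 0)‖ := by
  obtain ⟨hc, G, hG, hV, hw⟩ := hns
  have hQ : MeasurableSet (cylinder Ω T) := measurableSet_Ioo.prod hΩ.measurableSet
  have : (volume : Measure (ℝ × Plane)).IsAddHaarMeasure := Measure.prod.instIsAddHaarMeasure _ _
  let A : Fin 2 → Fin 2 → ℝ × Plane → ℝ := fun i j p =>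
    u p.1 p.2 i * u p.1 p.2 j - κ * G p.1 p.2 i j
  have hA : ∀ i j, MemLp (A i j) 2 (volume.restrict (cylinder Ω T)) := fun i j =>
    (hc.memLp_mul hG hV i j).sub ((hG i j).const_mul κ)
  have hweak := @weak_form_memV Ω T u₀ u hc A hA fun φ hφ t ht => by
    rw [hw φ hφ t ht]
    simp only [A, sub_mul, mul_assoc]
  let A' : Fin 2 → Fin 2 → ℝ × Plane → ℝ := fun i j => (cylinder Ω T).indicator (A i j)
  let G' : Fin 2 → Fin 2 → ℝ × Plane → ℝ := fun i j =>
    (cylinder Ω T).indicator fun p => G p.1 p.2 i j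
  have hA' : ∀ i j, MemLp (A' i j) 2 volume := fun i j => (memLp_indicator_iff_restrict hQ).2 (hA i j)
  have hG' : ∀ i j, MemLp (G' i j) 2 volume := fun i j => (memLp_indicator_iff_restrict hQ).2 (hG i j)
  have hsq : ContinuousOn (fun t => ‖toL2 Ω (u t)‖ ^ 2) (Icc 0 T) := hc.continuousOn.norm.pow 2
  have hint : ∀ i j, IntegrableOn (fun p => A i j p * G p.1 p.2 i j) (cylinder Ω T) := fun i j =>
    integrable_mul_of_memLp (hA i j) (hG i j)
  have hmono : ∀ a b, 0 < a → a < b → b < T → ‖toL2 Ω (u b)‖ ^ 2 ≤ ‖toL2 Ω (u a)‖ ^ 2 := by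
    intro a b ha hab hb
    let Φ : ℝ → ℝ → ℝ := fun σ h => ∑ i, ∑ j, ∫ y in Ioo a b ×ˢ univ,
      A' i j ((σ, 0) + y) * G' i j ((h, 0) + y)
    refine le_of_mean_increment_le (θ := fun t => ‖toL2 Ω (u t)‖ ^ 2) (Φ := Φ) hsq ha hab hb ?_ ?_ ?_
    · refine continuous_finsetSum _ fun i _ => continuous_finsetSum _ fun j _ => ?_
      exact (continuous_setIntegral_translate_mul (hA' i j) (hG' i j) _).comp
        (f := fun p : ℝ × ℝ => (((p.1, 0) : ℝ × Plane), ((p.2, 0) : ℝ × Plane))) (by fun_prop)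
    · -- `Φ 0 0 = -κ ∫ |∇u|²` since the trilinear form vanishes
      have h1 : ∀ i j, ∫ y in Ioo a b ×ˢ univ, A' i j (((0 : ℝ), (0 : Plane)) + y) *
          G' i j (((0 : ℝ), (0 : Plane)) + y) = ∫ p in Ioo a b ×ˢ Ω, A i j p * G p.1 p.2 i j :=
        fun i j => by
          rw [show ((0 : ℝ), (0 : Plane)) = 0 from rfl]
          simp only [zero_add, A', G', ← indicator_mul]
          rw [setIntegral_indicator hQ]
          congr 2
          ext p
          simp only [cylinder, mem_inter_iff, mem_prod, mem_univ, and_true, mem_Ioo]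
          constructor
          · rintro ⟨h1, -, h2⟩; exact ⟨h1, h2⟩
          · rintro ⟨h1, h2⟩; exact ⟨h1, ⟨ha.trans h1.1, h1.2.trans hb⟩, h2⟩
      simp only [Φ, h1]
      rw [← integral_sum_sum fun i j => (hint i j).mono_set
        (prod_mono (Ioo_subset_Ioo ha.le hb.le) subset_rfl),
        ← intervalIntegral_slice (integrable_finsetSum _ fun i _ =>
          integrable_finsetSum _ fun j _ => hint i j) ha.le hab.le hb.le]
      rw [intervalIntegral.integral_of_le hab.le]
      refine integral_nonpos_of_ae ?_
      filter_upwards [(ae_restrict_iff' measurableSet_Ioc).2 (ae_of_ae_Ioo ha.le hb.le hV)] with q hq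
      have hq1 : ∀ i j, IntegrableOn (fun x => u q x i * u q x j * G q x i j) Ω := fun i j =>
        integrable_mul_of_memLp (hq.memLp_mul i j) (hq.2.1 i j)
      have hq2 : ∀ i j, IntegrableOn (fun x => κ * (G q x i j * G q x i j)) Ω := fun i j =>
        (integrable_mul_of_memLp (hq.2.1 i j) (hq.2.1 i j)).const_mul κ
      have e : ∀ i j x, A i j (q, x) * G q x i j =
          u q x i * u q x j * G q x i j - κ * (G q x i j * G q x i j) := fun i j x => by
        simp only [A]; ring
      have hq3 : ∀ i j, IntegrableOn (fun x => u q x i * u q x j * G q x i j -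
          κ * (G q x i j * G q x i j)) Ω := fun i j => (hq1 i j).sub (hq2 i j)
      simp only [e, Pi.zero_apply]
      rw [integral_sum_sum hq3]
      simp only [integral_sub (hq1 _ _) (hq2 _ _), Finset.sum_sub_distrib]
      rw [← integral_sum_sum hq1, hq.integral_trilinear_eq_zero hΩ, zero_sub]
      exact neg_nonpos.2 (Finset.sum_nonneg fun i _ => Finset.sum_nonneg fun j _ =>
        integral_nonneg fun x => mul_nonneg hκ.le (mul_self_nonneg _))
    · -- the equation on `(t, t + h)`, tested with `u (t + h)`, which lies in `V` for almost all `t`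
      intro h hh hbh
      have hcont : ∀ {x y}, 0 ≤ x → x ≤ y → y ≤ T → IntervalIntegrable
          (fun t => ‖toL2 Ω (u t)‖ ^ 2) volume x y :=
        fun hx hxy hy => (hsq.mono (Icc_subset_Icc hx hy)).intervalIntegrable_of_Icc hxy
      have hsw := fun i j => integral_translate_swap (hA' i j) (hG' i j) a b hh.le
      have hle : ∀ᵐ t ∂(volume.restrict (Ioo a b)),
          ‖toL2 Ω (u (t + h))‖ ^ 2 - ‖toL2 Ω (u t)‖ ^ 2 ≤ 2 * ∑ i, ∑ j,
            ∫ σ in (0 : ℝ)..h, ∫ x, A' i j (σ + t, x) * G' i j (h + t, x) := by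
        have hV' : ∀ᵐ t, t + h ∈ Ioo 0 T → MemV Ω (u (t + h)) (G (t + h)) :=
          (measurePreserving_add_right volume h).quasiMeasurePreserving.ae
            ((ae_restrict_iff' measurableSet_Ioo).1 hV)
        filter_upwards [ae_restrict_of_ae hV', ae_restrict_mem measurableSet_Ioo] with t ht htI
        have hth : t + h ∈ Ioo 0 T := ⟨by linarith [htI.1], by linarith [htI.2]⟩
        refine (norm_sq_sub_le_inner _ _).trans_eq ?_
        rw [hweak (ha.trans htI.1).le (by linarith) hth.2.le (ht hth)]
        congr 1
        refine Finset.sum_congr rfl fun i _ => Finset.sum_congr rfl fun j _ => ?_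
        have := intervalIntegral.integral_comp_add_right
          (fun q => ∫ x in Ω, A i j (q, x) * G (t + h) x i j) t (a := 0) (b := h)
        rw [zero_add, add_comm h t] at this
        rw [← this]
        refine intervalIntegral.integral_congr fun σ hσ => ?_
        rw [uIcc_of_le hh.le] at hσ
        have hσt : σ + t ∈ Ioo 0 T := ⟨by linarith [htI.1, hσ.1], by linarith [htI.2, hσ.2]⟩
        rw [← integral_indicator hΩ.measurableSet]
        congr 1; ext x
        rw [add_comm h t]
        by_cases hx : x ∈ Ω
        · rw [indicator_of_mem hx, show A' i j _ = _ from indicator_of_mem (mk_mem_prod hσt hx) _,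
            show G' i j _ = _ from indicator_of_mem (mk_mem_prod hth hx) _]
        · rw [indicator_of_notMem hx, show A' i j (σ + t, x) = _ from
            indicator_of_notMem (fun h => hx h.2) _, zero_mul]
      calc ∫ t in a..b, (‖toL2 Ω (u (t + h))‖ ^ 2 - ‖toL2 Ω (u t)‖ ^ 2)
          ≤ ∫ t in Ioo a b, 2 * ∑ i, ∑ j,
            ∫ σ in (0 : ℝ)..h, ∫ x, A' i j (σ + t, x) * G' i j (h + t, x) := by
            rw [intervalIntegral.integral_of_le hab.le, integral_Ioc_eq_integral_Ioo]
            refine integral_mono_ae ?_ ((integrable_finsetSum _ fun i _ =>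
              integrable_finsetSum _ fun j _ => (hsw i j).1).const_mul 2) hle
            have : IntervalIntegrable (fun t => ‖toL2 Ω (u (t + h))‖ ^ 2 - ‖toL2 Ω (u t)‖ ^ 2)
                volume a b := by
              refine IntervalIntegrable.sub ?_ (hcont ha.le hab.le hb.le)
              simpa using (hcont (x := a + h) (y := b + h) (by linarith) (by linarith)
                hbh).comp_add_right h
            exact (intervalIntegrable_iff_integrableOn_Ioo_of_le hab.le).1 this
        _ = 2 * ∫ σ in (0 : ℝ)..h, Φ σ h := by
            rw [integral_const_mul, integral_sum_sum fun i j => (hsw i j).1]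
            have hΦi : ∀ i j, Continuous fun σ : ℝ => ∫ y in Ioo a b ×ˢ univ,
                A' i j ((σ, 0) + y) * G' i j ((h, 0) + y) := fun i j =>
              (continuous_setIntegral_translate_mul (hA' i j) (hG' i j) _).comp
                (f := fun σ : ℝ => (((σ, 0) : ℝ × Plane), ((h, 0) : ℝ × Plane))) (by fun_prop)
            simp only [Φ]
            rw [intervalIntegral.integral_finsetSum fun i _ =>
              (continuous_finsetSum _ fun j _ => hΦi i j).intervalIntegrable _ _]
            simp only [intervalIntegral.integral_finsetSum fun j (_ : j ∈ Finset.univ) =>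
              (hΦi _ j).intervalIntegrable _ _, (hsw _ _).2]
  have hT : 0 ≤ T := ht.1.trans ht.2
  refine (pow_le_pow_iff_left₀ (norm_nonneg _) (norm_nonneg _) two_ne_zero).1 ?_
  rcases ht.1.eq_or_lt with rfl | ht0
  · exact le_rfl
  have hT0 : 0 < T := ht0.trans_le ht.2
  have h0 : ∀ b ∈ Ioo 0 T, ‖toL2 Ω (u b)‖ ^ 2 ≤ ‖toL2 Ω (u 0)‖ ^ 2 := fun b hb => by
    have hl : Tendsto (fun a => ‖toL2 Ω (u a)‖ ^ 2) (𝓝[Ioo 0 b] 0) (𝓝 (‖toL2 Ω (u 0)‖ ^ 2)) :=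
      (hsq 0 ⟨le_rfl, hT⟩).mono_left (nhdsWithin_mono _ fun a ha => ⟨ha.1.le, (ha.2.trans hb.2).le⟩)
    have := left_nhdsWithin_Ioo_neBot hb.1
    exact ge_of_tendsto hl (by
      filter_upwards [self_mem_nhdsWithin] with a ha using hmono a b ha.1 ha.2 hb.2)
  have hl : Tendsto (fun a => ‖toL2 Ω (u a)‖ ^ 2) (𝓝[Ioo 0 t] t) (𝓝 (‖toL2 Ω (u t)‖ ^ 2)) :=
    (hsq t ht).mono_left (nhdsWithin_mono _ fun a ha => ⟨ha.1.le, ha.2.le.trans ht.2⟩)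
  have := right_nhdsWithin_Ioo_neBot ht0
  exact le_of_tendsto hl (by
    filter_upwards [self_mem_nhdsWithin] with a ha using h0 a ⟨ha.1, ha.2.trans_le ht.2⟩)

end

section

variable {Ω : Set Plane} {T : ℝ}

/-! ### Sequences of solutions -/

/-- The properties shared by the two kinds of sequences of solutions: the velocities solve the Euler
equations up to an error which tends to zero, and the energy does not exceed its initial value. -/
structure IsAsymptoticEuler (Ω : Set Plane) (T : ℝ) (un0 : ℕ → Plane → Plane)
    (un : ℕ → ℝ → Plane → Plane) : Prop where
  curve : ∀ n, IsSolenoidalCurve Ω T (un0 n) (un n)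
  norm_le : ∀ n, ∀ t ∈ Icc 0 T, ‖toL2 Ω (un n t)‖ ≤ ‖toL2 Ω (un n 0)‖
  weak_form : ∀ φ, IsSolenoidalTest Ω φ → ∃ ε : ℕ → ℝ, Tendsto ε atTop (𝓝 0) ∧
    ∀ n r s, 0 ≤ r → r ≤ s → s ≤ T →
      |inner ℝ (toL2 Ω (un n s) - toL2 Ω (un n r)) (toL2 Ω φ) - ∫ q in r..s, ∫ x in Ω,
        ∑ i, ∑ j, un n q x i * un n q x j * grad φ x i j| ≤ ε n * (s - r)

variable {un0 : ℕ → Plane → Plane} {un : ℕ → ℝ → Plane → Plane} {u0 : Plane → Plane}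

lemma isAsymptoticEuler_of_euler (hΩ : IsOpen Ω) (h : ∀ n, IsEulerSolution Ω T (un0 n) (un n)) :
    IsAsymptoticEuler Ω T un0 un where
  curve n := (h n).curve
  norm_le n _ ht := ((h n).norm_eq hΩ ht).le
  weak_form φ hφ := ⟨fun _ => 0, tendsto_const_nhds, fun n r s hr hrs hs => by
    have hc := (h n).curve
    rw [hc.inner_sub_eq hφ (F := fun p => ∑ i, ∑ j, un n p.1 p.2 i * un n p.1 p.2 j *
        grad φ p.2 i j) (integrable_finsetSum _ fun i _ => integrable_finsetSum _ fun j _ =>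
          hc.integrableOn_convection hφ i j) ((h n).weak_form φ hφ) hr hrs hs]
    simp⟩

lemma tendsto_toL2_zero (hT : 0 ≤ T) (hc : ∀ n, IsSolenoidalCurve Ω T (un0 n) (un n))
    (hu0 : MemLp u0 2 (volume.restrict Ω))
    (hinit : Tendsto (fun n => eLpNorm (un0 n - u0) 2 (volume.restrict Ω)) atTop (𝓝 0)) :
    Tendsto (fun n => toL2 Ω (un n 0)) atTop (𝓝 (toL2 Ω u0)) := by
  refine (tendsto_toL2_iff (fun n => (hc n).memLp ⟨le_rfl, hT⟩) hu0).2 (hinit.congr fun n => ?_)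
  exact eLpNorm_congr_ae ((hc n).initial.symm.sub .rfl)

lemma isAsymptoticEuler_of_navierStokes (hΩ : IsOpen Ω) (hT : 0 ≤ T)
    (hu0 : MemLp u0 2 (volume.restrict Ω))
    (hinit : Tendsto (fun n => eLpNorm (un0 n - u0) 2 (volume.restrict Ω)) atTop (𝓝 0))
    {κ : ℕ → ℝ} (hκ : ∀ n, 0 < κ n) (hκ0 : Tendsto κ atTop (𝓝 0))
    (h : ∀ n, IsNavierStokesSolution Ω T (κ n) (un0 n) (un n)) :
    IsAsymptoticEuler Ω T un0 un where
  curve n := (h n).curve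
  norm_le n _ ht := (h n).norm_le hΩ (hκ n) ht
  weak_form φ hφ := by
    -- the viscous term is `κ ⟪u, Δφ⟫`
    let L : Fin 2 → Plane → ℝ := fun i x => ∑ j, pderiv (fun y => grad φ y i j) x j
    have hg : ∀ i j, ContDiff ℝ ∞ fun x => grad φ x i j := fun i j => by
      simpa only [hφ.grad_eq] using contDiff_pderiv (hφ.contDiff_apply i) j
    have hg1 : ∀ i j, ContDiff ℝ 1 fun x => grad φ x i j := fun i j => (hg i j).of_le (by simp)
    have hgs : ∀ i j, tsupport (fun x => grad φ x i j) ⊆ Ω := fun i j => by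
      simpa only [hφ.grad_eq] using
        (tsupport_pderiv_subset _ j).trans (hφ.tsupport_apply_subset i)
    have hLj : ∀ i j, MemLp (fun x => pderiv (fun y => grad φ y i j) x j) 2 (volume.restrict Ω) :=
      fun i j => (continuous_pderiv (hg1 i j) j).memLp_of_hasCompactSupport
        (hasCompactSupport_pderiv (hφ.hasCompactSupport_grad i j) j)
    have hL : ∀ i, MemLp (L i) 2 (volume.restrict Ω) := fun i => memLp_finsetSum _ fun j _ => hLj i j
    refine ⟨fun n => κ n * (‖toL2 Ω (un n 0)‖ * ‖toL2 Ω (ofComponents L)‖), ?_, ?_⟩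
    · simpa using hκ0.mul ((tendsto_toL2_zero hT (fun n => (h n).curve) hu0 hinit).norm.mul_const
        ‖toL2 Ω (ofComponents L)‖)
    intro n r s hr hrs hs
    have hle := fun t ht => (h n).norm_le hΩ (hκ n) (t := t) ht
    obtain ⟨hc, G, hG, hV, hw⟩ := h n
    have hint1 := fun i j => hc.integrableOn_convection hφ i j
    have hint2 : ∀ i j, IntegrableOn (fun p : ℝ × Plane => κ n * (G p.1 p.2 i j * grad φ p.2 i j))
        (cylinder Ω T) := fun i j =>
      (integrable_mul_of_memLp (hG i j) (memLp_comp_snd (hφ.memLp_grad i j 2 _))).const_mul _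
    have hI1 : IntegrableOn (fun p : ℝ × Plane => ∑ i, ∑ j, un n p.1 p.2 i * un n p.1 p.2 j *
        grad φ p.2 i j) (cylinder Ω T) :=
      integrable_finsetSum _ fun i _ => integrable_finsetSum _ fun j _ => hint1 i j
    have hI : IntegrableOn (fun p : ℝ × Plane => ∑ i, ∑ j, (un n p.1 p.2 i * un n p.1 p.2 j *
        grad φ p.2 i j - κ n * (G p.1 p.2 i j * grad φ p.2 i j))) (cylinder Ω T) :=
      integrable_finsetSum _ fun i _ => integrable_finsetSum _ fun j _ => (hint1 i j).sub (hint2 i j)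
    rw [hc.inner_sub_eq hφ hI (hw φ hφ) hr hrs hs]
    rw [← intervalIntegral.integral_sub
      (intervalIntegrable_mono_Icc (intervalIntegrable_slice hT hI) hr hrs hs)
      (intervalIntegrable_mono_Icc (intervalIntegrable_slice hT hI1) hr hrs hs)]
    have hb := intervalIntegral.norm_integral_le_of_norm_le_const_ae (a := r) (b := s)
      (f := fun q => (∫ x in Ω, ∑ i, ∑ j, (un n q x i * un n q x j *
        grad φ x i j - κ n * (G q x i j * grad φ x i j))) - ∫ x in Ω, ∑ i, ∑ j,
        un n q x i * un n q x j * grad φ x i j)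
      (C := κ n * (‖toL2 Ω (un n 0)‖ * ‖toL2 Ω (ofComponents L)‖)) (by
        rw [uIoc_of_le hrs]
        filter_upwards [ae_of_ae_Ioo hr hs hV] with q hq hqI
        have hqI' : q ∈ Icc 0 T := ⟨hr.trans hqI.1.le, hqI.2.trans hs⟩
        have hm := hc.memLp hqI'
        have m1 : ∀ i j, IntegrableOn (fun x => un n q x i * un n q x j * grad φ x i j) Ω :=
          fun i j => integrable_mul_of_memLp ((hq hqI).memLp_mul i j) (hφ.memLp_grad i j 2 _)
        have m2 : ∀ i j, IntegrableOn (fun x => G q x i j * grad φ x i j) Ω := fun i j =>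
          integrable_mul_of_memLp ((hq hqI).2.1 i j) (hφ.memLp_grad i j 2 _)
        have e : (∫ x in Ω, ∑ i, ∑ j, (un n q x i * un n q x j *
            grad φ x i j - κ n * (G q x i j * grad φ x i j))) - ∫ x in Ω, ∑ i, ∑ j,
            un n q x i * un n q x j * grad φ x i j =
            κ n * inner ℝ (toL2 Ω (un n q)) (toL2 Ω (ofComponents L)) := by
          have m3 : ∀ i j, IntegrableOn (fun x => un n q x i * un n q x j * grad φ x i j -
              κ n * (G q x i j * grad φ x i j)) Ω := fun i j => (m1 i j).sub ((m2 i j).const_mul _)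
          rw [inner_toL2 hm (memLp_ofComponents hL), integral_sum_sum m3, integral_sum_sum m1]
          simp only [ofComponents_apply, L, Finset.mul_sum]
          rw [integral_sum_sum fun i j => integrable_mul_of_memLp (memLp_component hm i) (hLj i j)]
          simp only [fun i j => (hq hqI).hasWeakGrad.2.2 _ (hg i j) (hφ.hasCompactSupport_grad i j)
            (hgs i j) i j, fun i j => integral_sub (m1 i j) ((m2 i j).const_mul (κ n)),
            integral_const_mul, Finset.sum_sub_distrib, Finset.sum_neg_distrib]
          simp only [← Finset.mul_sum]
          ring
        rw [e, norm_mul, Real.norm_of_nonneg (hκ n).le]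
        refine mul_le_mul_of_nonneg_left ((norm_inner_le_norm _ _).trans ?_) (hκ n).le
        exact mul_le_mul_of_nonneg_right (hle q hqI') (norm_nonneg _))
    rwa [abs_of_nonneg (sub_nonneg.2 hrs), Real.norm_eq_abs] at hb

end

section

variable {Ω : Set Plane} {T : ℝ}

/-! ### The weak limit -/

lemma abs_integral_convection_le {v : Plane → Plane} (hv : MemLp v 2 (volume.restrict Ω))
    {g : Fin 2 → Fin 2 → Plane → ℝ} {C : ℝ}
    (hC : ∀ i j x, |g i j x| ≤ C) :
    |∫ x in Ω, ∑ i, ∑ j, v x i * v x j * g i j x| ≤ 4 * C * ‖toL2 Ω v‖ ^ 2 := by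
  have hsq : IntegrableOn (fun x => ‖v x‖ ^ 2) Ω := hv.norm.integrable_sq
  have e : ‖toL2 Ω v‖ ^ 2 = ∫ x in Ω, ‖v x‖ ^ 2 := by
    rw [← real_inner_self_eq_norm_sq, inner_toL2 hv hv]
    simp only [← inner_plane, real_inner_self_eq_norm_sq]
  rw [e, ← integral_const_mul, ← Real.norm_eq_abs]
  refine norm_integral_le_of_norm_le (hsq.const_mul _) (.of_forall fun x => ?_)
  have h1 : ∀ i j, |v x i * v x j * g i j x| ≤ C * ‖v x‖ ^ 2 := fun i j => by
    rw [abs_mul, abs_mul, mul_comm C]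
    have hi := PiLp.norm_apply_le (v x) i
    have hj := PiLp.norm_apply_le (v x) j
    rw [Real.norm_eq_abs] at hi hj
    rw [sq]
    exact mul_le_mul (mul_le_mul hi hj (abs_nonneg _) (norm_nonneg _)) (hC i j x) (abs_nonneg _)
      (by positivity)
  calc ‖∑ i, ∑ j, v x i * v x j * g i j x‖ ≤ ∑ i : Fin 2, ∑ j : Fin 2, C * ‖v x‖ ^ 2 :=
        (norm_sum_le _ _).trans (Finset.sum_le_sum fun i _ =>
          (norm_sum_le _ _).trans (Finset.sum_le_sum fun j _ => h1 i j))
    _ = 4 * C * ‖v x‖ ^ 2 := by simp; ring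

section

variable {un0 : ℕ → Plane → Plane} {un : ℕ → ℝ → Plane → Plane} {u0 : Plane → Plane}
  {u : ℝ → Plane → Plane}

namespace IsAsymptoticEuler

lemma exists_bound (H : IsAsymptoticEuler Ω T un0 un) (hT : 0 ≤ T)
    (hu0 : MemLp u0 2 (volume.restrict Ω))
    (hinit : Tendsto (fun n => eLpNorm (un0 n - u0) 2 (volume.restrict Ω)) atTop (𝓝 0)) :
    ∃ M, 0 ≤ M ∧ ∀ n, ∀ t ∈ Icc 0 T, ‖toL2 Ω (un n t)‖ ≤ M := by
  obtain ⟨M, hM⟩ := (tendsto_toL2_zero hT H.curve hu0 hinit).norm.bddAbove_range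
  have hM' : ∀ n, ‖toL2 Ω (un n 0)‖ ≤ M := fun n => hM ⟨n, rfl⟩
  exact ⟨M, (norm_nonneg _).trans (hM' 0), fun n t ht => (H.norm_le n t ht).trans (hM' n)⟩

/-- Tested with a smooth solenoidal field, the velocities are equi-Lipschitz in time. -/
lemma exists_lipschitz (H : IsAsymptoticEuler Ω T un0 un) {M : ℝ}
    (hM : ∀ n, ∀ t ∈ Icc 0 T, ‖toL2 Ω (un n t)‖ ≤ M) {φ : Plane → Plane}
    (hφ : IsSolenoidalTest Ω φ) :
    ∃ L, ∀ n r s, 0 ≤ r → r ≤ s → s ≤ T →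
      |inner ℝ (toL2 Ω (un n s) - toL2 Ω (un n r)) (toL2 Ω φ)| ≤ L * (s - r) := by
  obtain ⟨ε, hε, hw⟩ := H.weak_form φ hφ
  obtain ⟨E, hE⟩ := hε.bddAbove_range
  obtain ⟨C, hC0, hC⟩ := hφ.exists_bound
  refine ⟨E + 4 * C * M ^ 2, fun n r s hr hrs hs => ?_⟩
  have h1 := hw n r s hr hrs hs
  have h2 := intervalIntegral.norm_integral_le_of_norm_le_const (a := r) (b := s)
    (f := fun q => ∫ x in Ω, ∑ i, ∑ j, un n q x i * un n q x j * grad φ x i j)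
    (C := 4 * C * M ^ 2) fun q hq => by
      rw [uIoc_of_le hrs] at hq
      have hqI : q ∈ Icc 0 T := ⟨hr.trans hq.1.le, hq.2.trans hs⟩
      refine (abs_integral_convection_le ((H.curve n).memLp hqI) (g := fun i j x => grad φ x i j)
        fun i j x => (hC x).2 i j).trans ?_
      gcongr
      exact hM n q hqI
  rw [abs_of_nonneg (sub_nonneg.2 hrs), Real.norm_eq_abs] at h2
  have h3 : ε n * (s - r) ≤ E * (s - r) :=
    mul_le_mul_of_nonneg_right (hE ⟨n, rfl⟩) (sub_nonneg.2 hrs)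
  rw [abs_le] at *
  constructor <;> nlinarith [h1.1, h1.2, h2.1, h2.2]

end IsAsymptoticEuler

namespace IsRegularVelocity

lemma contDiffAt (hu : IsRegularVelocity Ω T u) {p : ℝ × Plane} (hp : 0 < p.1) :
    ContDiffAt ℝ 1 (fun p : ℝ × Plane => u p.1 p.2) p :=
  hu.contDiff.contDiffAt ((isOpen_Ioi.prod isOpen_univ).mem_nhds ⟨hp, mem_univ _⟩)

lemma contDiff_slice (hu : IsRegularVelocity Ω T u) {t : ℝ} (ht : 0 < t) : ContDiff ℝ 1 (u t) :=
  contDiff_iff_contDiffAt.2 fun x =>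
    (hu.contDiffAt (p := (t, x)) ht).comp (f := fun x : Plane => (t, x)) x (by fun_prop)

lemma memLp (hu : IsRegularVelocity Ω T u) {t : ℝ} (ht : t ∈ Ioc 0 T) :
    MemLp (u t) 2 (volume.restrict Ω) := by
  obtain ⟨C, hC⟩ := hu.bounds (t / 2) ⟨half_pos ht.1, by linarith [ht.1, ht.2]⟩
  exact ⟨(hu.contDiff_slice ht.1).continuous.aestronglyMeasurable,
    ((hC t ⟨by linarith [ht.1], ht.2⟩).2.1).trans_lt ENNReal.coe_lt_top⟩

lemma exists_norm_le (hu : IsRegularVelocity Ω T u) {s : ℝ} (hs : s ∈ Ioo 0 T) :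
    ∃ C : ℝ, ∀ t ∈ Icc s T, ‖toL2 Ω (u t)‖ ≤ C := by
  obtain ⟨C, hC⟩ := hu.bounds s hs
  refine ⟨C, fun t ht => ?_⟩
  rw [norm_toL2 (hu.memLp ⟨hs.1.trans_le ht.1, ht.2⟩)]
  exact ENNReal.toReal_le_of_le_ofReal C.coe_nonneg (by simpa using (hC t ht).2.1)

lemma exists_hasCompactSupport_approx (f : Lp Plane 2 ((volume : Measure Plane).restrict Ω)) {ε : ℝ}
    (hε : 0 < ε) :
    ∃ g : Plane → Plane, Continuous g ∧ HasCompactSupport g ∧ ‖f - toL2 Ω g‖ ≤ ε := by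
  obtain ⟨g, hg, hfg, hgc, hgm⟩ := (Lp.memLp f).exists_hasCompactSupport_eLpNorm_sub_le
    ENNReal.ofNat_ne_top (ENNReal.ofReal_pos.2 hε).ne'
  refine ⟨g, hgc, hg, ?_⟩
  nth_rewrite 1 [← toL2_coeFn f]
  rw [← toL2_sub (Lp.memLp f) hgm, norm_toL2 ((Lp.memLp f).sub hgm)]
  exact ENNReal.toReal_le_of_le_ofReal hε.le hfg

/-- The limit is weakly continuous in time. -/
lemma continuousOn_inner (hu : IsRegularVelocity Ω T u)
    (w : Lp Plane 2 ((volume : Measure Plane).restrict Ω)) :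
    ContinuousOn (fun t => inner ℝ (toL2 Ω (u t)) w) (Ioc 0 T) := by
  have hcpt : ∀ g : Plane → Plane, Continuous g → HasCompactSupport g →
      ContinuousOn (fun t => inner ℝ (toL2 Ω (u t)) (toL2 Ω g)) (Ioc 0 T) := fun g hg hgc => by
    have h1 : ContinuousOn (fun t => ∫ x in Ω, ∑ i, u t x i * g x i) (Ioc 0 T) := by
      refine continuousOn_integral_of_compact_support (k := tsupport g) hgc ?_ ?_
      · have : ContinuousOn (fun p : ℝ × Plane => u p.1 p.2) (Ioc 0 T ×ˢ univ) :=
          hu.contDiff.continuousOn.mono (prod_mono (fun t ht => ht.1) subset_rfl)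
        simp only [← inner_plane]
        exact this.inner (hg.comp continuous_snd).continuousOn
      · intro t x _ hx
        simp [image_eq_zero_of_notMem_tsupport hx]
    refine h1.congr fun t ht => ?_
    rw [inner_toL2 (hu.memLp ht) (hg.memLp_of_hasCompactSupport hgc)]
  intro t ht
  obtain ⟨s, hs0, hst⟩ := exists_between ht.1
  have hsT : s ∈ Ioo 0 T := ⟨hs0, hst.trans_le ht.2⟩
  obtain ⟨C, hC⟩ := hu.exists_norm_le hsT
  have hcont : ContinuousOn (fun t => inner ℝ (toL2 Ω (u t)) w) (Icc s T) := by
    choose g hg hgc hgw using fun n : ℕ => exists_hasCompactSupport_approx w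
      (ε := 1 / ((n : ℝ) + 1)) (by positivity)
    refine (TendstoUniformlyOn.continuousOn (p := atTop)
      (F := fun n t => inner ℝ (toL2 Ω (u t)) (toL2 Ω (g n))) ?_
      (Eventually.frequently (.of_forall fun n => (hcpt (g n) (hg n) (hgc n)).mono
        fun t ht => ⟨hs0.trans_le ht.1, ht.2⟩)))
    rw [Metric.tendstoUniformlyOn_iff]
    intro ε hε
    have hlim : Tendsto (fun n : ℕ => C * (1 / ((n : ℝ) + 1))) atTop (𝓝 0) := by
      simpa using tendsto_one_div_add_atTop_nhds_zero_nat.const_mul C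
    filter_upwards [hlim.eventually_lt_const hε] with n hn t ht
    rw [Real.dist_eq, ← inner_sub_right]
    refine (abs_real_inner_le_norm _ _).trans_lt (lt_of_le_of_lt ?_ hn)
    exact mul_le_mul (hC t ht) (hgw n) (norm_nonneg _) ((norm_nonneg _).trans (hC t ht))
  refine (hcont t ⟨hst.le, ht.2⟩).mono_of_mem_nhdsWithin ?_
  filter_upwards [self_mem_nhdsWithin, mem_nhdsWithin_of_mem_nhds (Ioi_mem_nhds hst)] with r hr hr'
  exact ⟨le_of_lt hr', hr.2⟩

end IsRegularVelocity

lemma WeakStarTendsto.memLp_cylinder (h : WeakStarTendsto Ω T un u) :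
    MemLp (fun p : ℝ × Plane => u p.1 p.2) 2 (volume.restrict (cylinder Ω T)) := by
  obtain ⟨h1, ⟨C, hC⟩, -⟩ := h
  exact WeakTurbulence.memLp_cylinder h1 hC

lemma intervalIntegral_inner {v : ℝ → Plane → Plane}
    (hv : MemLp (fun p : ℝ × Plane => v p.1 p.2) 2 (volume.restrict (cylinder Ω T)))
    (hvt : ∀ t ∈ Ioc 0 T, MemLp (v t) 2 (volume.restrict Ω))
    (w : Lp Plane 2 ((volume : Measure Plane).restrict Ω)) {a b : ℝ} (ha : 0 ≤ a) (hab : a ≤ b)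
    (hb : b ≤ T) :
    IntervalIntegrable (fun t => inner ℝ (toL2 Ω (v t)) w) volume a b ∧
    ∫ t in a..b, inner ℝ (toL2 Ω (v t)) w =
      ∫ p in Ioo a b ×ˢ Ω, ∑ i, v p.1 p.2 i * w p.2 i := by
  have hint : IntegrableOn (fun p : ℝ × Plane => ∑ i, v p.1 p.2 i * w p.2 i) (cylinder Ω T) :=
    integrable_finsetSum _ fun i _ => integrable_mul_of_memLp (hv.eval_piLp i)
      (memLp_comp_snd (memLp_component (Lp.memLp w) i))
  have e : ∀ t ∈ Ioc a b, inner ℝ (toL2 Ω (v t)) w = ∫ x in Ω, ∑ i, v t x i * w x i :=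
    fun t ht => by
      rw [← inner_toL2 (hvt t ⟨ha.trans_lt ht.1, ht.2.trans hb⟩) (Lp.memLp w), toL2_coeFn]
  constructor
  · refine (intervalIntegrable_congr ?_).1 (intervalIntegrable_mono_Icc
      (intervalIntegrable_slice (ha.trans (hab.trans hb)) hint) ha hab hb)
    rw [uIoc_of_le hab]
    exact fun t ht => (e t ht).symm
  · rw [← intervalIntegral_slice hint ha hab hb]
    refine intervalIntegral.integral_congr_ae (.of_forall fun t ht => ?_)
    rw [uIoc_of_le hab] at ht
    exact e t ht

lemma WeakStarTendsto.tendsto_intervalIntegral (hΩ : IsOpen Ω) (h : WeakStarTendsto Ω T un u)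
    (hc : ∀ n, IsSolenoidalCurve Ω T (un0 n) (un n)) (hut : ∀ t ∈ Ioc 0 T, MemLp (u t) 2 (volume.restrict Ω))
    (w : Lp Plane 2 ((volume : Measure Plane).restrict Ω)) {a b : ℝ} (ha : 0 ≤ a) (hab : a ≤ b)
    (hb : b ≤ T) :
    Tendsto (fun n => ∫ t in a..b, inner ℝ (toL2 Ω (un n t)) w) atTop
      (𝓝 (∫ t in a..b, inner ℝ (toL2 Ω (u t)) w)) := by
  have e : ∀ v : ℝ → Plane → Plane, ∫ p in Ioo a b ×ˢ Ω, ∑ i, v p.1 p.2 i * w p.2 i =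
      ∫ p in cylinder Ω T, ∑ i, v p.1 p.2 i * ((Ioo a b).indicator (fun _ => w p.2) p.1) i := by
    intro v
    have hsub : Ioo a b ×ˢ Ω ⊆ cylinder Ω T := prod_mono (Ioo_subset_Ioo ha hb) subset_rfl
    rw [← inter_eq_right.2 hsub, ← setIntegral_indicator (measurableSet_Ioo.prod hΩ.measurableSet)]
    refine setIntegral_congr_fun (measurableSet_Ioo.prod hΩ.measurableSet) fun p hp => ?_
    by_cases h1 : p.1 ∈ Ioo a b
    · simp only [indicator_of_mem (show p ∈ Ioo a b ×ˢ Ω from ⟨h1, hp.2⟩), indicator_of_mem h1]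
    · simp [indicator_of_notMem (show p ∉ Ioo a b ×ˢ Ω from fun h => h1 h.1), indicator_of_notMem h1]
  rw [(intervalIntegral_inner h.memLp_cylinder hut w ha hab hb).2, e]
  simp only [fun n => (intervalIntegral_inner (hc n).memLp_cylinder
    (fun t ht => (hc n).memLp (Ioc_subset_Icc_self ht)) w ha hab hb).2, e]
  refine h.2.2 (fun t x => (Ioo a b).indicator (fun _ => w x) t) ?_ ?_
  · have : (fun p : ℝ × Plane => (Ioo a b).indicator (fun _ => w p.2) p.1) =
        (Prod.fst ⁻¹' Ioo a b).indicator fun p => w p.2 := by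
      ext1 p; by_cases h1 : p.1 ∈ Ioo a b <;> simp [h1, indicator]
    rw [this]
    exact (aestronglyMeasurable_comp_snd (Lp.memLp w).1).indicator (measurable_fst measurableSet_Ioo)
  · refine (lintegral_mono (g := fun _ => eLpNorm w 2 (volume.restrict Ω)) fun t => ?_).trans_lt ?_
    · by_cases h1 : t ∈ Ioo a b
      · simp [h1]
      · simp [h1, ← Pi.zero_def]
    · rw [lintegral_const]
      exact ENNReal.mul_lt_top (Lp.memLp w).2 (by simp)

/-- Equi-Lipschitz functions converging in the mean to a continuous function converge pointwise. -/
lemma tendsto_of_tendsto_intervalIntegral {f : ℕ → ℝ → ℝ} {g : ℝ → ℝ} {L t T : ℝ} (ht : t ∈ Ioc 0 T)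
    (hL : ∀ n r s, 0 ≤ r → r ≤ s → s ≤ T → |f n s - f n r| ≤ L * (s - r))
    (hf : ∀ n, IntervalIntegrable (f n) volume 0 T)
    (hg : ContinuousOn g (Ioc 0 T))
    (h : ∀ a, 0 < a → a ≤ t → Tendsto (fun n => ∫ r in a..t, f n r) atTop (𝓝 (∫ r in a..t, g r))) :
    Tendsto (fun n => f n t) atTop (𝓝 (g t)) := by
  have hL0 : 0 ≤ L := by
    have := (abs_nonneg _).trans (hL 0 0 t le_rfl ht.1.le ht.2)
    rw [sub_zero] at this
    exact nonneg_of_mul_nonneg_left this ht.1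
  rw [Metric.tendsto_atTop']
  intro ε hε
  obtain ⟨δ, hδ, hgδ⟩ := Metric.continuousWithinAt_iff.1 (hg t ht) (ε / 3) (by positivity)
  obtain ⟨η, hη, hη'⟩ := exists_between (show 0 < min (min δ t) (ε / (3 * (L + 1))) from
    lt_min (lt_min hδ ht.1) (by positivity))
  simp only [lt_min_iff] at hη'
  obtain ⟨⟨hη1, hη2⟩, hη3⟩ := hη'
  have hLη : L * η < ε / 3 := by
    rw [lt_div_iff₀ (by positivity)] at hη3 ⊢
    nlinarith
  have ha : 0 < t - η := by linarith
  obtain ⟨N, hN⟩ := (Metric.tendsto_atTop.1 (h (t - η) ha (by linarith))) (η * (ε / 3)) (by positivity)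
  refine ⟨N, fun n hn => ?_⟩
  have h1 := hN n hn.le
  rw [Real.dist_eq] at h1 ⊢
  have e1 : |(∫ r in t - η..t, f n r) - η * f n t| ≤ η * (ε / 3) := by
    have : (∫ r in t - η..t, f n r) - η * f n t = ∫ r in t - η..t, (f n r - f n t) := by
      rw [intervalIntegral.integral_sub
        (intervalIntegrable_mono_Icc (hf n) ha.le (by linarith) ht.2)
          (intervalIntegrable_const (c := f n t))]
      simp
    rw [this]
    suffices h : ∀ r ∈ uIoc (t - η) t, ‖f n r - f n t‖ ≤ ε / 3 by
      have := intervalIntegral.norm_integral_le_of_norm_le_const h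
      rwa [sub_sub_cancel, abs_of_pos hη, mul_comm] at this
    intro r hr
    rw [uIoc_of_le (by linarith)] at hr
    rw [norm_sub_rev]
    refine (hL n r t (ha.trans hr.1).le hr.2 ht.2).trans ?_
    nlinarith [hr.1, hr.2]
  have e2 : |(∫ r in t - η..t, g r) - η * g t| ≤ η * (ε / 3) := by
    have hgi : IntervalIntegrable g volume (t - η) t :=
      (hg.mono fun r hr => ⟨ha.trans_le hr.1, hr.2.trans ht.2⟩).intervalIntegrable_of_Icc (by linarith)
    have : (∫ r in t - η..t, g r) - η * g t = ∫ r in t - η..t, (g r - g t) := by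
      rw [intervalIntegral.integral_sub hgi (intervalIntegrable_const (c := g t))]
      simp
    rw [this]
    suffices h : ∀ r ∈ uIoc (t - η) t, ‖g r - g t‖ ≤ ε / 3 by
      have := intervalIntegral.norm_integral_le_of_norm_le_const h
      rwa [sub_sub_cancel, abs_of_pos hη, mul_comm] at this
    intro r hr
    rw [uIoc_of_le (by linarith)] at hr
    refine (hgδ ⟨ha.trans hr.1, hr.2.trans ht.2⟩ ?_).le
    rw [Real.dist_eq, abs_of_nonpos (by linarith [hr.2])]
    linarith [hr.1]
  have e3 : η * |f n t - g t| < η * ε := by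
    rw [← abs_of_pos hη, ← abs_mul, abs_of_pos hη]
    rw [abs_lt] at *
    rw [abs_le] at e1 e2
    constructor <;> nlinarith [e1.1, e1.2, e2.1, e2.2, h1.1, h1.2]
  exact lt_of_mul_lt_mul_left e3 hη.le

lemma hasOrthogonalProjection_solenoidalSpace : (solenoidalSpace Ω).HasOrthogonalProjection :=
  have : CompleteSpace (solenoidalSpace Ω) := isClosed_solenoidalSpace.completeSpace_coe
  inferInstance

/-- Weak convergence of bounded fields on the solenoidal space may be tested with smooth fields. -/
lemma tendsto_inner_of_dense {ι : Type*} {l : Filter ι}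
    {U : ι → Lp Plane 2 ((volume : Measure Plane).restrict Ω)}
    {V : Lp Plane 2 ((volume : Measure Plane).restrict Ω)} {M : ℝ} (hU : ∀ᶠ k in l, ‖U k‖ ≤ M)
    (h : ∀ φ, IsSolenoidalTest Ω φ → Tendsto (fun k => inner ℝ (U k) (toL2 Ω φ)) l
      (𝓝 (inner ℝ V (toL2 Ω φ))))
    {w : Lp Plane 2 ((volume : Measure Plane).restrict Ω)} (hw : w ∈ solenoidalSpace Ω) :
    Tendsto (fun k => inner ℝ (U k) w) l (𝓝 (inner ℝ V w)) := by
  refine Metric.tendsto_nhds.2 fun ε hε => ?_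
  have hM : 0 ≤ |M| + ‖V‖ := by positivity
  obtain ⟨_, ⟨φ, hφ, rfl⟩, hwφ⟩ := Metric.mem_closure_iff.1 (mem_solenoidalSpace_iff.1 hw)
    (ε / (2 * (|M| + ‖V‖ + 1))) (by positivity)
  rw [dist_eq_norm, lt_div_iff₀ (by positivity)] at hwφ
  filter_upwards [hU, Metric.tendsto_nhds.1 (h φ hφ) (ε / 2) (by positivity)] with k hk1 hk2
  rw [Real.dist_eq] at hk2 ⊢
  have e : inner ℝ (U k) w - inner ℝ V w = inner ℝ (U k - V) (w - toL2 Ω φ) +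
      (inner ℝ (U k) (toL2 Ω φ) - inner ℝ V (toL2 Ω φ)) := by
    simp only [inner_sub_left, inner_sub_right]; ring
  rw [e]
  refine (abs_add_le _ _).trans_lt ?_
  have h1 := abs_real_inner_le_norm (U k - V) (w - toL2 Ω φ)
  have h2 : ‖U k - V‖ ≤ |M| + ‖V‖ := (norm_sub_le _ _).trans (by linarith [le_abs_self M])
  nlinarith [norm_nonneg (w - toL2 Ω φ)]

/-- The velocities converge weakly at each positive time. -/
lemma tendsto_inner_slice (hΩ : IsOpen Ω) (H : IsAsymptoticEuler Ω T un0 un)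
    (hlim : WeakStarTendsto Ω T un u) (hu : IsRegularVelocity Ω T u) {M : ℝ}
    (hM : ∀ n, ∀ t ∈ Icc 0 T, ‖toL2 Ω (un n t)‖ ≤ M) {t : ℝ} (ht : t ∈ Ioc 0 T)
    (w : Lp Plane 2 ((volume : Measure Plane).restrict Ω)) :
    Tendsto (fun n => inner ℝ (toL2 Ω (un n t)) w) atTop (𝓝 (inner ℝ (toL2 Ω (u t)) w)) := by
  have hT : 0 ≤ T := ht.1.le.trans ht.2
  have key : ∀ w L, (∀ n r s, 0 ≤ r → r ≤ s → s ≤ T →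
      |inner ℝ (toL2 Ω (un n s) - toL2 Ω (un n r)) w| ≤ L * (s - r)) →
      Tendsto (fun n => inner ℝ (toL2 Ω (un n t)) w) atTop (𝓝 (inner ℝ (toL2 Ω (u t)) w)) :=
    fun w L hL => tendsto_of_tendsto_intervalIntegral (f := fun n t => inner ℝ (toL2 Ω (un n t)) w)
      (g := fun t => inner ℝ (toL2 Ω (u t)) w) ht
      (fun n r s hr hrs hs => by rw [← inner_sub_left]; exact hL n r s hr hrs hs)
      (fun n => (intervalIntegral_inner (H.curve n).memLp_cylinder
        (fun t ht => (H.curve n).memLp (Ioc_subset_Icc_self ht)) w le_rfl hT le_rfl).1)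
      (hu.continuousOn_inner w)
      fun a ha hat => hlim.tendsto_intervalIntegral hΩ H.curve (fun t ht => hu.memLp ht) w ha.le hat ht.2
  have := hasOrthogonalProjection_solenoidalSpace (Ω := Ω)
  have h1 := tendsto_inner_of_dense (.of_forall fun n => hM n t (Ioc_subset_Icc_self ht))
    (fun φ hφ => by
      obtain ⟨L, hL⟩ := H.exists_lipschitz hM hφ
      exact key _ L hL) ((solenoidalSpace Ω).starProjection_apply_mem w)
  have h2 := key (w - (solenoidalSpace Ω).starProjection w) 0 fun n r s hr hrs hs => by
    rw [zero_mul, (solenoidalSpace Ω).inner_right_of_mem_orthogonal ((solenoidalSpace Ω).sub_mem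
      ((H.curve n).memH s ⟨hr.trans hrs, hs⟩).toL2_mem ((H.curve n).memH r ⟨hr, hrs.trans hs⟩).toL2_mem)
      ((solenoidalSpace Ω).sub_starProjection_mem_orthogonal w), abs_zero]
  simpa only [← inner_add_right, add_sub_cancel] using h1.add h2

/-- The weak limit is solenoidal and tangent to the boundary. -/
lemma toL2_mem_solenoidalSpace (hΩ : IsOpen Ω) (H : IsAsymptoticEuler Ω T un0 un)
    (hlim : WeakStarTendsto Ω T un u) (hu : IsRegularVelocity Ω T u) {M : ℝ}
    (hM : ∀ n, ∀ t ∈ Icc 0 T, ‖toL2 Ω (un n t)‖ ≤ M) {t : ℝ} (ht : t ∈ Ioc 0 T) :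
    toL2 Ω (u t) ∈ solenoidalSpace Ω := by
  have := hasOrthogonalProjection_solenoidalSpace (Ω := Ω)
  rw [← (solenoidalSpace Ω).orthogonal_orthogonal]
  intro w hw
  rw [real_inner_comm]
  refine tendsto_nhds_unique (tendsto_inner_slice hΩ H hlim hu hM ht w)
    (tendsto_const_nhds.congr fun n => ?_)
  exact ((solenoidalSpace Ω).inner_right_of_mem_orthogonal
    ((H.curve n).memH t (Ioc_subset_Icc_self ht)).toL2_mem hw).symm

/-- The energy of the weak limit does not exceed the initial energy. -/
lemma norm_limit_le (hΩ : IsOpen Ω) (H : IsAsymptoticEuler Ω T un0 un)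
    (hlim : WeakStarTendsto Ω T un u) (hu : IsRegularVelocity Ω T u) {M : ℝ}
    (hM : ∀ n, ∀ t ∈ Icc 0 T, ‖toL2 Ω (un n t)‖ ≤ M) (hu0 : MemLp u0 2 (volume.restrict Ω))
    (hinit : Tendsto (fun n => eLpNorm (un0 n - u0) 2 (volume.restrict Ω)) atTop (𝓝 0))
    {t : ℝ} (ht : t ∈ Ioc 0 T) :
    ‖toL2 Ω (u t)‖ ≤ ‖toL2 Ω u0‖ := by
  have h1 := tendsto_inner_slice hΩ H hlim hu hM ht (toL2 Ω (u t))
  rw [real_inner_self_eq_norm_sq] at h1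
  have h2 := le_of_tendsto_of_tendsto h1
    ((tendsto_toL2_zero (ht.1.le.trans ht.2) H.curve hu0 hinit).norm.mul_const ‖toL2 Ω (u t)‖)
    (.of_forall fun n => (real_inner_le_norm _ _).trans (mul_le_mul_of_nonneg_right
      (H.norm_le n t (Ioc_subset_Icc_self ht)) (norm_nonneg _)))
  rcases (norm_nonneg (toL2 Ω (u t))).eq_or_lt with h | h
  · rw [← h]; exact norm_nonneg _
  · rw [sq] at h2
    exact le_of_mul_le_mul_right h2 h

/-- The weak limit takes the initial value `u₀` strongly. -/
lemma tendsto_toL2_nhdsGT_zero (hΩ : IsOpen Ω) (hT : 0 < T) (H : IsAsymptoticEuler Ω T un0 un)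
    (hlim : WeakStarTendsto Ω T un u) (hu : IsRegularVelocity Ω T u) {M : ℝ}
    (hM : ∀ n, ∀ t ∈ Icc 0 T, ‖toL2 Ω (un n t)‖ ≤ M) (hu0 : MemLp u0 2 (volume.restrict Ω))
    (hinit : Tendsto (fun n => eLpNorm (un0 n - u0) 2 (volume.restrict Ω)) atTop (𝓝 0)) :
    Tendsto (fun t => toL2 Ω (u t)) (𝓝[>] 0) (𝓝 (toL2 Ω u0)) := by
  have hz := tendsto_toL2_zero hT.le H.curve hu0 hinit
  have hu0m : toL2 Ω u0 ∈ solenoidalSpace Ω := isClosed_solenoidalSpace.mem_of_tendsto hz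
    (.of_forall fun n => ((H.curve n).memH 0 ⟨le_rfl, hT.le⟩).toL2_mem)
  have hev : ∀ᶠ t in 𝓝[>] (0 : ℝ), t ∈ Ioc 0 T := Ioc_mem_nhdsGT hT
  have hbd : ∀ᶠ t in 𝓝[>] (0 : ℝ), ‖toL2 Ω (u t)‖ ≤ ‖toL2 Ω u0‖ := by
    filter_upwards [hev] with t ht using norm_limit_le hΩ H hlim hu hM hu0 hinit ht
  have hweak := tendsto_inner_of_dense (U := fun t => toL2 Ω (u t)) hbd (fun φ hφ => by
    obtain ⟨L, hL⟩ := H.exists_lipschitz hM hφ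
    have hlip : ∀ t ∈ Ioc 0 T, |inner ℝ (toL2 Ω (u t)) (toL2 Ω φ) -
        inner ℝ (toL2 Ω u0) (toL2 Ω φ)| ≤ L * t := fun t ht => by
      refine le_of_tendsto (((tendsto_inner_slice hΩ H hlim hu hM ht (toL2 Ω φ)).sub
        (hz.inner tendsto_const_nhds)).abs) (.of_forall fun n => ?_)
      have := hL n 0 t le_rfl ht.1.le ht.2
      rwa [inner_sub_left, sub_zero] at this
    rw [tendsto_iff_norm_sub_tendsto_zero]
    refine squeeze_zero' (.of_forall fun _ => norm_nonneg _) (g := fun t => L * t) ?_ ?_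
    · filter_upwards [hev] with t ht using hlip t ht
    · have : Continuous fun t : ℝ => L * t := by fun_prop
      exact (this.tendsto' 0 0 (by simp)).mono_left nhdsWithin_le_nhds) hu0m
  rw [tendsto_iff_norm_sub_tendsto_zero]
  have hsq : Tendsto (fun t => ‖toL2 Ω (u t) - toL2 Ω u0‖ ^ 2) (𝓝[>] 0) (𝓝 0) := by
    refine squeeze_zero' (.of_forall fun _ => sq_nonneg _) (g := fun t =>
      2 * (‖toL2 Ω u0‖ ^ 2 - inner ℝ (toL2 Ω (u t)) (toL2 Ω u0))) ?_ ?_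
    · filter_upwards [hbd] with t ht
      rw [norm_sub_sq_real]
      have := pow_le_pow_left₀ (norm_nonneg _) ht 2
      linarith
    · have := (hweak.const_sub (‖toL2 Ω u0‖ ^ 2)).const_mul 2
      rwa [real_inner_self_eq_norm_sq, sub_self, mul_zero] at this
  have := hsq.sqrt
  simpa [Real.sqrt_sq] using this

end

end

section

variable {Ω : Set Plane} {T : ℝ}

/-! ### Regular fields -/

lemma continuousOn_pderiv_slice {f : ℝ → Plane → ℝ}
    (hf : ContDiffOn ℝ 1 (fun p : ℝ × Plane => f p.1 p.2) (Ioi 0 ×ˢ univ)) (j : Fin 2) :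
    ContinuousOn (fun p : ℝ × Plane => pderiv (f p.1) p.2 j) (Ioi 0 ×ˢ univ) := by
  have ho : IsOpen ((Ioi 0 : Set ℝ) ×ˢ (univ : Set Plane)) := isOpen_Ioi.prod isOpen_univ
  have h1 : ContinuousOn (fun p : ℝ × Plane => fderiv ℝ (fun p : ℝ × Plane => f p.1 p.2) p
      (0, EuclideanSpace.single j 1)) (Ioi 0 ×ˢ univ) :=
    (hf.continuousOn_fderiv_of_isOpen ho le_rfl).clm_apply continuousOn_const
  refine h1.congr fun p hp => ?_
  have h2 : HasFDerivAt (fun x : Plane => (p.1, x)) (ContinuousLinearMap.inr ℝ ℝ Plane) p.2 :=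
    hasFDerivAt_prodMk_right p.1 p.2
  have h3 : HasFDerivAt (fun p : ℝ × Plane => f p.1 p.2)
      (fderiv ℝ (fun p : ℝ × Plane => f p.1 p.2) p) (p.1, p.2) :=
    ((hf.contDiffAt (ho.mem_nhds hp)).differentiableAt one_ne_zero).hasFDerivAt
  have h4 := (h3.comp p.2 h2).fderiv
  simp only [Function.comp_def] at h4
  simp [pderiv, h4]

lemma contDiff_slice {f : ℝ → Plane → ℝ}
    (hf : ContDiffOn ℝ 1 (fun p : ℝ × Plane => f p.1 p.2) (Ioi 0 ×ˢ univ)) {t : ℝ} (ht : 0 < t) :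
    ContDiff ℝ 1 (f t) :=
  contDiff_iff_contDiffAt.2 fun x =>
    ContDiffAt.comp (g := fun p : ℝ × Plane => f p.1 p.2) (f := fun x : Plane => (t, x)) x
      (hf.contDiffAt ((isOpen_Ioi.prod isOpen_univ).mem_nhds ⟨ht, mem_univ _⟩)) (by fun_prop)

lemma aestronglyMeasurable_restrict_of_continuousOn {f : ℝ × Plane → ℝ} (hΩ : IsOpen Ω)
    (hf : ContinuousOn f (Ioi 0 ×ˢ univ)) {s : Set ℝ} (hs : MeasurableSet s) (hs0 : s ⊆ Ioi 0) :
    AEStronglyMeasurable f ((volume : Measure (ℝ × Plane)).restrict (s ×ˢ Ω)) :=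
  (hf.mono (prod_mono hs0 (subset_univ _))).aestronglyMeasurable (hs.prod hΩ.measurableSet)

section Velocity

variable {u : ℝ → Plane → Plane}

namespace IsRegularVelocity

lemma contDiffOn_apply (hu : IsRegularVelocity Ω T u) (i : Fin 2) :
    ContDiffOn ℝ 1 (fun p : ℝ × Plane => u p.1 p.2 i) (Ioi 0 ×ˢ univ) :=
  (EuclideanSpace.proj (𝕜 := ℝ) i).contDiff.comp_contDiffOn hu.contDiff

lemma contDiff_slice_apply (hu : IsRegularVelocity Ω T u) {t : ℝ} (ht : 0 < t) (i : Fin 2) :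
    ContDiff ℝ 1 fun x => u t x i :=
  contDiff_component (hu.contDiff_slice ht) i

lemma grad_eq (hu : IsRegularVelocity Ω T u) {t : ℝ} (ht : 0 < t) (x : Plane) (i j : Fin 2) :
    grad (u t) x i j = pderiv (fun y => u t y i) x j :=
  grad_eq_pderiv ((hu.contDiff_slice ht).differentiable one_ne_zero x) i j

lemma continuousOn_grad (hu : IsRegularVelocity Ω T u) (i j : Fin 2) :
    ContinuousOn (fun p : ℝ × Plane => grad (u p.1) p.2 i j) (Ioi 0 ×ˢ univ) :=
  (continuousOn_pderiv_slice (f := fun t x => u t x i) (hu.contDiffOn_apply i) j).congr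
    fun p hp => hu.grad_eq hp.1 p.2 i j

lemma continuous_grad (hu : IsRegularVelocity Ω T u) {t : ℝ} (ht : 0 < t) (i j : Fin 2) :
    Continuous fun x => grad (u t) x i j := by
  simpa only [hu.grad_eq ht] using continuous_pderiv (hu.contDiff_slice_apply ht i) j

lemma memLp_grad (hu : IsRegularVelocity Ω T u) {t : ℝ} (ht : t ∈ Ioc 0 T) (i j : Fin 2) :
    MemLp (fun x => grad (u t) x i j) 2 (volume.restrict Ω) := by
  obtain ⟨C, hC⟩ := hu.bounds (t / 2) ⟨half_pos ht.1, by linarith [ht.1, ht.2]⟩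
  exact ⟨(hu.continuous_grad ht.1 i j).aestronglyMeasurable,
    ((hC t ⟨by linarith [ht.1], ht.2⟩).2.2.2 i j).trans_lt ENNReal.coe_lt_top⟩

lemma hasWeakGrad (hu : IsRegularVelocity Ω T u) {t : ℝ} (ht : t ∈ Ioc 0 T) :
    HasWeakGrad Ω (u t) (grad (u t)) := by
  refine ⟨hu.memLp ht, hu.memLp_grad ht, fun f hf hc hs i j => ?_⟩
  rw [setIntegral_eq_integral_of_tsupport ((tsupport_mul_subset_right (g := fun x => pderiv f x j)
      (f := fun x => u t x i)).trans ((tsupport_pderiv_subset f j).trans hs)),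
    setIntegral_eq_integral_of_tsupport ((tsupport_mul_subset_right (g := f)).trans hs),
    integral_mul_pderiv (hu.contDiff_slice_apply ht.1 i) (hf.of_le (by simp)) hc]
  simp only [hu.grad_eq ht.1]

/-- A regular velocity field in the solenoidal space is divergence free. -/
lemma sum_grad_eq_zero (hΩ : IsOpen Ω) (hu : IsRegularVelocity Ω T u) {t : ℝ} (ht : t ∈ Ioc 0 T)
    (hm : toL2 Ω (u t) ∈ solenoidalSpace Ω) {x : Plane} (hx : x ∈ Ω) :
    ∑ i, grad (u t) x i i = 0 := by
  have hcont : Continuous fun x => ∑ i, grad (u t) x i i :=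
    continuous_finsetSum _ fun i _ => hu.continuous_grad ht.1 i i
  have hae := hΩ.ae_eq_zero_of_integral_contDiff_smul_eq_zero (μ := volume)
    (hcont.locallyIntegrable.locallyIntegrableOn Ω) fun g hg hgc hgs => by
      have hg1 : ContDiff ℝ 1 g := hg.of_le (by simp)
      have h1 := integral_eq_zero_of_toL2_mem (hu.memLp ht) hm (w := fun j x => pderiv g x j)
        (fun j => (continuous_pderiv hg1 j).memLp_of_hasCompactSupport
          (hasCompactSupport_pderiv hgc j)) fun ψ hψ => by
          have hi : ∀ j, IntegrableOn (fun x => ψ x j * pderiv g x j) Ω := fun j =>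
            integrable_mul_of_memLp (hψ.memLp_apply j 2 _)
              ((continuous_pderiv hg1 j).memLp_of_hasCompactSupport (hasCompactSupport_pderiv hgc j))
          rw [integral_finsetSum _ fun j _ => hi j]
          have e : ∀ j, ∫ x in Ω, ψ x j * pderiv g x j = -∫ x in Ω, pderiv (fun y => ψ y j) x j * g x :=
            fun j => by
              rw [setIntegral_eq_integral_of_tsupport ((tsupport_mul_subset_left
                (f := fun x => ψ x j)).trans (hψ.tsupport_apply_subset j)),
                setIntegral_eq_integral_of_tsupport ((tsupport_mul_subset_right (g := g)).trans hgs),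
                integral_mul_pderiv (hψ.contDiff_one_apply j) hg1 hgc]
          have hi' : ∀ j, IntegrableOn (fun x => pderiv (fun y => ψ y j) x j * g x) Ω := fun j =>
            (((continuous_pderiv (hψ.contDiff_one_apply j) j).mul
              hg.continuous).integrable_of_hasCompactSupport hgc.mul_left).integrableOn
          simp only [e, Finset.sum_neg_distrib]
          rw [← integral_finsetSum _ fun j _ => hi' j]
          simp only [← Finset.sum_mul, hψ.sum_pderiv, zero_mul, integral_zero, neg_zero]
      have hi : ∀ j, IntegrableOn (fun x => u t x j * pderiv g x j) Ω := fun j =>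
        integrable_mul_of_memLp (memLp_component (hu.memLp ht) j)
          ((continuous_pderiv hg1 j).memLp_of_hasCompactSupport (hasCompactSupport_pderiv hgc j))
      have hi' : ∀ j, IntegrableOn (fun x => grad (u t) x j j * g x) Ω := fun j =>
        integrable_mul_of_memLp (hu.memLp_grad ht j j) (hg.continuous.memLp_of_hasCompactSupport hgc)
      rw [integral_finsetSum _ fun j _ => hi j] at h1
      simp only [fun j => (hu.hasWeakGrad ht).2.2 g hg hgc hgs j j, Finset.sum_neg_distrib] at h1
      rw [← integral_finsetSum _ fun j _ => hi' j, neg_eq_zero] at h1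
      simp only [smul_eq_mul]
      rw [← setIntegral_eq_integral_of_tsupport ((tsupport_mul_subset_left (f := g)).trans hgs), ← h1]
      congr 1; ext x
      rw [← Finset.sum_mul, mul_comm]
  have h0 : (fun x => ∑ i, grad (u t) x i i) =ᵐ[volume.restrict Ω] fun _ => 0 :=
    (ae_restrict_iff' hΩ.measurableSet).2 hae
  exact Measure.eqOn_open_of_ae_eq h0 hΩ hcont.continuousOn continuousOn_const hx

end IsRegularVelocity

end Velocity

namespace IsRegularStress

variable {S : ℝ → Plane → Fin 2 → Fin 2 → ℝ}

lemma contDiff_slice (hS : IsRegularStress Ω T S) {t : ℝ} (ht : 0 < t) (i j : Fin 2) :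
    ContDiff ℝ 1 fun x => S t x i j :=
  WeakTurbulence.contDiff_slice (f := fun t x => S t x i j) (hS.contDiff i j) ht

lemma memLp (hS : IsRegularStress Ω T S) {t : ℝ} (ht : t ∈ Ioc 0 T) (i j : Fin 2) :
    MemLp (fun x => S t x i j) 2 (volume.restrict Ω) := by
  obtain ⟨C, hC⟩ := hS.bounds (t / 2) ⟨half_pos ht.1, by linarith [ht.1, ht.2]⟩
  exact ⟨(hS.contDiff_slice ht.1 i j).continuous.aestronglyMeasurable,
    ((hC t ⟨by linarith [ht.1], ht.2⟩ i).1 j).trans_lt ENNReal.coe_lt_top⟩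

lemma memLp_div (hS : IsRegularStress Ω T S) {t : ℝ} (ht : t ∈ Ioc 0 T) (i : Fin 2) :
    MemLp (fun x => ∑ j, pderiv (fun y => S t y i j) x j) 2 (volume.restrict Ω) := by
  obtain ⟨C, hC⟩ := hS.bounds (t / 2) ⟨half_pos ht.1, by linarith [ht.1, ht.2]⟩
  exact ⟨(continuous_finsetSum _ fun j _ =>
    continuous_pderiv (hS.contDiff_slice ht.1 i j) j).aestronglyMeasurable,
    ((hC t ⟨by linarith [ht.1], ht.2⟩ i).2).trans_lt ENNReal.coe_lt_top⟩

end IsRegularStress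

end

section

variable {Ω : Set Plane} {T : ℝ}

/-! ### The limit equation -/

/-- Smooth functions `ξ` approximating the indicator function of an interval. -/
lemma exists_contDiff_approx_indicator {a b ε : ℝ} (hab : a < b) (hε : 0 < ε) :
    ∃ ξ : ℝ → ℝ, ContDiff ℝ ∞ ξ ∧ HasCompactSupport ξ ∧ tsupport ξ ⊆ Ioo a b ∧
      (∀ t, 0 ≤ ξ t ∧ ξ t ≤ 1) ∧ ∫ t in a..b, (1 - ξ t) ≤ ε := by
  obtain ⟨δ, hδ, hδ'⟩ := exists_between (show 0 < min ((b - a) / 4) (ε / 4) from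
    lt_min (by linarith) (by linarith))
  rw [lt_min_iff] at hδ'
  let B : ContDiffBump ((a + b) / 2 : ℝ) :=
    ⟨(b - a) / 2 - 2 * δ, (b - a) / 2 - δ, by linarith, by linarith⟩
  refine ⟨B, B.contDiff, B.hasCompactSupport, ?_, fun t => ⟨B.nonneg, B.le_one⟩, ?_⟩
  · rw [B.tsupport_eq, Real.closedBall_eq_Icc]
    intro t ht
    simp only [B, mem_Icc] at ht
    exact ⟨by linarith [ht.1], by linarith [ht.2]⟩
  · have hint : ∀ c d : ℝ, IntervalIntegrable (fun t => 1 - B t) volume c d := fun c d =>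
      (continuous_const.sub B.continuous).intervalIntegrable _ _
    have hle : ∀ c d : ℝ, c ≤ d → ∫ t in c..d, (1 - B t) ≤ d - c := fun c d hcd => by
      have := intervalIntegral.integral_mono_on (μ := volume) hcd (hint c d)
        (intervalIntegrable_const (c := (1 : ℝ))) fun t _ => by linarith [B.nonneg (x := t)]
      simpa using this
    have hmid : ∫ t in a + 2 * δ..b - 2 * δ, (1 - B t) = 0 := by
      rw [intervalIntegral.integral_congr (g := fun _ => (0 : ℝ)), intervalIntegral.integral_zero]
      intro t ht
      rw [uIcc_of_le (by linarith)] at ht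
      have : t ∈ Metric.closedBall ((a + b) / 2) B.rIn := by
        rw [Real.closedBall_eq_Icc]
        exact ⟨by simp only [B]; linarith [ht.1], by simp only [B]; linarith [ht.2]⟩
      simp [B.one_of_mem_closedBall this]
    rw [← intervalIntegral.integral_add_adjacent_intervals (hint a (a + 2 * δ)) (hint _ b),
      ← intervalIntegral.integral_add_adjacent_intervals (hint (a + 2 * δ) (b - 2 * δ)) (hint _ b),
      hmid]
    have h1 := hle a (a + 2 * δ) (by linarith)
    have h2 := hle (b - 2 * δ) b (by linarith)
    linarith

/-- Convergence against test functions of time implies, for bounded sequences, the convergence of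
the integrals over intervals. -/
lemma tendsto_intervalIntegral_of_test {f : ℕ → ℝ → ℝ} {g : ℝ → ℝ} {a b K : ℝ} (hab : a < b)
    (hfi : ∀ n, IntervalIntegrable (f n) volume a b) (hgi : IntervalIntegrable g volume a b)
    (hf : ∀ n, ∀ t ∈ Icc a b, |f n t| ≤ K) (hg : ∀ t ∈ Icc a b, |g t| ≤ K)
    (h : ∀ ξ : ℝ → ℝ, ContDiff ℝ ∞ ξ → HasCompactSupport ξ → tsupport ξ ⊆ Ioo a b →
      Tendsto (fun n => ∫ t in a..b, ξ t * f n t) atTop (𝓝 (∫ t in a..b, ξ t * g t))) :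
    Tendsto (fun n => ∫ t in a..b, f n t) atTop (𝓝 (∫ t in a..b, g t)) := by
  have hK : 0 ≤ K := (abs_nonneg _).trans (hg a ⟨le_rfl, hab.le⟩)
  refine Metric.tendsto_atTop.2 fun ε hε => ?_
  obtain ⟨ξ, hξ, hξc, hξs, hξ01, hξi⟩ := exists_contDiff_approx_indicator hab
    (show 0 < ε / (4 * (K + 1)) by positivity)
  obtain ⟨N, hN⟩ := Metric.tendsto_atTop.1 (h ξ hξ hξc hξs) (ε / 2) (by positivity)
  have key : ∀ φ : ℝ → ℝ, IntervalIntegrable φ volume a b → (∀ t ∈ Icc a b, |φ t| ≤ K) →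
      |(∫ t in a..b, φ t) - ∫ t in a..b, ξ t * φ t| ≤ ε / 4 := fun φ hφi hφ => by
    rw [← intervalIntegral.integral_sub hφi (hφi.continuousOn_mul hξ.continuous.continuousOn)]
    have := intervalIntegral.norm_integral_le_of_norm_le (μ := volume) hab.le
      (f := fun t => φ t - ξ t * φ t) (g := fun t => (1 - ξ t) * K) (.of_forall fun t ht => by
        rw [show φ t - ξ t * φ t = (1 - ξ t) * φ t by ring, norm_mul,
          Real.norm_of_nonneg (by linarith [(hξ01 t).2])]
        exact mul_le_mul_of_nonneg_left (hφ t (Ioc_subset_Icc_self ht)) (by linarith [(hξ01 t).2]))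
      (((continuous_const.sub hξ.continuous).mul continuous_const).intervalIntegrable _ _)
    rw [intervalIntegral.integral_mul_const, Real.norm_eq_abs] at this
    refine this.trans ((mul_le_mul_of_nonneg_right hξi hK).trans ?_)
    rw [div_mul_eq_mul_div, div_le_div_iff₀ (by positivity) (by positivity)]
    nlinarith
  refine ⟨N, fun n hn => ?_⟩
  have h1 := hN n hn
  have h2 := key _ (hfi n) (hf n)
  have h3 := key _ hgi hg
  rw [Real.dist_eq] at h1 ⊢
  rw [abs_lt] at *
  rw [abs_le] at h2 h3
  constructor <;> linarith [h1.1, h1.2, h2.1, h2.2, h3.1, h3.2]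

lemma isScalarTest_mul {ξ : ℝ → ℝ} {η : Plane → ℝ} (hξ : ContDiff ℝ ∞ ξ) (hξc : HasCompactSupport ξ)
    (hξs : tsupport ξ ⊆ Ioo 0 T) (hη : ContDiff ℝ ∞ η) (hηc : HasCompactSupport η)
    (hηs : tsupport η ⊆ Ω) : IsScalarTest Ω T fun p => ξ p.1 * η p.2 := by
  have hsub : tsupport (fun p : ℝ × Plane => ξ p.1 * η p.2) ⊆ tsupport ξ ×ˢ tsupport η := by
    refine closure_minimal (fun p hp => ?_) ((isClosed_tsupport ξ).prod (isClosed_tsupport η))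
    exact ⟨subset_tsupport _ (left_ne_zero_of_mul hp), subset_tsupport _ (right_ne_zero_of_mul hp)⟩
  exact ⟨(hξ.comp contDiff_fst).mul (hη.comp contDiff_snd),
    (hξc.isCompact.prod hηc.isCompact).of_isClosed_subset (isClosed_tsupport _) hsub,
    hsub.trans (prod_mono hξs hηs)⟩

namespace IsScalarTest

variable {ψ : ℝ × Plane → ℝ}

lemma exists_bound (h : IsScalarTest Ω T ψ) : ∃ C : ℝ, 0 ≤ C ∧ ∀ p, |ψ p| ≤ C := by
  obtain ⟨C, hC⟩ := h.1.continuous.bounded_above_of_compact_support h.2.1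
  exact ⟨C, (norm_nonneg _).trans (hC 0), hC⟩

lemma integrableOn_mul (h : IsScalarTest Ω T ψ) {f : ℝ × Plane → ℝ}
    (hf : ContinuousOn f (Ioi 0 ×ˢ univ)) : IntegrableOn (fun p => ψ p * f p) (cylinder Ω T) := by
  have h1 : IntegrableOn (fun p => ψ p * f p) (tsupport ψ) :=
    (h.1.continuous.continuousOn.mul (hf.mono (h.2.2.trans (prod_mono (fun t ht => ht.1)
      (subset_univ _))))).integrableOn_compact h.2.1.isCompact
  refine ((integrableOn_iff_integrable_of_support_subset ?_).1 h1).integrableOn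
  exact fun p hp => subset_tsupport _ (left_ne_zero_of_mul hp)

end IsScalarTest

section

variable {un0 : ℕ → Plane → Plane} {un : ℕ → ℝ → Plane → Plane} {u0 : Plane → Plane}
  {u : ℝ → Plane → Plane} {R : Fin 2 → Fin 2 → (ℝ × Plane → ℝ) → ℝ}
  {S : ℝ → Plane → Fin 2 → Fin 2 → ℝ}

/-- Weak-* convergence against `ψ u_j e_i`, for a bounded weight `ψ`. -/
lemma WeakStarTendsto.tendsto_integral_weight_mul (h : WeakStarTendsto Ω T un u) {ψ : ℝ × Plane → ℝ} {C : ℝ}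
    (hψ : AEStronglyMeasurable ψ (volume.restrict (cylinder Ω T))) (hC : ∀ p, |ψ p| ≤ C)
    (i j : Fin 2) :
    Tendsto (fun n => ∫ p in cylinder Ω T, ψ p * (un n p.1 p.2 i * u p.1 p.2 j)) atTop
      (𝓝 (∫ p in cylinder Ω T, ψ p * (u p.1 p.2 i * u p.1 p.2 j))) := by
  obtain ⟨hum, ⟨K, hK⟩, hlim⟩ := h
  let g : ℝ → Plane → Plane := fun t x => EuclideanSpace.single i (ψ (t, x) * u t x j)
  have hg : ∀ (v : Plane) t x, ∑ k, v k * g t x k = ψ (t, x) * (v i * u t x j) := fun v t x => by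
    have : ∀ k, v k * g t x k = if k = i then v k * (ψ (t, x) * u t x j) else 0 := fun k => by
      simp [g]
    simp only [this, Finset.sum_ite_eq', Finset.mem_univ, if_true]
    ring
  have := hlim g ?_ ?_
  · simpa only [hg] using this
  · have h1 : AEStronglyMeasurable (fun p : ℝ × Plane => ψ p * u p.1 p.2 j)
        (volume.restrict (cylinder Ω T)) := hψ.mul (aestronglyMeasurable_component hum j)
    have h2 : Continuous fun r : ℝ => (EuclideanSpace.single i r : Plane) := by
      refine (PiLp.continuous_toLp 2 _).comp (continuous_pi fun k => ?_)
      by_cases hk : k = i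
      · subst hk; simpa using continuous_id'
      · simpa [Pi.single_apply, hk] using continuous_const
    exact h2.comp_aestronglyMeasurable h1
  · refine (lintegral_mono_ae (g := fun _ => ENNReal.ofReal C * K) ?_).trans_lt ?_
    · filter_upwards [hK] with t ht
      refine (eLpNorm_le_mul_eLpNorm_of_ae_le_mul (c := C) (g := u t) (.of_forall fun x => ?_) 2).trans
        (mul_le_mul_right ht _)
      simp only [g, PiLp.norm_single, norm_mul]
      exact mul_le_mul (hC _) (PiLp.norm_apply_le _ j) (norm_nonneg _) ((abs_nonneg _).trans (hC (0, 0)))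
    · rw [lintegral_const]
      exact ENNReal.mul_lt_top (by finiteness) (by simp)

/-- The limit of `uₙ ⊗ uₙ` in the sense of distributions is `R + u ⊗ u`. -/
lemma IsReynoldsTensor.tendsto_integral (hR : IsReynoldsTensor Ω T un u R)
    (h : WeakStarTendsto Ω T un u) (hc : ∀ n, IsSolenoidalCurve Ω T (un0 n) (un n))
    {ψ : ℝ × Plane → ℝ} (hψ : IsScalarTest Ω T ψ) (i j : Fin 2) :
    Tendsto (fun n => ∫ p in cylinder Ω T, ψ p * (un n p.1 p.2 i * un n p.1 p.2 j)) atTop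
      (𝓝 (R i j ψ + ∫ p in cylinder Ω T, ψ p * (u p.1 p.2 i * u p.1 p.2 j))) := by
  obtain ⟨C, -, hC⟩ := hψ.exists_bound
  have hm : AEStronglyMeasurable ψ (volume.restrict (cylinder Ω T)) :=
    hψ.1.continuous.aestronglyMeasurable
  have hint : ∀ {v w : ℝ → Plane → Plane},
      MemLp (fun p : ℝ × Plane => v p.1 p.2) 2 (volume.restrict (cylinder Ω T)) →
      MemLp (fun p : ℝ × Plane => w p.1 p.2) 2 (volume.restrict (cylinder Ω T)) →
      ∀ i j, IntegrableOn (fun p => ψ p * (v p.1 p.2 i * w p.1 p.2 j)) (cylinder Ω T) :=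
    fun hv hw i j => (integrable_mul_of_memLp (hv.eval_piLp i) (hw.eval_piLp j)).bdd_mul hm
      (.of_forall hC)
  have h1 := h.tendsto_integral_weight_mul hm hC i j
  have h2 := h.tendsto_integral_weight_mul hm hC j i
  have h3 := ((hR ψ hψ i j).add h1).add (h2.sub_const (∫ p in cylinder Ω T, ψ p * (u p.1 p.2 i * u p.1 p.2 j)))
  have e : ∫ p in cylinder Ω T, ψ p * (u p.1 p.2 j * u p.1 p.2 i) =
      ∫ p in cylinder Ω T, ψ p * (u p.1 p.2 i * u p.1 p.2 j) := by
    congr 1; ext p; ring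
  rw [e, sub_self, add_zero] at h3
  refine h3.congr fun n => ?_
  have i1 := hint (hc n).memLp_cylinder (hc n).memLp_cylinder i j
  have i2 := hint (hc n).memLp_cylinder h.memLp_cylinder i j
  have i3 := hint (hc n).memLp_cylinder h.memLp_cylinder j i
  have i4 := hint h.memLp_cylinder h.memLp_cylinder i j
  have e2 : ∫ p in cylinder Ω T, ψ p * ((un n p.1 p.2 i - u p.1 p.2 i) *
      (un n p.1 p.2 j - u p.1 p.2 j)) =
      (∫ p in cylinder Ω T, ψ p * (un n p.1 p.2 i * un n p.1 p.2 j)) -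
      (∫ p in cylinder Ω T, ψ p * (un n p.1 p.2 i * u p.1 p.2 j)) -
      ((∫ p in cylinder Ω T, ψ p * (un n p.1 p.2 j * u p.1 p.2 i)) -
      ∫ p in cylinder Ω T, ψ p * (u p.1 p.2 i * u p.1 p.2 j)) := by
    rw [← integral_sub' i1 i2, ← integral_sub' i3 i4, ← integral_sub' (i1.sub i2) (i3.sub i4)]
    congr 1; ext p
    simp only [Pi.sub_apply]
    ring
  rw [e2]; ring

lemma IsReynoldsTensor.map_neg (hR : IsReynoldsTensor Ω T un u R) {ψ ψ' : ℝ × Plane → ℝ}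
    (hψ : IsScalarTest Ω T ψ) (hψ' : IsScalarTest Ω T ψ') (h : ∀ p, ψ' p = -ψ p) (i j : Fin 2) :
    R i j ψ' = -R i j ψ := by
  refine tendsto_nhds_unique (hR ψ' hψ' i j) ((hR ψ hψ i j).neg.congr fun n => ?_)
  simp only [h, neg_mul, integral_neg]

lemma tendsto_convection_test (hR : IsReynoldsTensor Ω T un u R)
    (h : WeakStarTendsto Ω T un u) (hc : ∀ n, IsSolenoidalCurve Ω T (un0 n) (un n))
    (hS : IsTraceFreePart Ω T R S) (hSreg : IsRegularStress Ω T S) {φ : Plane → Plane}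
    (hφ : IsSolenoidalTest Ω φ) {ξ : ℝ → ℝ} (hξ : ContDiff ℝ ∞ ξ) (hξc : HasCompactSupport ξ)
    (hξs : tsupport ξ ⊆ Ioo 0 T) :
    Tendsto (fun n => ∫ p in cylinder Ω T, ξ p.1 * ∑ i, ∑ j,
        un n p.1 p.2 i * un n p.1 p.2 j * grad φ p.2 i j) atTop
      (𝓝 (∫ p in cylinder Ω T, ξ p.1 * ∑ i, ∑ j,
        (u p.1 p.2 i * u p.1 p.2 j + S p.1 p.2 i j) * grad φ p.2 i j)) := by
  let ψ : Fin 2 → Fin 2 → ℝ × Plane → ℝ := fun i j p => ξ p.1 * grad φ p.2 i j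
  have hψ : ∀ i j, IsScalarTest Ω T (ψ i j) := fun i j => by
    refine isScalarTest_mul (η := fun x => grad φ x i j) hξ hξc hξs ?_ (hφ.hasCompactSupport_grad i j) ?_
    · simpa only [hφ.grad_eq] using contDiff_pderiv (hφ.contDiff_apply i) j
    · simpa only [hφ.grad_eq] using (tsupport_pderiv_subset _ j).trans (hφ.tsupport_apply_subset i)
  have hint : ∀ {v : ℝ → Plane → Plane},
      MemLp (fun p : ℝ × Plane => v p.1 p.2) 2 (volume.restrict (cylinder Ω T)) →
      ∀ i j, IntegrableOn (fun p => ψ i j p * (v p.1 p.2 i * v p.1 p.2 j)) (cylinder Ω T) :=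
    fun hv i j => by
      obtain ⟨C, -, hC⟩ := (hψ i j).exists_bound
      exact (integrable_mul_of_memLp (hv.eval_piLp i) (hv.eval_piLp j)).bdd_mul
        (hψ i j).1.continuous.aestronglyMeasurable (.of_forall hC)
  have hintS : ∀ i j, IntegrableOn (fun p => ψ i j p * S p.1 p.2 i j) (cylinder Ω T) := fun i j =>
    (hψ i j).integrableOn_mul (hSreg.contDiff i j).continuousOn
  have h1 := tendsto_finsetSum Finset.univ fun i _ => tendsto_finsetSum Finset.univ fun j _ =>
    hR.tendsto_integral h hc (hψ i j) i j
  -- the trace of `R` is a pressure, invisible to solenoidal fields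
  have htr : ∀ k, R k k (ψ 1 1) = -R k k (ψ 0 0) := fun k =>
    hR.map_neg (hψ 0 0) (hψ 1 1) (fun p => by
      have := hφ.2.2.2 p.2
      rw [Fin.sum_univ_two] at this
      simp only [ψ]
      rw [show grad φ p.2 1 1 = -grad φ p.2 0 0 by linarith]
      ring) k k
  have hsum : ∑ i, ∑ j, (R i j (ψ i j) + ∫ p in cylinder Ω T, ψ i j p * (u p.1 p.2 i * u p.1 p.2 j)) =
      ∫ p in cylinder Ω T, ξ p.1 * ∑ i, ∑ j,
        (u p.1 p.2 i * u p.1 p.2 j + S p.1 p.2 i j) * grad φ p.2 i j := by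
    have e : ∀ p : ℝ × Plane, ξ p.1 * ∑ i, ∑ j, (u p.1 p.2 i * u p.1 p.2 j + S p.1 p.2 i j) *
        grad φ p.2 i j = ∑ i, ∑ j, (ψ i j p * (u p.1 p.2 i * u p.1 p.2 j) + ψ i j p * S p.1 p.2 i j) :=
      fun p => by
        simp only [ψ, Finset.mul_sum]
        exact Finset.sum_congr rfl fun i _ => Finset.sum_congr rfl fun j _ => by ring
    have hi : ∀ i j, IntegrableOn (fun p => ψ i j p * (u p.1 p.2 i * u p.1 p.2 j) +
        ψ i j p * S p.1 p.2 i j) (cylinder Ω T) := fun i j =>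
      (hint h.memLp_cylinder i j).add (hintS i j)
    simp only [e]
    rw [integral_sum_sum hi]
    simp only [fun i j => integral_add (hint h.memLp_cylinder i j) (hintS i j), ← hS _ (hψ _ _)]
    simp only [Fin.sum_univ_two, if_true, htr]
    norm_num
    ring
  rw [hsum] at h1
  refine h1.congr fun n => ?_
  rw [← integral_sum_sum fun i j => hint (hc n).memLp_cylinder i j]
  congr 1; ext p
  simp only [ψ, Finset.mul_sum]
  exact Finset.sum_congr rfl fun i _ => Finset.sum_congr rfl fun j _ => by ring

/-- The limit satisfies the Euler equations with the additional stress `S`. -/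
lemma inner_limit_sub_eq (hΩ : IsOpen Ω) (H : IsAsymptoticEuler Ω T un0 un)
    (hlim : WeakStarTendsto Ω T un u) (hu : IsRegularVelocity Ω T u) {M : ℝ}
    (hM : ∀ n, ∀ t ∈ Icc 0 T, ‖toL2 Ω (un n t)‖ ≤ M) (hR : IsReynoldsTensor Ω T un u R)
    (hS : IsTraceFreePart Ω T R S) (hSreg : IsRegularStress Ω T S) {φ : Plane → Plane}
    (hφ : IsSolenoidalTest Ω φ) {a b : ℝ} (ha : 0 < a) (hab : a ≤ b) (hb : b ≤ T) :
    inner ℝ (toL2 Ω (u b) - toL2 Ω (u a)) (toL2 Ω φ) = ∫ t in a..b, ∫ x in Ω, ∑ i, ∑ j,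
      (u t x i * u t x j + S t x i j) * grad φ x i j := by
  rcases hab.eq_or_lt with rfl | hab'
  · simp
  have hT : 0 ≤ T := (ha.trans_le (hab.trans hb)).le
  let f : ℕ → ℝ → ℝ := fun n t => ∫ x in Ω, ∑ i, ∑ j, un n t x i * un n t x j * grad φ x i j
  let g : ℝ → ℝ := fun t => ∫ x in Ω, ∑ i, ∑ j, (u t x i * u t x j + S t x i j) * grad φ x i j
  have hfn : ∀ n, IntegrableOn (fun p : ℝ × Plane => ∑ i, ∑ j,
      un n p.1 p.2 i * un n p.1 p.2 j * grad φ p.2 i j) (cylinder Ω T) := fun n =>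
    integrable_finsetSum _ fun i _ => integrable_finsetSum _ fun j _ =>
      (H.curve n).integrableOn_convection hφ i j
  have hfi : ∀ n, IntervalIntegrable (f n) volume a b := fun n =>
    intervalIntegrable_mono_Icc (intervalIntegrable_slice hT (hfn n)) ha.le hab hb
  have hgc : ContinuousOn g (Icc a b) := by
    refine continuousOn_integral_of_compact_support (k := tsupport φ) hφ.2.1 ?_ ?_
    · have hsub : Icc a b ×ˢ univ ⊆ Ioi (0 : ℝ) ×ˢ (univ : Set Plane) :=
        prod_mono (fun t ht => ha.trans_le ht.1) subset_rfl
      refine continuousOn_finsetSum _ fun i _ => continuousOn_finsetSum _ fun j _ => ?_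
      exact (((((hu.contDiffOn_apply i).continuousOn).mul (hu.contDiffOn_apply j).continuousOn).add
        (hSreg.contDiff i j).continuousOn).mono hsub).mul
          ((hφ.continuous_grad i j).comp continuous_snd).continuousOn
    · intro t x _ hx
      refine Finset.sum_eq_zero fun i _ => Finset.sum_eq_zero fun j _ => ?_
      rw [hφ.grad_eq, image_eq_zero_of_notMem_tsupport (f := fun x => pderiv (fun y => φ y i) x j)
        fun h => hx ((tsupport_component_subset φ i) (tsupport_pderiv_subset _ j h)), mul_zero]
  obtain ⟨K₁, hK₁⟩ := isCompact_Icc.exists_bound_of_continuousOn hgc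
  obtain ⟨C, hC0, hC⟩ := hφ.exists_bound
  have hfb : ∀ n, ∀ t ∈ Icc a b, |f n t| ≤ 4 * C * M ^ 2 := fun n t ht => by
    have htI : t ∈ Icc 0 T := ⟨ha.le.trans ht.1, ht.2.trans hb⟩
    refine (abs_integral_convection_le ((H.curve n).memLp htI) (g := fun i j x => grad φ x i j)
        fun i j x => (hC x).2 i j).trans ?_
    gcongr
    exact hM n t htI
  have hfg : Tendsto (fun n => ∫ t in a..b, f n t) atTop (𝓝 (∫ t in a..b, g t)) := by
    refine tendsto_intervalIntegral_of_test (K := max K₁ (4 * C * M ^ 2)) hab' hfi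
      (hgc.intervalIntegrable_of_Icc hab) (fun n t ht => (hfb n t ht).trans (le_max_right _ _))
      (fun t ht => (hK₁ t ht).trans (le_max_left _ _)) fun ξ hξ hξc hξs => ?_
    have hξs' : tsupport ξ ⊆ Ioo 0 T := hξs.trans (Ioo_subset_Ioo ha.le hb)
    have e : ∀ F : ℝ × Plane → ℝ, IntegrableOn (fun p => ξ p.1 * F p) (cylinder Ω T) →
        ∫ p in cylinder Ω T, ξ p.1 * F p = ∫ t in a..b, ξ t * ∫ x in Ω, F (t, x) := fun F hF => by
      rw [integral_cylinder hF, intervalIntegral.integral_of_le hab, integral_Ioc_eq_integral_Ioo]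
      simp only [integral_const_mul]
      refine setIntegral_eq_of_subset_of_forall_sdiff_eq_zero measurableSet_Ioo
        (Ioo_subset_Ioo ha.le hb) fun t ht => ?_
      rw [image_eq_zero_of_notMem_tsupport fun h => ht.2 (hξs h), zero_mul]
    have hlim' := tendsto_convection_test hR hlim H.curve hS hSreg hφ hξ hξc hξs'
    obtain ⟨Cξ, hCξ⟩ := hξ.continuous.bounded_above_of_compact_support hξc
    rw [e] at hlim'
    · refine hlim'.congr fun n => ?_
      rw [e _ ((hfn n).bdd_mul (c := Cξ) (hξ.continuous.comp continuous_fst).aestronglyMeasurable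
        (.of_forall fun p => hCξ p.1))]
    · have hψ : ∀ i j, IsScalarTest Ω T fun p => ξ p.1 * grad φ p.2 i j := fun i j => by
        refine isScalarTest_mul (η := fun x => grad φ x i j) hξ hξc hξs' ?_
          (hφ.hasCompactSupport_grad i j) ?_
        · simpa only [hφ.grad_eq] using contDiff_pderiv (hφ.contDiff_apply i) j
        · simpa only [hφ.grad_eq] using (tsupport_pderiv_subset _ j).trans (hφ.tsupport_apply_subset i)
      refine (integrable_finsetSum Finset.univ fun i _ => integrable_finsetSum Finset.univ fun j _ =>
        (hψ i j).integrableOn_mul (((hu.contDiffOn_apply i).continuousOn.mul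
          (hu.contDiffOn_apply j).continuousOn).add (hSreg.contDiff i j).continuousOn)).congr
          (.of_forall fun p => ?_)
      simp only [Finset.mul_sum]
      exact Finset.sum_congr rfl fun i _ => Finset.sum_congr rfl fun j _ => by
        simp only [Pi.add_apply, Pi.mul_apply]; ring
  obtain ⟨ε, hε, hw⟩ := H.weak_form φ hφ
  have h1 := ((tendsto_inner_slice hΩ H hlim hu hM ⟨ha.trans hab', hb⟩ (toL2 Ω φ)).sub
    (tendsto_inner_slice hΩ H hlim hu hM ⟨ha, hab.trans hb⟩ (toL2 Ω φ))).sub hfg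
  have h2 : Tendsto (fun n => inner ℝ (toL2 Ω (un n b)) (toL2 Ω φ) -
      inner ℝ (toL2 Ω (un n a)) (toL2 Ω φ) - ∫ t in a..b, f n t) atTop (𝓝 0) := by
    refine squeeze_zero_norm (a := fun n => ε n * (b - a)) (fun n => ?_)
      (by simpa using hε.mul_const (b - a))
    rw [← inner_sub_left]
    exact hw n a b ha.le hab hb
  rw [inner_sub_left]
  exact sub_eq_zero.1 (tendsto_nhds_unique h1 h2)

end

end

section

variable {Ω : Set Plane} {T : ℝ}

/-! ### The energy balance of the limit -/

section

variable {u : ℝ → Plane → Plane} {S : ℝ → Plane → Fin 2 → Fin 2 → ℝ}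

/-- The force `-(u · ∇u + ∇ · S)`, which drives the limit flow up to a pressure gradient. -/
noncomputable def netForce (u : ℝ → Plane → Plane) (S : ℝ → Plane → Fin 2 → Fin 2 → ℝ) (t : ℝ) :
    Plane → Plane :=
  ofComponents fun i x => -((∑ j, u t x j * grad (u t) x i j) +
    ∑ j, pderiv (fun y => S t y i j) x j)

/-- The power `∫ S : ∇u` of the stress `S`. -/
noncomputable def stressPower (Ω : Set Plane) (u : ℝ → Plane → Plane)
    (S : ℝ → Plane → Fin 2 → Fin 2 → ℝ) (t : ℝ) : ℝ :=
  ∫ x in Ω, ∑ i, ∑ j, S t x i j * grad (u t) x i j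

lemma netForce_apply (t : ℝ) (x : Plane) (i : Fin 2) : netForce u S t x i =
    -((∑ j, u t x j * grad (u t) x i j) + ∑ j, pderiv (fun y => S t y i j) x j) := rfl

lemma IsRegularVelocity.memLp_mul_grad (hΩ : IsOpen Ω) (hu : IsRegularVelocity Ω T u) {s t : ℝ}
    (hs : s ∈ Ioo 0 T) (ht : t ∈ Icc s T) (i j k : Fin 2) :
    MemLp (fun x => u t x k * grad (u t) x i j) 2 (volume.restrict Ω) := by
  obtain ⟨C, hC⟩ := hu.bounds s hs
  have ht' : t ∈ Ioc 0 T := ⟨hs.1.trans_le ht.1, ht.2⟩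
  have := memLp_mul_of_bound (C := C) (hu.memLp_grad ht' i j) (memLp_component (hu.memLp ht') k).1
    ((ae_restrict_iff' hΩ.measurableSet).2 (.of_forall fun x hx =>
      (PiLp.norm_apply_le (u t x) k).trans ((hC t ht).1 x hx).1))
  simpa only [mul_comm] using this

lemma exists_netForce_bound (hΩ : IsOpen Ω) (hu : IsRegularVelocity Ω T u)
    (hS : IsRegularStress Ω T S) {s : ℝ} (hs : s ∈ Ioo 0 T) :
    ∃ C : ℝ, ∀ t ∈ Icc s T, MemLp (netForce u S t) 2 (volume.restrict Ω) ∧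
      ‖toL2 Ω (netForce u S t)‖ ≤ C := by
  obtain ⟨C, hC⟩ := hu.bounds s hs
  obtain ⟨D, hD⟩ := hS.bounds s hs
  refine ⟨(∑ i : Fin 2, ((∑ j : Fin 2, C * C) + D) : ℝ≥0), fun t ht => ?_⟩
  have ht' : t ∈ Ioc 0 T := ⟨hs.1.trans_le ht.1, ht.2⟩
  have h1 := hu.memLp_mul_grad hΩ hs ht
  have h2 : ∀ i, MemLp (fun x => ∑ j, u t x j * grad (u t) x i j) 2 (volume.restrict Ω) := fun i =>
    memLp_finsetSum _ fun j _ => h1 i j j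
  have h3 : ∀ i, MemLp (fun x => netForce u S t x i) 2 (volume.restrict Ω) := fun i =>
    ((h2 i).add (hS.memLp_div ht' i)).neg
  have h4 : MemLp (netForce u S t) 2 (volume.restrict Ω) := memLp_ofComponents h3
  refine ⟨h4, ?_⟩
  rw [norm_toL2 h4]
  refine ENNReal.toReal_le_of_le_ofReal (NNReal.coe_nonneg _) ?_
  rw [ENNReal.ofReal_coe_nnreal]
  push_cast
  refine (eLpNorm_ofComponents_le fun i => (h3 i).1).trans (Finset.sum_le_sum fun i _ => ?_)
  rw [show (fun x => netForce u S t x i) =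
    -((fun x => ∑ j, u t x j * grad (u t) x i j) + fun x => ∑ j, pderiv (fun y => S t y i j) x j)
    from rfl, eLpNorm_neg]
  refine (eLpNorm_add_le (h2 i).1 (hS.memLp_div ht' i).1 one_le_two).trans
    (add_le_add ((eLpNorm_fun_sum_le (fun j _ => (h1 i j j).1) one_le_two).trans
      (Finset.sum_le_sum fun j _ => ?_)) (hD t ht i).2)
  refine (eLpNorm_le_nnreal_smul_eLpNorm_of_ae_le_mul (c := C) (g := fun x => grad (u t) x i j)
    ((ae_restrict_iff' hΩ.measurableSet).2 (.of_forall fun x hx => ?_)) 2).trans ?_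
  · rw [nnnorm_mul]
    exact mul_le_mul_left ((PiLp.nnnorm_apply_le (u t x) j).trans ((hC t ht).1 x hx).1) _
  · rw [ENNReal.smul_def, smul_eq_mul]
    exact mul_le_mul_right ((hC t ht).2.2.2 i j) _

lemma continuousOn_netForce (hu : IsRegularVelocity Ω T u) (hS : IsRegularStress Ω T S) (i : Fin 2) :
    ContinuousOn (fun p : ℝ × Plane => netForce u S p.1 p.2 i) (Ioi 0 ×ˢ univ) :=
  ((continuousOn_finsetSum _ fun j _ => (hu.contDiffOn_apply j).continuousOn.mul
    (hu.continuousOn_grad i j)).add (continuousOn_finsetSum _ fun j _ =>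
      continuousOn_pderiv_slice (f := fun t x => S t x i j) (hS.contDiff i j) j)).neg

/-- The net force is the divergence of `-(u ⊗ u + S)`. -/
lemma integral_stress_grad_eq (hΩ : IsOpen Ω) (hu : IsRegularVelocity Ω T u)
    (hS : IsRegularStress Ω T S) {t : ℝ} (ht : 0 < t) (hdiv : ∀ x ∈ Ω, ∑ i, grad (u t) x i i = 0)
    {φ : Plane → Plane} (hφ : IsSolenoidalTest Ω φ) :
    ∫ x in Ω, ∑ i, ∑ j, (u t x i * u t x j + S t x i j) * grad φ x i j =
      ∫ x in Ω, ∑ i, netForce u S t x i * φ x i := by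
  have hui := hu.contDiff_slice_apply ht
  have hF : ∀ i j, ContDiff ℝ 1 fun x => u t x i * u t x j + S t x i j := fun i j =>
    ((hui i).mul (hui j)).add (hS.contDiff_slice ht i j)
  have hi1 : ∀ i j, IntegrableOn (fun x => (u t x i * u t x j + S t x i j) * grad φ x i j) Ω :=
    fun i j => ((hF i j).continuous.mul (hφ.continuous_grad i j)).integrable_of_hasCompactSupport
      (hφ.hasCompactSupport_grad i j).mul_left |>.integrableOn
  have hi2 : ∀ i j, IntegrableOn
      (fun x => pderiv (fun x => u t x i * u t x j + S t x i j) x j * φ x i) Ω :=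
    fun i j => ((continuous_pderiv (hF i j) j).mul
      (hφ.contDiff_apply i).continuous).integrable_of_hasCompactSupport
        (hφ.hasCompactSupport_apply i).mul_left |>.integrableOn
  have hibp : ∀ i j, ∫ x in Ω, (u t x i * u t x j + S t x i j) * grad φ x i j =
      -∫ x in Ω, pderiv (fun x => u t x i * u t x j + S t x i j) x j * φ x i := fun i j => by
    rw [setIntegral_eq_integral_of_tsupport ((tsupport_mul_subset_right
      (g := fun x => φ x i)).trans (hφ.tsupport_apply_subset i)),
      setIntegral_eq_integral_of_tsupport]
    · simp only [hφ.grad_eq]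
      exact integral_mul_pderiv (hF i j) (hφ.contDiff_one_apply i) (hφ.hasCompactSupport_apply i) j
    · refine (tsupport_mul_subset_right (g := fun x => grad φ x i j)).trans ?_
      simpa only [hφ.grad_eq] using (tsupport_pderiv_subset _ j).trans (hφ.tsupport_apply_subset i)
  rw [integral_sum_sum hi1]
  simp only [hibp, Finset.sum_neg_distrib]
  rw [← integral_sum_sum hi2, ← integral_neg]
  refine setIntegral_congr_fun hΩ.measurableSet fun x hx => ?_
  have hd := fun i => (hui i).differentiable one_ne_zero x
  have hp : ∀ i j, pderiv (fun x => u t x i * u t x j + S t x i j) x j =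
      u t x i * grad (u t) x j j + grad (u t) x i j * u t x j + pderiv (fun y => S t y i j) x j :=
    fun i j => by
      rw [pderiv_add ((hd i).fun_mul (hd j)) ((hS.contDiff_slice ht i j).differentiable one_ne_zero x),
        pderiv_mul (hd i) (hd j), hu.grad_eq ht, hu.grad_eq ht]
  have hd0 := hdiv x hx
  simp only [hp, netForce_apply, Fin.sum_univ_two] at hd0 ⊢
  linear_combination (-(u t x 0 * φ x 0 + u t x 1 * φ x 1)) * hd0

/-- The power of the net force is the power of the stress; there is no boundary term as, on the
boundary, either the stress or the velocity vanishes. -/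
lemma integral_netForce_mul_eq (hΩ : IsOpen Ω) (hu : IsRegularVelocity Ω T u)
    (hS : IsRegularStress Ω T S) {s t : ℝ} (hs : s ∈ Ioo 0 T) (ht : t ∈ Icc s T)
    (hm : toL2 Ω (u t) ∈ solenoidalSpace Ω)
    (hbd : ∀ x ∈ frontier Ω, (∀ i j, S t x i j = 0) ∨ u t x = 0) :
    ∫ x in Ω, ∑ i, netForce u S t x i * u t x i = stressPower Ω u S t := by
  have ht0 : 0 < t := hs.1.trans_le ht.1
  have ht' : t ∈ Ioc 0 T := ⟨ht0, ht.2⟩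
  have hui := hu.contDiff_slice_apply ht0
  have hu2 := memLp_component (hu.memLp ht')
  have htri := (hu.hasWeakGrad ht').integral_trilinear_eq_zero hΩ hm fun i j =>
    hu.memLp_mul_grad hΩ hs ht i j i
  have hi1 : IntegrableOn (fun x => ∑ j, u t x j * ∑ i, u t x i * grad (u t) x i j) Ω :=
    integrable_finsetSum _ fun j _ => integrable_mul_of_memLp (hu2 j)
      (memLp_finsetSum _ fun i _ => hu.memLp_mul_grad hΩ hs ht i j i)
  have hi2 : IntegrableOn (fun x => ∑ i, u t x i * ∑ j, pderiv (fun y => S t y i j) x j) Ω :=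
    integrable_finsetSum _ fun i _ => integrable_mul_of_memLp (hu2 i) (hS.memLp_div ht' i)
  have hi3 : IntegrableOn (fun x => ∑ i, ∑ j, S t x i j * grad (u t) x i j) Ω :=
    integrable_finsetSum _ fun i _ => integrable_finsetSum _ fun j _ =>
      integrable_mul_of_memLp (hS.memLp ht' i j) (hu.memLp_grad ht' i j)
  have hf : ∀ j, ContDiff ℝ 1 fun x => ∑ i, S t x i j * u t x i := fun j =>
    ContDiff.sum fun i _ => (hS.contDiff_slice ht0 i j).mul (hui i)
  have hpd : ∀ x, ∑ j, pderiv (fun y => ∑ i, S t y i j * u t y i) x j =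
      (∑ i, ∑ j, S t x i j * grad (u t) x i j) +
        ∑ i, u t x i * ∑ j, pderiv (fun y => S t y i j) x j := fun x => by
    have hd := fun i => (hui i).differentiable one_ne_zero x
    have hSd := fun i j => (hS.contDiff_slice ht0 i j).differentiable one_ne_zero x
    have e : ∀ j, pderiv (fun y => ∑ i, S t y i j * u t y i) x j = ∑ i,
        (S t x i j * grad (u t) x i j + pderiv (fun y => S t y i j) x j * u t x i) := fun j => by
      rw [pderiv_sum fun i _ => (hSd i j).fun_mul (hd i)]
      simp only [pderiv_mul (hSd _ _) (hd _), hu.grad_eq ht0]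
    rw [Finset.sum_congr rfl fun j _ => e j]
    simp only [Fin.sum_univ_two]
    ring
  have hdiv := setIntegral_div_eq_zero hΩ (f := fun j x => ∑ i, S t x i j * u t x i) hf
    (fun j x hx => by
      rcases hbd x hx with h | h
      · simp [h]
      · simp [h])
    (fun j => integrable_finsetSum _ fun i _ => integrable_mul_of_memLp (hS.memLp ht' i j) (hu2 i))
    (by simp only [hpd]; exact hi3.add hi2)
  simp only [hpd] at hdiv
  rw [integral_add hi3 hi2] at hdiv
  have e : ∀ x, ∑ i, netForce u S t x i * u t x i =
      -(∑ j, u t x j * ∑ i, u t x i * grad (u t) x i j) -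
        ∑ i, u t x i * ∑ j, pderiv (fun y => S t y i j) x j := fun x => by
    simp only [netForce_apply, Fin.sum_univ_two]
    ring
  simp only [e]
  have e2 := integral_sub hi1.neg hi2
  simp only [Pi.neg_apply] at e2
  rw [e2, integral_neg, htri, stressPower]
  linarith

/-- Energy balance of the limit flow. -/
lemma norm_sq_sub_eq_integral_stressPower (hΩ : IsOpen Ω) (hu : IsRegularVelocity Ω T u)
    (hS : IsRegularStress Ω T S) (hm : ∀ t ∈ Ioc 0 T, toL2 Ω (u t) ∈ solenoidalSpace Ω)
    (hbd : ∀ t ∈ Ioc 0 T, ∀ x ∈ frontier Ω, (∀ i j, S t x i j = 0) ∨ u t x = 0)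
    (heq : ∀ φ, IsSolenoidalTest Ω φ → ∀ a b, 0 < a → a ≤ b → b ≤ T →
      inner ℝ (toL2 Ω (u b) - toL2 Ω (u a)) (toL2 Ω φ) = ∫ t in a..b, ∫ x in Ω, ∑ i, ∑ j,
        (u t x i * u t x j + S t x i j) * grad φ x i j) {a b : ℝ} (ha : 0 < a) (hab : a ≤ b)
    (hb : b ≤ T) :
    IntervalIntegrable (stressPower Ω u S) volume a b ∧
    ‖toL2 Ω (u b)‖ ^ 2 - ‖toL2 Ω (u a)‖ ^ 2 = 2 * ∫ t in a..b, stressPower Ω u S t := by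
  rcases hab.eq_or_lt with rfl | hab'
  · simp
  have has : a ∈ Ioo 0 T := ⟨ha, hab'.trans_le hb⟩
  obtain ⟨C, hC⟩ := exists_netForce_bound hΩ hu hS has
  obtain ⟨D, hD⟩ := hu.exists_norm_le has
  have hsub : Icc a b ⊆ Icc a T := Icc_subset_Icc le_rfl hb
  have hIoc : ∀ t ∈ Icc a b, t ∈ Ioc 0 T := fun t ht => ⟨ha.trans_le ht.1, ht.2.trans hb⟩
  have hmeas : ∀ w : Fin 2 → ℝ × Plane → ℝ, (∀ i, AEStronglyMeasurable (w i)
      ((volume.restrict (Ioc a b)).prod (volume.restrict Ω))) →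
      AEStronglyMeasurable (fun t => ∫ x in Ω, ∑ i, netForce u S t x i * w i (t, x))
        (volume.restrict (Ioc a b)) := fun w hw => by
    refine AEStronglyMeasurable.integral_prod_right' (f := fun p : ℝ × Plane =>
      ∑ i, netForce u S p.1 p.2 i * w i p) (Finset.aestronglyMeasurable_fun_sum _ fun i _ =>
        AEStronglyMeasurable.mul ?_ (hw i))
    rw [Measure.prod_restrict]
    exact aestronglyMeasurable_restrict_of_continuousOn hΩ (continuousOn_netForce hu hS i)
      measurableSet_Ioc fun t ht => ha.trans ht.1
  have hint : ∀ φ, IntervalIntegrable (fun t => inner ℝ (toL2 Ω (netForce u S t)) φ) volume a b :=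
    fun φ => by
      rw [intervalIntegrable_iff_integrableOn_Ioc_of_le hab]
      refine Integrable.of_bound ?_ (C * ‖φ‖) ?_
      · refine (hmeas (fun i p => φ p.2 i) fun i =>
          (memLp_component (Lp.memLp φ) i).1.comp_snd).congr ?_
        filter_upwards [ae_restrict_mem measurableSet_Ioc] with t ht
        rw [← inner_toL2 (hC t (hsub (Ioc_subset_Icc_self ht))).1 (Lp.memLp φ), toL2_coeFn]
      · filter_upwards [ae_restrict_mem measurableSet_Ioc] with t ht
        exact (norm_inner_le_norm _ _).trans (mul_le_mul_of_nonneg_right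
          (hC t (hsub (Ioc_subset_Icc_self ht))).2 (norm_nonneg _))
  have hpow : ∀ t ∈ Icc a b, inner ℝ (toL2 Ω (netForce u S t)) (toL2 Ω (u t)) =
      stressPower Ω u S t := fun t ht => by
    rw [inner_toL2 (hC t (hsub ht)).1 (hu.memLp (hIoc t ht)),
      integral_netForce_mul_eq hΩ hu hS has (hsub ht) (hm t (hIoc t ht)) (hbd t (hIoc t ht))]
  have hintU : IntervalIntegrable (fun t => inner ℝ (toL2 Ω (netForce u S t)) (toL2 Ω (u t)))
      volume a b := by
    rw [intervalIntegrable_iff_integrableOn_Ioc_of_le hab]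
    refine Integrable.of_bound ?_ (C * D) ?_
    · refine (hmeas (fun i p => u p.1 p.2 i) fun i => ?_).congr ?_
      · rw [Measure.prod_restrict]
        exact aestronglyMeasurable_restrict_of_continuousOn hΩ (hu.contDiffOn_apply i).continuousOn
          measurableSet_Ioc fun t ht => ha.trans ht.1
      · filter_upwards [ae_restrict_mem measurableSet_Ioc] with t ht
        rw [inner_toL2 (hC t (hsub (Ioc_subset_Icc_self ht))).1 (hu.memLp (hIoc t (Ioc_subset_Icc_self ht)))]
    · filter_upwards [ae_restrict_mem measurableSet_Ioc] with t ht
      have ht' := hsub (Ioc_subset_Icc_self ht)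
      exact (norm_inner_le_norm _ _).trans (mul_le_mul (hC t ht').2 (hD t ht') (norm_nonneg _)
        ((norm_nonneg _).trans (hC t ht').2))
  have hEq : EqOn (fun t => inner ℝ (toL2 Ω (netForce u S t)) (toL2 Ω (u t)))
      (stressPower Ω u S) (Icc a b) := hpow
  refine ⟨(intervalIntegrable_congr (fun t ht => ?_)).1 hintU, ?_⟩
  · rw [uIoc_of_le hab] at ht
    exact hEq (Ioc_subset_Icc_self ht)
  rw [norm_sq_sub_eq_of_weak_deriv hab (U := fun t => toL2 Ω (u t))
    (B := fun t => toL2 Ω (netForce u S t)) (C := C) (K := solenoidalSpace Ω)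
    (fun t ht => hm t (hIoc t ht)) (fun t ht => (hC t (hsub ht)).2) hint hintU ?_,
    intervalIntegral.integral_congr (g := stressPower Ω u S)]
  · rwa [uIcc_of_le hab]
  · intro s t hs hst ht φ hφ
    have hst' : Icc s t ⊆ Icc a b := Icc_subset_Icc hs ht
    refine solenoidalSpace_induction (P := fun φ => inner ℝ (toL2 Ω (u t) - toL2 Ω (u s)) φ =
      ∫ q in s..t, inner ℝ (toL2 Ω (netForce u S q)) φ) (isClosed_eq (by fun_prop)
        (continuous_integral_inner (C := C) hst (fun q hq => (hC q (hsub (hst' hq))).2)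
          fun ψ => intervalIntegrable_mono_Icc (hint ψ) hs hst ht)) (fun ψ hψ => ?_) hφ
    rw [heq ψ hψ s t (ha.trans_le hs) hst (ht.trans hb)]
    refine intervalIntegral.integral_congr fun q hq => ?_
    rw [uIcc_of_le hst] at hq
    have hq' := hst' hq
    simp only
    rw [inner_toL2 (hC q (hsub hq')).1 (hψ.memLp 2 _), integral_stress_grad_eq hΩ hu hS
      (hIoc q hq').1 (fun x hx => hu.sum_grad_eq_zero hΩ (hIoc q hq') (hm q (hIoc q hq')) hx) hψ]

end

end

section

variable {Ω : Set Plane} {T : ℝ}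

/-! ### The stress is controlled by the energy deficit -/

lemma integral_weight_norm_sq {v : ℝ → Plane → Plane} {ξ : ℝ → ℝ}
    (hv : MemLp (fun p : ℝ × Plane => v p.1 p.2) 2 (volume.restrict (cylinder Ω T)))
    (hvt : ∀ t ∈ Ioo 0 T, MemLp (v t) 2 (volume.restrict Ω)) (hξ : Continuous ξ)
    (hξ01 : ∀ t, 0 ≤ ξ t ∧ ξ t ≤ 1) :
    IntegrableOn (fun p : ℝ × Plane => ξ p.1 * ‖v p.1 p.2‖ ^ 2) (cylinder Ω T) ∧
    IntegrableOn (fun t => ξ t * ‖toL2 Ω (v t)‖ ^ 2) (Ioo 0 T) ∧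
    ∫ p in cylinder Ω T, ξ p.1 * ‖v p.1 p.2‖ ^ 2 = ∫ t in Ioo 0 T, ξ t * ‖toL2 Ω (v t)‖ ^ 2 := by
  have h1 : IntegrableOn (fun p : ℝ × Plane => ξ p.1 * ‖v p.1 p.2‖ ^ 2) (cylinder Ω T) :=
    hv.norm.integrable_sq.bdd_mul (c := 1) (hξ.comp continuous_fst).aestronglyMeasurable
      (.of_forall fun p => by rw [Real.norm_of_nonneg (hξ01 _).1]; exact (hξ01 _).2)
  have e : ∀ t ∈ Ioo 0 T, ∫ x in Ω, ξ t * ‖v t x‖ ^ 2 = ξ t * ‖toL2 Ω (v t)‖ ^ 2 := fun t ht => by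
    rw [integral_const_mul, ← real_inner_self_eq_norm_sq, inner_toL2 (hvt t ht) (hvt t ht)]
    simp only [← inner_plane, real_inner_self_eq_norm_sq]
  refine ⟨h1, ?_, ?_⟩
  · have h2 := h1
    rw [IntegrableOn, volume_restrict_cylinder] at h2
    exact (integrableOn_congr_fun e measurableSet_Ioo).1 h2.integral_prod_left
  · rw [integral_cylinder h1]
    exact setIntegral_congr_fun measurableSet_Ioo e

section

variable {un0 : ℕ → Plane → Plane} {un : ℕ → ℝ → Plane → Plane} {u0 : Plane → Plane}
  {u : ℝ → Plane → Plane} {R : Fin 2 → Fin 2 → (ℝ × Plane → ℝ) → ℝ}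
  {S : ℝ → Plane → Fin 2 → Fin 2 → ℝ}

/-- The energy lost by the limit at time `t`: the difference of the energies of `u₀` and `u(t)`. -/
noncomputable def energyDeficit (Ω : Set Plane) (u0 : Plane → Plane) (u : ℝ → Plane → Plane)
    (t : ℝ) : ℝ :=
  ‖toL2 Ω u0‖ ^ 2 - ‖toL2 Ω (u t)‖ ^ 2

/-- The energy of the fluctuations `uₙ - u` is asymptotically bounded by the energy deficit. -/
lemma exists_fluctuation_bound (hT : 0 < T) (H : IsAsymptoticEuler Ω T un0 un)
    (hlim : WeakStarTendsto Ω T un u) (hu : IsRegularVelocity Ω T u)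
    (hu0 : MemLp u0 2 (volume.restrict Ω))
    (hinit : Tendsto (fun n => eLpNorm (un0 n - u0) 2 (volume.restrict Ω)) atTop (𝓝 0))
    {ξ : ℝ → ℝ} (hξ : Continuous ξ) (hξ01 : ∀ t, 0 ≤ ξ t ∧ ξ t ≤ 1) :
    ∃ E : ℕ → ℝ, Tendsto E atTop (𝓝 (∫ t in Ioo 0 T, ξ t * energyDeficit Ω u0 u t)) ∧
      ∀ n, ∫ p in cylinder Ω T, ξ p.1 * ‖un n p.1 p.2 - u p.1 p.2‖ ^ 2 ≤ E n := by
  have hIoo : ∀ t ∈ Ioo 0 T, t ∈ Icc 0 T := fun t ht => Ioo_subset_Icc_self ht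
  have hun := fun n => integral_weight_norm_sq (H.curve n).memLp_cylinder
    (fun t ht => (H.curve n).memLp (hIoo t ht)) hξ hξ01
  have huu := integral_weight_norm_sq hlim.memLp_cylinder
    (fun t ht => hu.memLp (Ioo_subset_Ioc_self ht)) hξ hξ01
  have hξi : IntegrableOn ξ (Ioo 0 T) :=
    (hξ.integrableOn_Icc (a := 0) (b := T)).mono_set Ioo_subset_Icc_self
  have hcross : ∀ (v : ℝ → Plane → Plane),
      MemLp (fun p : ℝ × Plane => v p.1 p.2) 2 (volume.restrict (cylinder Ω T)) →
      ∀ i, IntegrableOn (fun p : ℝ × Plane => ξ p.1 * (v p.1 p.2 i * u p.1 p.2 i)) (cylinder Ω T) :=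
    fun v hv i => (integrable_mul_of_memLp (hv.eval_piLp i)
      (hlim.memLp_cylinder.eval_piLp i)).bdd_mul (c := 1)
      (hξ.comp continuous_fst).aestronglyMeasurable
      (.of_forall fun p => by rw [Real.norm_of_nonneg (hξ01 _).1]; exact (hξ01 _).2)
  refine ⟨fun n => (∫ t in Ioo 0 T, ξ t) * ‖toL2 Ω (un n 0)‖ ^ 2 -
    2 * ∑ i, (∫ p in cylinder Ω T, ξ p.1 * (un n p.1 p.2 i * u p.1 p.2 i)) +
    ∫ p in cylinder Ω T, ξ p.1 * ‖u p.1 p.2‖ ^ 2, ?_, fun n => ?_⟩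
  · have h1 := tendsto_finsetSum Finset.univ fun i _ =>
      hlim.tendsto_integral_weight_mul (ψ := fun p => ξ p.1) (C := 1)
        (hξ.comp continuous_fst).aestronglyMeasurable
        (fun p => by rw [abs_of_nonneg (hξ01 _).1]; exact (hξ01 _).2) i i
    have h2 := ((((tendsto_toL2_zero hT.le H.curve hu0 hinit).norm.pow 2).const_mul
      (∫ t in Ioo 0 T, ξ t)).sub (h1.const_mul 2)).add_const
      (∫ p in cylinder Ω T, ξ p.1 * ‖u p.1 p.2‖ ^ 2)
    refine h2.trans (le_of_eq ?_)
    congr 1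
    rw [← integral_finsetSum _ fun i _ => hcross u hlim.memLp_cylinder i]
    have e1 : ∫ p in cylinder Ω T, ∑ i, ξ p.1 * (u p.1 p.2 i * u p.1 p.2 i) =
        ∫ p in cylinder Ω T, ξ p.1 * ‖u p.1 p.2‖ ^ 2 := by
      simp only [← Finset.mul_sum, ← inner_plane, real_inner_self_eq_norm_sq]
    have e2 : ∫ t in Ioo 0 T, ξ t * energyDeficit Ω u0 u t =
        (∫ t in Ioo 0 T, ξ t) * ‖toL2 Ω u0‖ ^ 2 - ∫ t in Ioo 0 T, ξ t * ‖toL2 Ω (u t)‖ ^ 2 := by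
      rw [← integral_mul_const, ← integral_sub (hξi.mul_const _) huu.2.1]
      congr 1; ext t
      rw [energyDeficit]; ring
    rw [e1, e2, huu.2.2]
    ring
  · have e : ∫ p in cylinder Ω T, ξ p.1 * ‖un n p.1 p.2 - u p.1 p.2‖ ^ 2 =
        (∫ p in cylinder Ω T, ξ p.1 * ‖un n p.1 p.2‖ ^ 2) -
        2 * ∑ i, (∫ p in cylinder Ω T, ξ p.1 * (un n p.1 p.2 i * u p.1 p.2 i)) +
        ∫ p in cylinder Ω T, ξ p.1 * ‖u p.1 p.2‖ ^ 2 := by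
      have i2 : IntegrableOn (fun p : ℝ × Plane => 2 * ∑ i, ξ p.1 * (un n p.1 p.2 i * u p.1 p.2 i))
          (cylinder Ω T) :=
        (integrable_finsetSum _ fun i _ => hcross _ (H.curve n).memLp_cylinder i).const_mul 2
      rw [← integral_finsetSum _ fun i _ => hcross _ (H.curve n).memLp_cylinder i,
        ← integral_const_mul, ← integral_sub' (hun n).1 i2, ← integral_add' ((hun n).1.sub i2) huu.1]
      congr 1; ext p
      simp only [Pi.add_apply, Pi.sub_apply, ← Finset.mul_sum, ← inner_plane, norm_sub_sq_real]
      ring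
    rw [e, (hun n).2.2]
    beta_reduce
    rw [← integral_mul_const]
    gcongr ?_ - _ + _
    refine setIntegral_mono_on (hun n).2.1 (hξi.mul_const _) measurableSet_Ioo fun t ht => ?_
    exact mul_le_mul_of_nonneg_left (pow_le_pow_left₀ (norm_nonneg _) (H.norm_le n t (hIoo t ht)) 2)
      (hξ01 t).1

lemma abs_integral_weight_mul_le (hlim : WeakStarTendsto Ω T un u)
    (hc : ∀ n, IsSolenoidalCurve Ω T (un0 n) (un n)) {ψ : ℝ × Plane → ℝ} {ξ : ℝ → ℝ} {K : ℝ}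
    (hξ : Continuous ξ) (hξ01 : ∀ t, 0 ≤ ξ t ∧ ξ t ≤ 1) (hψ : ∀ p, |ψ p| ≤ K * ξ p.1)
    (n : ℕ) (i j : Fin 2) :
    |∫ p in cylinder Ω T, ψ p * ((un n p.1 p.2 i - u p.1 p.2 i) * (un n p.1 p.2 j - u p.1 p.2 j))| ≤
      K * ∫ p in cylinder Ω T, ξ p.1 * ‖un n p.1 p.2 - u p.1 p.2‖ ^ 2 := by
  have hi : IntegrableOn (fun p : ℝ × Plane => ξ p.1 * ‖un n p.1 p.2 - u p.1 p.2‖ ^ 2)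
      (cylinder Ω T) :=
    ((hc n).memLp_cylinder.sub hlim.memLp_cylinder).norm.integrable_sq.bdd_mul (c := 1)
      (hξ.comp continuous_fst).aestronglyMeasurable
      (.of_forall fun p => by rw [Real.norm_of_nonneg (hξ01 _).1]; exact (hξ01 _).2)
  rw [← integral_const_mul, ← Real.norm_eq_abs]
  refine norm_integral_le_of_norm_le (hi.const_mul K) (.of_forall fun p => ?_)
  rw [norm_mul, norm_mul, sq]
  have h1 := PiLp.norm_apply_le (un n p.1 p.2 - u p.1 p.2)
  refine (mul_le_mul (hψ p) (mul_le_mul (h1 i) (h1 j) (norm_nonneg _)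
    (norm_nonneg _)) (by positivity) ((abs_nonneg _).trans (hψ p))).trans_eq (mul_assoc _ _ _)

/-- The entries of the stress, as distributions, are controlled by the energy deficit. -/
lemma abs_integral_stress_le (hT : 0 < T) (H : IsAsymptoticEuler Ω T un0 un)
    (hlim : WeakStarTendsto Ω T un u) (hu : IsRegularVelocity Ω T u)
    (hu0 : MemLp u0 2 (volume.restrict Ω))
    (hinit : Tendsto (fun n => eLpNorm (un0 n - u0) 2 (volume.restrict Ω)) atTop (𝓝 0))
    (hR : IsReynoldsTensor Ω T un u R) (hS : IsTraceFreePart Ω T R S)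
    {ξ : ℝ → ℝ} {η : Plane → ℝ} {K : ℝ} (hξ : Continuous ξ) (hξ01 : ∀ t, 0 ≤ ξ t ∧ ξ t ≤ 1)
    (hψ : IsScalarTest Ω T fun p => ξ p.1 * η p.2) (hη : ∀ x, |η x| ≤ K) (i j : Fin 2) :
    |∫ p in cylinder Ω T, ξ p.1 * η p.2 * S p.1 p.2 i j| ≤
      2 * K * ∫ t in Ioo 0 T, ξ t * energyDeficit Ω u0 u t := by
  have hK : 0 ≤ K := (abs_nonneg _).trans (hη 0)
  obtain ⟨E, hE, hEn⟩ := exists_fluctuation_bound hT H hlim hu hu0 hinit hξ hξ01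
  have hb : ∀ i j, |R i j fun p => ξ p.1 * η p.2| ≤
      K * ∫ t in Ioo 0 T, ξ t * energyDeficit Ω u0 u t := fun i j => by
    refine le_of_tendsto_of_tendsto (hR _ hψ i j).abs (hE.const_mul K) (.of_forall fun n => ?_)
    refine (abs_integral_weight_mul_le hlim H.curve hξ hξ01 (fun p => ?_) n i j).trans
      (mul_le_mul_of_nonneg_left (hEn n) hK)
    rw [abs_mul, abs_of_nonneg (hξ01 _).1, mul_comm]
    exact mul_le_mul_of_nonneg_right (hη _) (hξ01 _).1
  have h := hS _ hψ i j
  rw [← h]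
  have h1 := abs_le.1 (hb i j)
  have h2 := abs_le.1 (hb 0 0)
  have h3 := abs_le.1 (hb 1 1)
  rw [abs_le]
  split_ifs
  · constructor <;> linarith [h1.1, h1.2, h2.1, h2.2, h3.1, h3.2]
  · constructor <;> linarith [h1.1, h1.2]

end

/-- A continuous function with nonnegative integrals against nonnegative test functions is
nonnegative. -/
lemma nonneg_of_integral_test {h : ℝ → ℝ} {a b : ℝ} (hc : ContinuousOn h (Ioo a b))
    (H : ∀ ξ : ℝ → ℝ, ContDiff ℝ ∞ ξ → HasCompactSupport ξ → tsupport ξ ⊆ Ioo a b →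
      (∀ t, 0 ≤ ξ t ∧ ξ t ≤ 1) → 0 ≤ ∫ t in Ioo a b, ξ t * h t) {t : ℝ} (ht : t ∈ Ioo a b) :
    0 ≤ h t := by
  by_contra! hneg
  have hev : ∀ᶠ s in 𝓝 t, s ∈ Ioo a b ∧ h s < h t / 2 :=
    Filter.Eventually.and (Ioo_mem_nhds ht.1 ht.2) ((hc.continuousAt (Ioo_mem_nhds ht.1 ht.2)).eventually_lt_const
      (by linarith))
  obtain ⟨δ, hδ, hball⟩ := Metric.eventually_nhds_iff_ball.1 hev
  let B : ContDiffBump t := ⟨δ / 4, δ / 2, by positivity, by linarith⟩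
  have hsupp : tsupport B ⊆ Metric.ball t δ := by
    rw [B.tsupport_eq]
    exact Metric.closedBall_subset_ball (half_lt_self hδ)
  have hsub : tsupport B ⊆ Ioo a b := fun s hs => (hball s (hsupp hs)).1
  have h1 := H B B.contDiff B.hasCompactSupport hsub fun s => ⟨B.nonneg, B.le_one⟩
  have hint : IntegrableOn (fun s => B s * h s) (Ioo a b) := by
    have h2 : IntegrableOn (fun s => B s * h s) (tsupport B) :=
      (B.continuous.continuousOn.mul (hc.mono hsub)).integrableOn_compact B.hasCompactSupport
    refine ((integrableOn_iff_integrable_of_support_subset ?_).1 h2).integrableOn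
    exact fun s hs => subset_tsupport _ (left_ne_zero_of_mul hs)
  have hBi : Integrable (fun s => B s * (h t / 2)) :=
    (B.continuous.integrable_of_hasCompactSupport B.hasCompactSupport).mul_const _
  have h3 : ∫ s in Ioo a b, B s * h s ≤ ∫ s in Ioo a b, B s * (h t / 2) := by
    refine integral_mono hint hBi.integrableOn fun s => ?_
    by_cases hs : s ∈ tsupport B
    · exact mul_le_mul_of_nonneg_left (hball s (hsupp hs)).2.le B.nonneg
    · simp [image_eq_zero_of_notMem_tsupport hs]
  rw [integral_mul_const, setIntegral_eq_integral_of_forall_compl_eq_zero fun s hs =>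
    image_eq_zero_of_notMem_tsupport fun h => hs (hsub h)] at h3
  have h4 : 0 < ∫ s, B s := B.integral_pos
  nlinarith

/-- Continuous cut-off functions exhausting an open set. -/
lemma exists_cutoff_of_isOpen (hΩ : IsOpen Ω) : ∃ χ : ℕ → Plane → ℝ, (∀ k, Continuous (χ k)) ∧
    (∀ k, HasCompactSupport (χ k)) ∧ (∀ k, tsupport (χ k) ⊆ Ω) ∧ (∀ k x, χ k x ∈ Icc 0 1) ∧
    ∀ x ∈ Ω, ∀ᶠ k in atTop, χ k x = 1 := by
  have : LocallyCompactSpace Ω := hΩ.locallyCompactSpace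
  have hK : ∀ k, ∃ f : C(Plane, ℝ), EqOn f 1 (Subtype.val '' compactCovering Ω k) ∧
      IsCompact (tsupport f) ∧ tsupport f ⊆ Ω ∧ ∀ x, f x ∈ Icc 0 1 := fun k =>
    exists_continuousMap_one_of_isCompact_subset_isOpen
      ((isCompact_compactCovering Ω k).image continuous_subtype_val) hΩ (by
        rintro _ ⟨x, -, rfl⟩; exact x.2)
  choose f hf1 hfc hfs hf01 using hK
  refine ⟨fun k => f k, fun k => (f k).continuous, hfc, hfs, hf01, fun x hx => ?_⟩
  obtain ⟨n, hn⟩ := exists_mem_compactCovering (⟨x, hx⟩ : Ω)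
  filter_upwards [eventually_ge_atTop n] with k hk
  exact hf1 k ⟨⟨x, hx⟩, compactCovering_subset Ω hk hn, rfl⟩

section

variable {u0 : Plane → Plane} {u : ℝ → Plane → Plane} {S : ℝ → Plane → Fin 2 → Fin 2 → ℝ}

/-- The distributional bound of the stress holds at each time, for continuous test functions. -/
lemma abs_integral_stress_slice_le (hS : IsRegularStress Ω T S)
    (hd : ContinuousOn (energyDeficit Ω u0 u) (Ioo 0 T))
    (hb : ∀ (ξ : ℝ → ℝ) (η : Plane → ℝ) (K : ℝ), Continuous ξ → (∀ t, 0 ≤ ξ t ∧ ξ t ≤ 1) →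
      IsScalarTest Ω T (fun p => ξ p.1 * η p.2) → (∀ x, |η x| ≤ K) → ∀ i j,
      |∫ p in cylinder Ω T, ξ p.1 * η p.2 * S p.1 p.2 i j| ≤
        2 * K * ∫ t in Ioo 0 T, ξ t * energyDeficit Ω u0 u t)
    {η : Plane → ℝ} {K t : ℝ} (ht : t ∈ Ioo 0 T) (hη : Continuous η) (hηc : HasCompactSupport η)
    (hηs : tsupport η ⊆ Ω) (hηK : ∀ x, |η x| ≤ K) (i j : Fin 2) :
    |∫ x in Ω, η x * S t x i j| ≤ 2 * K * energyDeficit Ω u0 u t := by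
  -- smooth test functions
  have hsm : ∀ (η : Plane → ℝ) (K : ℝ), ContDiff ℝ ∞ η → HasCompactSupport η → tsupport η ⊆ Ω →
      (∀ x, |η x| ≤ K) → |∫ x in Ω, η x * S t x i j| ≤ 2 * K * energyDeficit Ω u0 u t := by
    intro η K hη hηc hηs hηK
    have hG : ContinuousOn (fun t => ∫ x in Ω, η x * S t x i j) (Ioo 0 T) := by
      refine continuousOn_integral_of_compact_support (k := tsupport η) hηc ?_ ?_
      · exact (hη.continuous.comp continuous_snd).continuousOn.mul
          ((hS.contDiff i j).continuousOn.mono (prod_mono (fun t ht => ht.1) subset_rfl))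
      · intro t x _ hx
        rw [image_eq_zero_of_notMem_tsupport hx, zero_mul]
    have key : ∀ c : ℝ, |c| = 1 →
        0 ≤ 2 * K * energyDeficit Ω u0 u t - c * ∫ x in Ω, η x * S t x i j := fun c hc => by
      refine nonneg_of_integral_test (h := fun t => 2 * K * energyDeficit Ω u0 u t -
        c * ∫ x in Ω, η x * S t x i j) ((continuousOn_const.mul hd).sub (continuousOn_const.mul hG))
        (fun ξ hξ hξc hξs hξ01 => ?_) ht
      have hψ := isScalarTest_mul hξ hξc hξs hη hηc hηs
      have hi : ∀ {f : ℝ → ℝ}, ContinuousOn f (Ioo 0 T) →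
          IntegrableOn (fun t => ξ t * f t) (Ioo 0 T) := fun {f} hf => by
        have h2 : IntegrableOn (fun s => ξ s * f s) (tsupport ξ) :=
          (hξ.continuous.continuousOn.mul (hf.mono hξs)).integrableOn_compact hξc
        refine ((integrableOn_iff_integrable_of_support_subset ?_).1 h2).integrableOn
        exact fun s hs => subset_tsupport _ (left_ne_zero_of_mul hs)
      have h1 := hb ξ η K hξ.continuous hξ01 hψ hηK i j
      have e : ∫ p in cylinder Ω T, ξ p.1 * η p.2 * S p.1 p.2 i j =
          ∫ t in Ioo 0 T, ξ t * ∫ x in Ω, η x * S t x i j := by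
        rw [integral_cylinder (hψ.integrableOn_mul (hS.contDiff i j).continuousOn)]
        simp only [mul_assoc, integral_const_mul]
      have e2 : ∫ t in Ioo 0 T, ξ t * (2 * K * energyDeficit Ω u0 u t -
          c * ∫ x in Ω, η x * S t x i j) = 2 * K * (∫ t in Ioo 0 T, ξ t * energyDeficit Ω u0 u t) -
          c * ∫ t in Ioo 0 T, ξ t * ∫ x in Ω, η x * S t x i j := by
        rw [← integral_const_mul, ← integral_const_mul,
          ← integral_sub ((hi hd).const_mul _) ((hi hG).const_mul _)]
        congr 1; ext t; ring
      rw [e2, ← e, sub_nonneg]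
      refine (le_abs_self _).trans ?_
      rw [abs_mul, hc, one_mul]
      exact h1
    have h1 := key 1 (by simp)
    have h2 := key (-1) (by simp)
    rw [abs_le]
    constructor <;> linarith
  choose g hg hgη hgs using fun k : ℕ => hη.exists_contDiff_approx ⊤ (ε := fun _ => 1 / ((k : ℝ) + 1))
    continuous_const (fun _ => by positivity)
  have hgts : ∀ k, tsupport (g k) ⊆ tsupport η := fun k => closure_mono (hgs k)
  have hgc : ∀ k, HasCompactSupport (g k) := fun k =>
    hηc.isCompact.of_isClosed_subset (isClosed_tsupport _) (hgts k)
  have hgd : ∀ k x, |g k x - η x| ≤ 1 / ((k : ℝ) + 1) := fun k x => (hgη k x).le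
  have hk := fun k => hsm (g k) (K + 1 / ((k : ℝ) + 1)) (hg k) (hgc k) ((hgts k).trans hηs)
    fun x => by
      have h1 := abs_le.1 (hgd k x)
      have h2 := abs_le.1 (hηK x)
      rw [abs_le]; constructor <;> linarith [h1.1, h1.2, h2.1, h2.2]
  have hSc : Continuous fun x => S t x i j := (hS.contDiff_slice ht.1 i j).continuous
  have h1 : Tendsto (fun k => ∫ x in Ω, g k x * S t x i j) atTop (𝓝 (∫ x in Ω, η x * S t x i j)) := by
    refine tendsto_integral_of_dominated_convergence
      ((tsupport η).indicator fun x => (K + 1) * |S t x i j|)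
      (fun k => ((hg k).continuous.mul hSc).aestronglyMeasurable) ?_ (fun k => .of_forall fun x => ?_)
      (.of_forall fun x => ?_)
    · rw [integrable_indicator_iff (isClosed_tsupport η).measurableSet]
      exact IntegrableOn.restrict
        ((continuous_const.mul hSc.abs).continuousOn.integrableOn_compact hηc)
    · by_cases hx : x ∈ tsupport η
      · rw [indicator_of_mem hx, norm_mul]
        refine mul_le_mul_of_nonneg_right ?_ (abs_nonneg _)
        have h1 := abs_le.1 (hgd k x)
        have h2 := abs_le.1 (hηK x)
        have h3 : 1 / ((k : ℝ) + 1) ≤ 1 := by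
          rw [div_le_one (by positivity)]; linarith [(Nat.cast_nonneg k : (0 : ℝ) ≤ k)]
        rw [Real.norm_eq_abs, abs_le]; constructor <;> linarith [h1.1, h1.2, h2.1, h2.2]
      · rw [indicator_of_notMem hx, image_eq_zero_of_notMem_tsupport fun h => hx (hgts k h)]
        simp
    · refine Tendsto.mul_const _ (tendsto_iff_norm_sub_tendsto_zero.2 ?_)
      exact squeeze_zero (fun _ => norm_nonneg _) (fun k => hgd k x)
        tendsto_one_div_add_atTop_nhds_zero_nat
  refine le_of_tendsto_of_tendsto h1.abs ?_ (.of_forall hk)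
  have := ((tendsto_one_div_add_atTop_nhds_zero_nat (𝕜 := ℝ)).const_add K).const_mul 2
  simpa using this.mul_const (energyDeficit Ω u0 u t)

/-- The power of the stress is controlled by the energy deficit. -/
lemma abs_stressPower_le (hΩ : IsOpen Ω) (hu : IsRegularVelocity Ω T u) (hS : IsRegularStress Ω T S)
    {K t : ℝ} (ht : t ∈ Ioo 0 T) (hK : 0 ≤ K)
    (hb : ∀ η : Plane → ℝ, Continuous η → HasCompactSupport η → tsupport η ⊆ Ω →
      (∀ x, |η x| ≤ K) → ∀ i j, |∫ x in Ω, η x * S t x i j| ≤ 2 * K * energyDeficit Ω u0 u t)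
    (hgrad : ∀ x ∈ Ω, ∀ i j, |grad (u t) x i j| ≤ K) :
    |stressPower Ω u S t| ≤ 8 * K * energyDeficit Ω u0 u t := by
  have ht' := Ioo_subset_Ioc_self ht
  obtain ⟨χ, hχ, hχc, hχs, hχ01, hχlim⟩ := exists_cutoff_of_isOpen hΩ
  have hi : ∀ i j, IntegrableOn (fun x => S t x i j * grad (u t) x i j) Ω := fun i j =>
    integrable_mul_of_memLp (hS.memLp ht' i j) (hu.memLp_grad ht' i j)
  have hij : ∀ i j, |∫ x in Ω, S t x i j * grad (u t) x i j| ≤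
      2 * K * energyDeficit Ω u0 u t := fun i j => by
    have hgc := hu.continuous_grad ht.1 i j
    have hSc := (hS.contDiff_slice ht.1 i j).continuous
    have h1 : Tendsto (fun k => ∫ x in Ω, χ k x * grad (u t) x i j * S t x i j) atTop
        (𝓝 (∫ x in Ω, S t x i j * grad (u t) x i j)) := by
      refine tendsto_integral_of_dominated_convergence (fun x => ‖S t x i j * grad (u t) x i j‖)
        (fun k => (((hχ k).mul hgc).mul hSc).aestronglyMeasurable) (hi i j).norm
        (fun k => .of_forall fun x => ?_)
        ((ae_restrict_iff' hΩ.measurableSet).2 (.of_forall fun x hx => ?_))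
      · rw [mul_assoc, norm_mul, mul_comm (grad (u t) x i j), Real.norm_of_nonneg (hχ01 k x).1]
        exact mul_le_of_le_one_left (norm_nonneg _) (hχ01 k x).2
      · refine tendsto_const_nhds.congr' ?_
        filter_upwards [hχlim x hx] with k hk
        rw [hk, one_mul, mul_comm]
    refine le_of_tendsto h1.abs (.of_forall fun k => hb _ ((hχ k).mul hgc) (hχc k).mul_right
      ((tsupport_mul_subset_left (f := χ k)).trans (hχs k)) (fun x => ?_) i j)
    change |χ k x * grad (u t) x i j| ≤ K
    by_cases hx : x ∈ Ω
    · rw [abs_mul, abs_of_nonneg (hχ01 k x).1]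
      exact (mul_le_of_le_one_left (abs_nonneg _) (hχ01 k x).2).trans (hgrad x hx i j)
    · rw [image_eq_zero_of_notMem_tsupport fun h => hx (hχs k h), zero_mul, abs_zero]
      exact hK
  rw [stressPower, integral_sum_sum hi]
  calc |∑ i, ∑ j, ∫ x in Ω, S t x i j * grad (u t) x i j|
      ≤ ∑ i : Fin 2, ∑ j : Fin 2, 2 * K * energyDeficit Ω u0 u t :=
        (Finset.abs_sum_le_sum_abs _ _).trans (Finset.sum_le_sum fun i _ =>
          (Finset.abs_sum_le_sum_abs _ _).trans (Finset.sum_le_sum fun j _ => hij i j))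
    _ = 8 * K * energyDeficit Ω u0 u t := by simp; ring

end

end

section

variable {Ω : Set Plane} {T : ℝ}

/-! ### Propagation of the energy deficit -/

/-- Grönwall's inequality in integral form, for a continuous function. -/
lemma le_mul_exp_of_le_integral {f : ℝ → ℝ} {a b K : ℝ} (hab : a ≤ b) (hf : ContinuousOn f (Icc a b))
    (hK : 0 ≤ K) (h : ∀ t ∈ Icc a b, f t ≤ f a + K * ∫ s in a..t, f s) :
    f b ≤ f a * Real.exp (K * (b - a)) := by
  have hi : ∀ t ∈ Icc a b, IntervalIntegrable f volume a t := fun t ht =>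
    (hf.mono (by rw [uIcc_of_le ht.1]; exact Icc_subset_Icc_right ht.2)).intervalIntegrable
  have hprim : ContinuousOn (fun t => ∫ s in a..t, f s) (Icc a b) := by
    have := intervalIntegral.continuousOn_primitive_interval' (hi b ⟨hab, le_rfl⟩) left_mem_uIcc
    rwa [uIcc_of_le hab] at this
  have hd : ∀ t ∈ Ioo a b, HasDerivAt
      (fun t => (f a + K * ∫ s in a..t, f s) * Real.exp (-(K * (t - a))))
      (K * f t * Real.exp (-(K * (t - a))) +
        (f a + K * ∫ s in a..t, f s) * (Real.exp (-(K * (t - a))) * -(K * 1))) t := fun t ht => by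
    have hc : ContinuousAt f t := hf.continuousAt (Icc_mem_nhds ht.1 ht.2)
    have h1 := intervalIntegral.integral_hasDerivAt_right (hi t (Ioo_subset_Icc_self ht))
      ((hf.mono Ioo_subset_Icc_self).stronglyMeasurableAtFilter isOpen_Ioo t ht) hc
    exact ((h1.const_mul K).const_add (f a)).mul
      ((((hasDerivAt_id t).sub_const a).const_mul K).neg.exp)
  have hanti := antitoneOn_of_deriv_nonpos (convex_Icc a b)
    (f := fun t => (f a + K * ∫ s in a..t, f s) * Real.exp (-(K * (t - a))))
    ((continuousOn_const.add (continuousOn_const.mul hprim)).mul (by fun_prop))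
    (by
      rw [interior_Icc]
      exact fun t ht => (hd t ht).differentiableAt.differentiableWithinAt)
    (by
      rw [interior_Icc]
      intro t ht
      rw [(hd t ht).deriv]
      have h1 := mul_le_mul_of_nonneg_left (h t (Ioo_subset_Icc_self ht)) hK
      have h2 := mul_le_mul_of_nonneg_right h1 (Real.exp_pos (-(K * (t - a)))).le
      linarith)
  have h1 := hanti ⟨le_rfl, hab⟩ ⟨hab, le_rfl⟩ hab
  simp only [intervalIntegral.integral_same, mul_zero, add_zero, sub_self, neg_zero, Real.exp_zero,
    mul_one] at h1
  have h2 := mul_le_mul_of_nonneg_right h1 (Real.exp_pos (K * (b - a))).le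
  rw [mul_assoc, ← Real.exp_add, neg_add_cancel, Real.exp_zero, mul_one] at h2
  exact (h b ⟨hab, le_rfl⟩).trans h2

/-- If the rate of change of a function is controlled by the function itself, then it grows and
decays at most exponentially. -/
lemma le_mul_exp_of_abs_rate_le {f P : ℝ → ℝ} {a b K : ℝ} (hab : a ≤ b)
    (hP : IntervalIntegrable P volume a b)
    (hf : ∀ t ∈ Icc a b, f t = f a + ∫ s in a..t, P s) (hK : 0 ≤ K)
    (hle : ∀ t ∈ Ioo a b, |P t| ≤ K * f t) :
    f b ≤ f a * Real.exp (K * (b - a)) ∧ f a ≤ f b * Real.exp (K * (b - a)) := by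
  have hc : ContinuousOn f (Icc a b) := by
    have h1 := intervalIntegral.continuousOn_primitive_interval' hP left_mem_uIcc
    rw [uIcc_of_le hab] at h1
    exact (continuousOn_const.add h1).congr hf
  have hsub : ∀ {s t}, a ≤ s → s ≤ t → t ≤ b → IntervalIntegrable P volume s t :=
    fun {s t} h1 h2 h3 => hP.mono_set (by
      rw [uIcc_of_le h2, uIcc_of_le hab]; exact Icc_subset_Icc h1 h3)
  have hbd : ∀ {s t}, a ≤ s → s ≤ t → t ≤ b → |f t - f s| ≤ K * ∫ τ in s..t, f τ :=
    fun {s t} h1 h2 h3 => by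
    have e : f t - f s = ∫ τ in s..t, P τ := by
      rw [hf t ⟨h1.trans h2, h3⟩, hf s ⟨h1, h2.trans h3⟩, ← intervalIntegral.integral_add_adjacent_intervals
        (hsub le_rfl h1 (h2.trans h3)) (hsub h1 h2 h3)]
      ring
    rw [e, ← intervalIntegral.integral_const_mul, ← Real.norm_eq_abs]
    refine intervalIntegral.norm_integral_le_of_norm_le h2 ?_ ?_
    · filter_upwards [Measure.ae_ne volume b] with τ hτ hτ'
      exact hle τ ⟨h1.trans_lt hτ'.1, lt_of_le_of_ne (hτ'.2.trans h3) hτ⟩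
    · refine ContinuousOn.intervalIntegrable ?_
      rw [uIcc_of_le h2]
      exact continuousOn_const.mul (hc.mono (Icc_subset_Icc h1 h3))
  refine ⟨le_mul_exp_of_le_integral hab hc hK fun t ht => ?_, ?_⟩
  · have := (abs_le.1 (hbd le_rfl ht.1 ht.2)).2
    linarith
  · have h1 := le_mul_exp_of_le_integral (f := fun s => f (a + b - s)) (K := K) hab
      (hc.comp (by fun_prop) fun s hs => ⟨by linarith [hs.2], by linarith [hs.1]⟩) hK
      fun t ht => by
        rw [intervalIntegral.integral_comp_sub_left, add_sub_cancel_left]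
        have := (abs_le.1 (hbd (s := a + b - t) (t := b) (by linarith [ht.2]) (by linarith [ht.1])
          le_rfl)).1
        linarith
    simpa using h1

/-! ### Strong convergence -/

section

variable {un0 : ℕ → Plane → Plane} {un : ℕ → ℝ → Plane → Plane} {u0 : Plane → Plane}
  {u : ℝ → Plane → Plane} {R : Fin 2 → Fin 2 → (ℝ × Plane → ℝ) → ℝ}
  {S : ℝ → Plane → Fin 2 → Fin 2 → ℝ}

/-- Strong convergence means that the energy of the fluctuations tends to zero. -/
lemma strongTendsto_iff (hlim : WeakStarTendsto Ω T un u)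
    (hc : ∀ n, IsSolenoidalCurve Ω T (un0 n) (un n)) :
    StrongTendsto Ω T un u ↔
      Tendsto (fun n => ∫ p in cylinder Ω T, ‖un n p.1 p.2 - u p.1 p.2‖ ^ 2) atTop (𝓝 0) := by
  have hm : ∀ n, MemLp (fun p : ℝ × Plane => un n p.1 p.2 - u p.1 p.2) 2
      (volume.restrict (cylinder Ω T)) := fun n => (hc n).memLp_cylinder.sub hlim.memLp_cylinder
  have e : ∀ n, ∫ p in cylinder Ω T, ‖un n p.1 p.2 - u p.1 p.2‖ ^ 2 =
      (eLpNorm (fun p : ℝ × Plane => un n p.1 p.2 - u p.1 p.2) 2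
        (volume.restrict (cylinder Ω T))).toReal ^ 2 := fun n => by
    have h0 : 0 ≤ ∫ p in cylinder Ω T, ‖un n p.1 p.2 - u p.1 p.2‖ ^ 2 :=
      integral_nonneg fun p => by positivity
    rw [(hm n).eLpNorm_eq_integral_rpow_norm two_ne_zero ENNReal.ofNat_ne_top,
      ENNReal.toReal_ofReal (by positivity)]
    simp only [ENNReal.toReal_ofNat, Real.rpow_ofNat]
    rw [← Real.rpow_natCast, ← Real.rpow_mul h0]
    norm_num
  rw [StrongTendsto, ← ENNReal.tendsto_toReal_zero_iff fun n => (hm n).2.ne]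
  simp only [e]
  refine ⟨fun h => by simpa using h.pow 2, fun h => ?_⟩
  simpa [Real.sqrt_sq ENNReal.toReal_nonneg] using h.sqrt

/-- If the limit has kept the whole energy of the initial data, then the convergence is strong. -/
lemma strongTendsto_of_energyDeficit_eq_zero (hT : 0 < T) (H : IsAsymptoticEuler Ω T un0 un)
    (hlim : WeakStarTendsto Ω T un u) (hu : IsRegularVelocity Ω T u)
    (hu0 : MemLp u0 2 (volume.restrict Ω))
    (hinit : Tendsto (fun n => eLpNorm (un0 n - u0) 2 (volume.restrict Ω)) atTop (𝓝 0))
    (h : ∀ t ∈ Ioo 0 T, energyDeficit Ω u0 u t = 0) : StrongTendsto Ω T un u := by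
  obtain ⟨E, hE, hEn⟩ := exists_fluctuation_bound hT H hlim hu hu0 hinit (ξ := fun _ => 1)
    continuous_const (fun _ => ⟨zero_le_one, le_rfl⟩)
  rw [setIntegral_congr_fun measurableSet_Ioo (g := fun _ => 0) fun t ht => by
    simp [h t ht], integral_zero] at hE
  simp only [one_mul] at hEn
  exact (strongTendsto_iff hlim H.curve).2
    (squeeze_zero (fun n => integral_nonneg fun p => by positivity) hEn hE)

/-- Strongly convergent sequences have no turbulent stress. -/
lemma stress_eq_zero_of_strongTendsto (hΩ : IsOpen Ω)
    (hc : ∀ n, IsSolenoidalCurve Ω T (un0 n) (un n)) (hlim : WeakStarTendsto Ω T un u)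
    (hR : IsReynoldsTensor Ω T un u R) (hS : IsTraceFreePart Ω T R S)
    (hSreg : IsRegularStress Ω T S) (h : StrongTendsto Ω T un u) {t : ℝ} (ht : t ∈ Ioc 0 T)
    {x : Plane} (hx : x ∈ Ω) (i j : Fin 2) : S t x i j = 0 := by
  have hR0 : ∀ ψ, IsScalarTest Ω T ψ → ∀ i j, R i j ψ = 0 := fun ψ hψ i j => by
    obtain ⟨K, -, hK⟩ := hψ.exists_bound
    have h1 := ((strongTendsto_iff hlim hc).1 h).const_mul K
    rw [mul_zero] at h1
    refine tendsto_nhds_unique (hR ψ hψ i j) (squeeze_zero_norm (fun n => ?_) h1)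
    simpa using abs_integral_weight_mul_le hlim hc (ξ := fun _ => 1) continuous_const
      (fun _ => ⟨zero_le_one, le_rfl⟩) (fun p => by simpa using hK p) n i j
  have ho : IsOpen (cylinder Ω T) := isOpen_Ioo.prod hΩ
  have hcont : ContinuousOn (fun p : ℝ × Plane => S p.1 p.2 i j) (Ioi 0 ×ˢ univ) :=
    (hSreg.contDiff i j).continuousOn
  have hcyl : ContinuousOn (fun p : ℝ × Plane => S p.1 p.2 i j) (cylinder Ω T) :=
    hcont.mono (prod_mono (fun t ht => ht.1) (subset_univ _))
  have hae := ho.ae_eq_zero_of_integral_contDiff_smul_eq_zero (μ := volume)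
    (hcyl.locallyIntegrableOn ho.measurableSet) fun ψ hψ hψc hψs => by
      have h1 := hS ψ ⟨hψ, hψc, hψs⟩ i j
      simp only [hR0 ψ ⟨hψ, hψc, hψs⟩, add_zero, zero_div, ite_self, sub_zero] at h1
      rw [h1]
      exact (setIntegral_eq_integral_of_forall_compl_eq_zero fun p hp => by
        rw [image_eq_zero_of_notMem_tsupport fun hp' => hp (hψs hp'), zero_smul]).symm
  have hzero : EqOn (fun p : ℝ × Plane => S p.1 p.2 i j) 0 (cylinder Ω T) :=
    Measure.eqOn_open_of_ae_eq ((ae_restrict_iff' ho.measurableSet).2 hae) ho hcyl continuousOn_const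
  -- at the final time, the stress is the limit of its values at earlier times
  have hct : ContinuousWithinAt (fun s => S s x i j) (Iio t) t :=
    ((hcont (t, x) ⟨ht.1, mem_univ _⟩).continuousAt
      ((isOpen_Ioi.prod isOpen_univ).mem_nhds ⟨ht.1, mem_univ _⟩)).comp_continuousWithinAt
      (f := fun s => (s, x)) (by fun_prop)
  refine tendsto_nhds_unique hct.tendsto (tendsto_const_nhds.congr' ?_)
  filter_upwards [Ioo_mem_nhdsLT ht.1] with s hs
  exact (hzero (show (s, x) ∈ cylinder Ω T from ⟨⟨hs.1, hs.2.trans_le ht.2⟩, hx⟩)).symm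

end

/-! ### The turbulent viscosity -/

/-- Only the viscous part of the stress does work: the tensor `strainPerp` is orthogonal to the
gradient of a solenoidal field. -/
lemma stress_contraction {v : Plane → Plane} {x : Plane} {s : Fin 2 → Fin 2 → ℝ} {ν δ : ℝ}
    (hdiv : ∑ i, grad v x i i = 0)
    (h : ∀ i j, s i j = -ν * (grad v x i j + grad v x j i) + δ * strainPerp v x i j) :
    ∑ i, ∑ j, s i j * grad v x i j =
      -(ν * ((∑ i, ∑ j, (grad v x i j + grad v x j i) ^ 2) / 2)) := by
  have h11 : grad v x 1 1 = -grad v x 0 0 := by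
    rw [Fin.sum_univ_two] at hdiv; linarith
  simp only [h, Fin.sum_univ_two, strainPerp, strain, Matrix.of_apply, Matrix.cons_val', Matrix.cons_val_zero,
    Matrix.cons_val_one, Matrix.cons_val_fin_one, h11]
  ring

end

end WeakTurbulence

open WeakTurbulence in
theorem proposition1
    (Ω : Set Plane) (hΩ : IsOpen Ω) (T : ℝ) (hT : 0 < T)
    -- the sequence of solutions, with initial data converging strongly in `L²(Ω)`
    (un : ℕ → ℝ → Plane → Plane) (un0 : ℕ → Plane → Plane) (u0 : Plane → Plane)
    (hsol : (∀ n, IsEulerSolution Ω T (un0 n) (un n)) ∨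
      ∃ κ : ℕ → ℝ, (∀ n, 0 < κ n) ∧ Tendsto κ atTop (𝓝 0) ∧
        ∀ n, IsNavierStokesSolution Ω T (κ n) (un0 n) (un n))
    (hu0 : MemLp u0 2 (volume.restrict Ω))
    (hinit : Tendsto (fun n => eLpNorm (un0 n - u0) 2 (volume.restrict Ω)) atTop (𝓝 0))
    -- its weak limit, assumed smooth
    (u : ℝ → Plane → Plane) (hlim : WeakStarTendsto Ω T un u) (hu : IsRegularVelocity Ω T u)
    -- the turbulent Reynolds tensor and its trace-free part
    (R : Fin 2 → Fin 2 → (ℝ × Plane → ℝ) → ℝ) (hR : IsReynoldsTensor Ω T un u R)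
    (S : ℝ → Plane → Fin 2 → Fin 2 → ℝ) (hS : IsTraceFreePart Ω T R S)
    (hSreg : IsRegularStress Ω T S)
    -- the turbulent viscosity `ν`, with the convention `ν = δ = 0` where the basis degenerates
    (ν δ : ℝ → Plane → ℝ)
    (hdecomp : ∀ t ∈ Ioc 0 T, ∀ x ∈ closure Ω, ∀ i j,
      S t x i j = -ν t x * (grad (u t) x i j + grad (u t) x j i) + δ t x * strainPerp (u t) x i j)
    (hnorm : ∀ t ∈ Ioc 0 T, ∀ x ∈ closure Ω,
      (∀ i j, strain (u t) x i j = 0) → ν t x = 0 ∧ δ t x = 0)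
    -- on the boundary, `u` vanishes wherever turbulence is present
    (hbdry : ∀ t ∈ Ioc 0 T, ∀ x ∈ frontier Ω, ν t x ≠ 0 ∨ δ t x ≠ 0 → u t x = 0) :
    List.TFAE [
      StrongTendsto Ω T un u,
      ∀ t ∈ Ioc 0 T, ∀ x ∈ Ω, ν t x = 0,
      IntegrableOn (fun p : ℝ × Plane => ν p.1 p.2 *
          ((∑ i, ∑ j, (grad (u p.1) p.2 i j + grad (u p.1) p.2 j i) ^ 2) / 2)) (cylinder Ω T) ∧
        ∫ p in cylinder Ω T, ν p.1 p.2 *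
          ((∑ i, ∑ j, (grad (u p.1) p.2 i j + grad (u p.1) p.2 j i) ^ 2) / 2) ≤ 0] ∧
    ((∃ C : ℝ, ∀ t ∈ Ioc 0 T, ∀ x ∈ Ω, ∀ i j, |grad (u t) x i j| ≤ C) →
      (StrongTendsto Ω T un u ↔
        IntegrableOn (fun p : ℝ × Plane => ν p.1 p.2 *
            ∑ i, ∑ j, grad (u p.1) p.2 i j ^ 2) (cylinder Ω T) ∧
          ∫ p in cylinder Ω T, ν p.1 p.2 * ∑ i, ∑ j, grad (u p.1) p.2 i j ^ 2 ≤ 0)) := by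
  have H : IsAsymptoticEuler Ω T un0 un := by
    rcases hsol with h | ⟨κ, hκ, hκ0, h⟩
    · exact isAsymptoticEuler_of_euler hΩ h
    · exact isAsymptoticEuler_of_navierStokes hΩ hT.le hu0 hinit hκ hκ0 h
  obtain ⟨M, -, hM⟩ := H.exists_bound hT.le hu0 hinit
  have hm : ∀ t ∈ Ioc 0 T, toL2 Ω (u t) ∈ solenoidalSpace Ω := fun t ht =>
    toL2_mem_solenoidalSpace hΩ H hlim hu hM ht
  have hbd : ∀ t ∈ Ioc 0 T, ∀ x ∈ frontier Ω, (∀ i j, S t x i j = 0) ∨ u t x = 0 := by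
    intro t ht x hx
    by_cases h : ν t x ≠ 0 ∨ δ t x ≠ 0
    · exact .inr (hbdry t ht x hx h)
    · push Not at h
      refine .inl fun i j => ?_
      rw [hdecomp t ht x (frontier_subset_closure hx), h.1, h.2]
      ring
  -- the energy balance
  have hbal : ∀ a b, 0 < a → a ≤ b → b ≤ T →
      IntervalIntegrable (fun t => -2 * stressPower Ω u S t) volume a b ∧
      energyDeficit Ω u0 u b = energyDeficit Ω u0 u a + ∫ t in a..b, -2 * stressPower Ω u S t :=
    fun a b ha hab hb => by
      obtain ⟨h1, h2⟩ := norm_sq_sub_eq_integral_stressPower hΩ hu hSreg hm hbd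
        (fun φ hφ a b ha hab hb => inner_limit_sub_eq hΩ H hlim hu hM hR hS hSreg hφ ha hab hb)
        ha hab hb
      refine ⟨h1.const_mul _, ?_⟩
      rw [intervalIntegral.integral_const_mul, energyDeficit, energyDeficit]
      linarith
  have hr0 : ∀ t ∈ Ioc 0 T, 0 ≤ energyDeficit Ω u0 u t := fun t ht =>
    sub_nonneg.2 (pow_le_pow_left₀ (norm_nonneg _) (norm_limit_le hΩ H hlim hu hM hu0 hinit ht) 2)
  have hrlim : Tendsto (energyDeficit Ω u0 u) (𝓝[>] 0) (𝓝 0) := by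
    have := ((tendsto_toL2_nhdsGT_zero hΩ hT H hlim hu hM hu0 hinit).norm.pow 2).const_sub
      (‖toL2 Ω u0‖ ^ 2)
    rwa [sub_self] at this
  have hrc : ContinuousOn (energyDeficit Ω u0 u) (Ioo 0 T) := fun t ht => by
    have ht2 : t / 2 ≤ T := by linarith [ht.1, ht.2]
    have h1 := intervalIntegral.continuousOn_primitive_interval'
      (hbal (t / 2) T (half_pos ht.1) ht2 le_rfl).1 left_mem_uIcc
    rw [uIcc_of_le ht2] at h1
    exact (((continuousOn_const.add h1).congr fun s hs =>
      (hbal (t / 2) s (half_pos ht.1) hs.1 hs.2).2).continuousAt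
      (Icc_mem_nhds (half_lt_self ht.1) ht.2)).continuousWithinAt
  -- the stress, hence its power, is dominated by the energy deficit
  have hpow : ∀ C : ℝ, 0 ≤ C → ∀ t ∈ Ioo 0 T, (∀ x ∈ Ω, ∀ i j, |grad (u t) x i j| ≤ C) →
      |-2 * stressPower Ω u S t| ≤ 16 * C * energyDeficit Ω u0 u t := fun C hC t ht hgrad => by
    have := abs_stressPower_le hΩ hu hSreg ht hC (fun η hη hηc hηs hηK i j =>
      abs_integral_stress_slice_le hSreg hrc (fun ξ η K hξ hξ01 hψ hηK i j =>
        abs_integral_stress_le hT H hlim hu hu0 hinit hR hS hξ hξ01 hψ hηK i j)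
        ht hη hηc hηs hηK i j) hgrad
    rw [abs_mul, abs_neg, abs_two]
    linarith
  have hexp : ∀ C : ℝ, 0 ≤ C → ∀ a b, 0 < a → a ≤ b → b ≤ T →
      (∀ t ∈ Ioo a b, ∀ x ∈ Ω, ∀ i j, |grad (u t) x i j| ≤ C) →
      energyDeficit Ω u0 u b ≤ energyDeficit Ω u0 u a * Real.exp (16 * C * (b - a)) ∧
      energyDeficit Ω u0 u a ≤ energyDeficit Ω u0 u b * Real.exp (16 * C * (b - a)) :=
    fun C hC a b ha hab hb hgrad => le_mul_exp_of_abs_rate_le hab (hbal a b ha hab hb).1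
      (fun t ht => (hbal a t ha ht.1 (ht.2.trans hb)).2) (by positivity)
      fun t ht => hpow C hC t ⟨ha.trans ht.1, ht.2.trans_le hb⟩ (hgrad t ht)
  have hstrong : (∀ t ∈ Ioo 0 T, energyDeficit Ω u0 u t = 0) → StrongTendsto Ω T un u :=
    strongTendsto_of_energyDeficit_eq_zero hT H hlim hu hu0 hinit
  have hcontr : ∀ t ∈ Ioc 0 T, ∀ x ∈ Ω, ∑ i, ∑ j, S t x i j * grad (u t) x i j =
      -(ν t x * ((∑ i, ∑ j, (grad (u t) x i j + grad (u t) x j i) ^ 2) / 2)) := fun t ht x hx =>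
    stress_contraction (hu.sum_grad_eq_zero hΩ ht (hm t ht) hx) (hdecomp t ht x (subset_closure hx))
  have h12 : StrongTendsto Ω T un u → ∀ t ∈ Ioc 0 T, ∀ x ∈ Ω, ν t x = 0 := fun h t ht x hx => by
    have h1 := hcontr t ht x hx
    simp only [stress_eq_zero_of_strongTendsto hΩ H.curve hlim hR hS hSreg h ht hx, zero_mul,
      Finset.sum_const_zero] at h1
    rcases mul_eq_zero.1 (neg_eq_zero.1 h1.symm) with h2 | h2
    · exact h2
    · refine (hnorm t ht x (subset_closure hx) fun i j => ?_).1
      have h3 := (Finset.sum_eq_zero_iff_of_nonneg fun i _ =>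
        Finset.sum_nonneg fun j _ => sq_nonneg _).1 ((div_eq_zero_iff.1 h2).resolve_right two_ne_zero)
      have h4 := (Finset.sum_eq_zero_iff_of_nonneg fun j _ => sq_nonneg _).1
        (h3 i (Finset.mem_univ i)) j (Finset.mem_univ j)
      rw [strain, pow_eq_zero_iff two_ne_zero |>.1 h4, zero_div]
  -- integrands with a vanishing turbulent viscosity
  have hint0 : (∀ t ∈ Ioc 0 T, ∀ x ∈ Ω, ν t x = 0) → ∀ g : ℝ × Plane → ℝ,
      IntegrableOn (fun p : ℝ × Plane => ν p.1 p.2 * g p) (cylinder Ω T) ∧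
        ∫ p in cylinder Ω T, ν p.1 p.2 * g p ≤ 0 := fun h g => by
    have e : EqOn (fun p : ℝ × Plane => ν p.1 p.2 * g p) (fun _ => 0) (cylinder Ω T) :=
      fun p hp => by simp [h p.1 (Ioo_subset_Ioc_self hp.1) p.2 hp.2]
    have hms : MeasurableSet (cylinder Ω T) := (isOpen_Ioo.prod hΩ).measurableSet
    refine ⟨(integrableOn_congr_fun e hms).2 integrableOn_zero, ?_⟩
    rw [setIntegral_congr_fun hms e, integral_zero]
  refine ⟨?_, ?_⟩
  · tfae_have 1 → 2 := h12
    tfae_have 2 → 3 := fun h => hint0 h _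
    tfae_have 3 → 1 := by
      rintro ⟨hi, hle⟩
      -- the deficit at the final time is the total work of the stress
      have hi' := hi
      rw [IntegrableOn, volume_restrict_cylinder] at hi'
      have e : EqOn (fun t => ∫ x in Ω, ν t x *
          ((∑ i, ∑ j, (grad (u t) x i j + grad (u t) x j i) ^ 2) / 2))
          (fun t => -stressPower Ω u S t) (Ioo 0 T) := fun t ht => by
        beta_reduce
        rw [stressPower, ← integral_neg]
        exact setIntegral_congr_fun hΩ.measurableSet fun x hx => by
          simp only [hcontr t (Ioo_subset_Ioc_self ht) x hx, neg_neg]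
      have hP : IntegrableOn (fun t => -stressPower Ω u S t) (Ioo 0 T) :=
        (integrableOn_congr_fun e measurableSet_Ioo).1 hi'.integral_prod_left
      rw [integral_cylinder hi] at hle
      beta_reduce at hle
      rw [setIntegral_congr_fun measurableSet_Ioo e, ← integral_Ioc_eq_integral_Ioo,
        ← intervalIntegral.integral_of_le hT.le] at hle
      have hP2 : IntegrableOn (fun t => -2 * stressPower Ω u S t) (uIcc 0 T) := by
        rw [uIcc_of_le hT.le, integrableOn_Icc_iff_integrableOn_Ioo]
        exact (hP.const_mul 2).congr (.of_forall fun t => by simp)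
      have hlimP : Tendsto (fun s => ∫ t in s..T, -2 * stressPower Ω u S t) (𝓝[>] 0)
          (𝓝 (∫ t in (0 : ℝ)..T, -2 * stressPower Ω u S t)) :=
        ((intervalIntegral.continuousOn_primitive_interval_left hP2).continuousWithinAt
          left_mem_uIcc).mono_of_mem_nhdsWithin (by
            rw [uIcc_of_le hT.le]; exact Icc_mem_nhdsGT hT)
      have hTle : energyDeficit Ω u0 u T ≤ 0 := by
        have h1 : energyDeficit Ω u0 u T = 0 + ∫ t in (0 : ℝ)..T, -2 * stressPower Ω u S t :=
          tendsto_nhds_unique (tendsto_const_nhds.congr' (by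
            filter_upwards [Ioc_mem_nhdsGT hT] with s hs
            exact (hbal s T hs.1 hs.2 le_rfl).2)) (hrlim.add hlimP)
        rw [intervalIntegral.integral_const_mul] at h1
        rw [intervalIntegral.integral_neg] at hle
        linarith
      -- and the deficit cannot vanish at the final time unless it vanished before
      refine hstrong fun s hs => le_antisymm ?_ (hr0 s (Ioo_subset_Ioc_self hs))
      obtain ⟨C, hC⟩ := hu.bounds s hs
      refine ((hexp C C.2 s T hs.1 hs.2.le le_rfl fun t ht =>
        fun x hx => ((hC t (Ioo_subset_Icc_self ht)).1 x hx).2).2).trans ?_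
      exact mul_nonpos_of_nonpos_of_nonneg hTle (Real.exp_pos _).le
    tfae_finish
  · rintro ⟨C, hC⟩
    -- with bounded gradients the deficit cannot leave its initial value zero
    have hs : StrongTendsto Ω T un u := by
      refine hstrong fun t ht => le_antisymm ?_ (hr0 t (Ioo_subset_Ioc_self ht))
      have h1 : ∀ᶠ s in 𝓝[>] (0 : ℝ), energyDeficit Ω u0 u t ≤
          energyDeficit Ω u0 u s * Real.exp (16 * max C 0 * (t - s)) := by
        filter_upwards [Ioc_mem_nhdsGT ht.1] with s hs
        exact (hexp (max C 0) (le_max_right _ _) s t hs.1 hs.2 ht.2.le fun τ hτ x hx i j =>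
          (hC τ ⟨hs.1.trans hτ.1, (hτ.2.trans ht.2).le⟩ x hx i j).trans (le_max_left _ _)).1
      have h2 : Tendsto (fun s => Real.exp (16 * max C 0 * (t - s))) (𝓝[>] 0)
          (𝓝 (Real.exp (16 * max C 0 * (t - 0)))) :=
        (Continuous.tendsto (by fun_prop) _).mono_left nhdsWithin_le_nhds
      have h3 := hrlim.mul h2
      rw [zero_mul] at h3
      exact ge_of_tendsto h3 h1
    exact ⟨fun _ => hint0 (h12 hs) _, fun _ => hs⟩
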